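/- \textbf{Setting.} Let $\lambda$ be a regular cardinal and $\mathcal V=(\mathcal V_0,\otimes,I)$ a symmetric monoidal closed category that is locally $\lambda$-presentable as a closed category: $\mathcal V_0$ is locally $\lambda$-presentable, and the full subcategory $\mathcal V_\lambda$ of $\lambda$-presentable objects contains $I$ and is closed under $\otimes$. Write $A^X$ for the internal hom $[X,A]$. An \emph{enriched factorization system} $(\mathcal E,\mathcal M)$ on $\mathcal V$ is an orthogonal factorization system on $\mathcal V_0$ such that $\mathcal E$ is closed under $Z\otimes-$ for every $Z\in\mathcal V$; it is \emph{proper} if $\mathcal E$ consists of epimorphisms and $\mathcal M$ of monomorphisms. Fix a proper enriched factorization system $(\mathcal E,\mathcal M)$ with $\mathcal M$ closed in $\mathcal V^{\to}$ under $\lambda$-directed colimits. \textbf{Structures.} Let $\mathbb L$ be a $\lambda$-ary language: a set of function symbols $f\colon(X,Y)$ and a set of relation symbols $R\colon X$, all arities $X,Y$ being in $\mathcal V_\lambda$. An $\mathbb L$-structure is an object $A\in\mathcal V$ with morphisms $f_A\colon A^X\to A^Y$ and $\mathcal M$-subobjects $R_A\rightarrowtail A^X$. The $\mathcal V$-category $\mathrm{Str}(\mathbb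 L)$ has as hom-object $\mathrm{Str}(\mathbb L)(A,B)$ the subobject of $[A,B]$ that classifies the maps compatible with all function and relation symbols. \textbf{Formulas.} Terms, of input and output arities in $\mathcal V_\lambda$, are generated by the morphisms $Y\to X$ of $\mathcal V_\lambda$ (as $(X,Y)$-ary terms), the function symbols, powers $t^Z$ (of arity $(X\otimes Z,Y\otimes Z)$ for $t\colon(X,Y)$ and $Z\in\mathcal V_\lambda$), families of fewer than $\lambda$ terms $t_j\colon(X,Y_j)$ (giving an $(X,\sum_jY_j)$-ary term), and composition; an $(X,Y)$-ary term is interpreted in a structure $A$ as a morphism $A^X\to A^Y$. Atomic formulas are the equations $s(x)=t(x)$, interpreted in $A$ as the $\mathcal M$-part of the $(\mathcal E,\mathcal M)$-factorization of the equalizer of $s_A,t_A$, and the formulas $R^Y(t(z))$ with $Y\in\mathcal V_\lambda$, $R\colon X$ and $t\colon(Z,X\otimes Y)$, interpreted as the pullback of $R_A^Y\rightarrowtail (A^X)^Y\cong A^{X\otimes Y}$ along $t_A$. Conjunctions (of fewer than $\lambda$ formulas) are interpreted as intersections, and $\exists y$ by the $(\mathcal E,\mathcal M)$-factorization of the composite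 with the projection $A^{X+Y}\to A^X$. A \emph{limit $\mathbb L_{\lambda\lambda}$-theory} $\mathbb T$ is a set of sequents $(\forall x)(\varphi(x)\vdash(\exists!!y)(\psi(x,y)\wedge\varphi(x)))$, where $\varphi,\psi$ are conjunctions of fewer than $\lambda$ atomic formulas and the arities $X$ of $x$ and $Y$ of $y$ are in $\mathcal V_\lambda$. A structure $A$ satisfies such a sequent if $\varphi_A\subseteq(\exists y(\psi\wedge\varphi))_A$ as $\mathcal M$-subobjects of $A^X$, and the composite $(\psi\wedge\varphi)_A\rightarrowtail A^{X+Y}\to A^X$ lies in $\mathcal M$. $\mathrm{Mod}(\mathbb T)$ is the full subcategory of $\mathrm{Str}(\mathbb L)$ of the structures satisfying all sequents of $\mathbb T$. \textbf{Orthogonality.} A full subcategory of $\mathrm{Str}(\mathbb L)$ is a \emph{$\lambda$-orthogonality class} if there is a set $\mathcal H$ of morphisms $h\colon A\to B$ between $\lambda$-presentable $\mathbb L$-structures (those for which $\mathrm{Str}(\mathbb L)(A,-)$ preserves $\lambda$-filtered colimits) such that it consists of exactly those $K$ for which $\mathrm{Str}(\mathbb L)(h,K)\colon\mathrm{Str}(\mathbb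 L)(B,K)\to\mathrm{Str}(\mathbb L)(A,K)$ is an isomorphism in $\mathcal V$ for all $h\in\mathcal H$. \textbf{Theorem.} Let $\mathcal K$ be a full subcategory of $\mathrm{Str}(\mathbb L)$, and consider: \begin{enumerate} \item $\mathcal K=\mathrm{Mod}(\mathbb T)$ for a limit $\mathbb L_{\lambda\lambda}$-theory $\mathbb T$; \item $\mathcal K$ is a $\lambda$-orthogonality class in $\mathrm{Str}(\mathbb L)$. \end{enumerate} Then $(1)\Rightarrow(2)$ always holds, and $(2)\Rightarrow(1)$ holds if there is a proper enriched factorization system $(\mathcal E_0,\mathcal M_0)$ on $\mathcal V$ such that: $\mathcal M_0$ is closed in $\mathcal V^\to$ under $\lambda$-filtered colimits; $\mathcal E_0\subseteq\mathcal E$; the inclusion of $\mathrm{Str}(\mathbb L)$ into the category of $\mathbb L$-structures formed with respect to $(\mathcal E_0,\mathcal M_0)$ preserves $\lambda$-presentable objects; and either $\mathbb L$ has no function symbols, or the following hold: every input arity $X$ of a function symbol and every arity $X$ of a relation symbol is $\mathcal E_0$-stable ($e^X\in\mathcal E_0$ whenever $e\in\mathcal E_0$), and there is a set $\mathcal G\subseteq\mathcal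 V_\lambda$ of $\mathcal E_0$-projective objects ($\mathcal V_0(G,-)$ sends maps in $\mathcal E_0$ to surjections) such that every $X\in\mathcal V_\lambda$ admits a map $G\to X$ in $\mathcal E_0$ with $G\in\mathcal G$. -/

import Mathlib

open CategoryTheory Category MonoidalCategory Limits Opposite

universe w u

noncomputable section

namespace EnrichedLogic

/-! ### The base of enrichment -/

/-- A locally presentable category is complete: it is reflective in the presheaves on a small
model of its presentable objects. -/
theorem hasLimits_of_isCardinalLocallyPresentable (C : Type u) [Category.{w} C]
    (κ : Cardinal.{w}) [Fact κ.IsRegular] [IsCardinalLocallyPresentable C κ] :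
    HasLimits C := by
  let P := isCardinalPresentable C κ
  let F : SmallModel.{w} P.FullSubcategory ⥤ C :=
    (equivSmallModel.{w} P.FullSubcategory).inverse ⋙ P.ι
  have : F.IsDense := inferInstance
  let R := Presheaf.restrictedULiftYoneda.{w} F
  let L := (uliftYoneda.{w} : SmallModel.{w} P.FullSubcategory ⥤ _).leftKanExtension F
  let adj : L ⊣ R := Presheaf.uliftYonedaAdjunction.{w} L
    ((uliftYoneda.{w} : SmallModel.{w} P.FullSubcategory ⥤ _).leftKanExtensionUnit F)
  have : R.Full := inferInstanceAs (Presheaf.restrictedULiftYoneda.{w} F).Full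
  have : R.Faithful := inferInstanceAs (Presheaf.restrictedULiftYoneda.{w} F).Faithful
  let : Reflective R := { L := L, adj := adj }
  exact hasLimits_of_reflective R

/-- `V` is locally `κ`-presentable as a closed category: it is locally `κ`-presentable, and its
`κ`-presentable objects contain the unit and are closed under the tensor product. -/
class IsLocallyPresentableAsClosed (V : Type u) [Category.{w} V] [MonoidalCategory V]
    (κ : Cardinal.{w}) [Fact κ.IsRegular] : Prop extends IsCardinalLocallyPresentable V κ where
  presentable_unit : IsCardinalPresentable (𝟙_ V) κ
  presentable_tensor (X Y : V) : IsCardinalPresentable X κ → IsCardinalPresentable Y κ →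
    IsCardinalPresentable (X ⊗ Y) κ

set_option synthInstance.checkSynthOrder false in
instance IsLocallyPresentableAsClosed.hasLimits (V : Type u) [Category.{w} V]
    [MonoidalCategory V] (κ : Cardinal.{w}) {_ : Fact κ.IsRegular}
    [IsLocallyPresentableAsClosed V κ] : HasLimits V :=
  hasLimits_of_isCardinalLocallyPresentable V κ

section Factorization

variable (V : Type u) [Category.{w} V] [MonoidalCategory V]

/-- An enriched orthogonal factorization system `(left, right)` on `V`: `left` is closed under
tensoring with the objects of `V` (for symmetric `V` the side is immaterial). -/
structure EnrichedFactorizationSystem where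
  left : MorphismProperty V
  right : MorphismProperty V
  left_respectsIso : left.RespectsIso
  right_respectsIso : right.RespectsIso
  hasFactorization : left.HasFactorization right
  existsUnique_diagonal {A B X Y : V} (e : A ⟶ B) (m : X ⟶ Y) (he : left e) (hm : right m)
    (a : A ⟶ X) (b : B ⟶ Y) (sq : a ≫ m = e ≫ b) : ∃! d : B ⟶ X, e ≫ d = a ∧ d ≫ m = b
  left_whiskerLeft (Z : V) {A B : V} (e : A ⟶ B) (he : left e) : left (Z ◁ e)

/-- A proper enriched factorization system: the left class consists of epimorphisms and the right
class of monomorphisms. -/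
structure ProperFactorizationSystem extends EnrichedFactorizationSystem V where
  epi_of_left {A B : V} (e : A ⟶ B) (he : left e) : Epi e
  mono_of_right {A B : V} (m : A ⟶ B) (hm : right m) : Mono m

variable {V}

namespace ProperFactorizationSystem

variable (S : ProperFactorizationSystem V)

theorem right_of_lifting {X Y : V} (f : X ⟶ Y)
    (hf : ∀ {A B : V} (e : A ⟶ B), S.left e → ∀ (a : A ⟶ X) (b : B ⟶ Y), a ≫ f = e ≫ b →
      ∃ d : B ⟶ X, e ≫ d = a ∧ d ≫ f = b) : S.right f := by
  have := S.hasFactorization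
  have := S.right_respectsIso
  let F := MorphismProperty.factorizationData S.left S.right f
  obtain ⟨d, h₁, h₂⟩ := hf F.i F.hi (𝟙 X) F.p (by simp)
  have := S.epi_of_left _ F.hi
  have : IsIso F.i := ⟨d, h₁, by rw [← cancel_epi F.i, reassoc_of% h₁, comp_id]⟩
  rw [← F.fac]
  exact MorphismProperty.RespectsIso.precomp _ _ _ F.hp

theorem exists_lift {A B X Y : V} {e : A ⟶ B} {m : X ⟶ Y} (he : S.left e) (hm : S.right m)
    (a : A ⟶ X) (b : B ⟶ Y) (sq : a ≫ m = e ≫ b) : ∃ d : B ⟶ X, e ≫ d = a ∧ d ≫ m = b :=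
  (S.existsUnique_diagonal e m he hm a b sq).exists

theorem right_le_of_left_le {S₀ S : ProperFactorizationSystem V} (h : S₀.left ≤ S.left) :
    S.right ≤ S₀.right := fun _ _ m hm =>
  S₀.right_of_lifting m fun e he a b sq => S.exists_lift (h e he) hm a b sq

/-- The right class is closed in the arrow category under `κ`-filtered (equivalently,
`κ`-directed) colimits. -/
def RightClosedUnderFilteredColimits (κ : Cardinal.{w}) [Fact κ.IsRegular] : Prop :=
  ∀ (J : Type w) [SmallCategory J] [IsCardinalFiltered J κ],
    S.right.IsStableUnderColimitsOfShape J

/-- `X` is projective with respect to the left class. -/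
def IsLeftProjective (X : V) : Prop :=
  ∀ {A B : V} (e : A ⟶ B), S.left e → Function.Surjective (fun g : X ⟶ A => g ≫ e)

/-- `X` is stable: the power `e ^ X` is in the left class whenever `e` is. -/
def IsLeftStable [MonoidalClosed V] (X : V) : Prop :=
  ∀ {A B : V} (e : A ⟶ B), S.left e → S.left ((ihom X).map e)

/-- `G` is a (small) generator, relative to the left class, for the `κ`-presentable objects. -/
def IsLeftGenerator (κ : Cardinal.{w}) [Fact κ.IsRegular] (G : Set V) : Prop :=
  Small.{w} G ∧ (∀ X ∈ G, IsCardinalPresentable X κ) ∧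
    ∀ X : V, IsCardinalPresentable X κ → ∃ Y ∈ G, ∃ e : Y ⟶ X, S.left e

end ProperFactorizationSystem

/-- Subobjects whose inclusion lies in the right class. -/
structure MSubobject (S : ProperFactorizationSystem V) (B : V) where
  obj : V
  arrow : obj ⟶ B
  mem : S.right arrow

namespace MSubobject

variable {S : ProperFactorizationSystem V} {B : V}

instance (P : MSubobject S B) : Mono P.arrow := S.mono_of_right _ P.mem

/-- Inclusion of subobjects. -/
protected def le (P Q : MSubobject S B) : Prop :=
  ∃ k : P.obj ⟶ Q.obj, k ≫ Q.arrow = P.arrow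

/-- The image of `f` given by its factorization. -/
def image {A : V} (S : ProperFactorizationSystem V) (f : A ⟶ B) : MSubobject S B :=
  have := S.hasFactorization
  { obj := (MorphismProperty.factorizationData S.left S.right f).Z
    arrow := (MorphismProperty.factorizationData S.left S.right f).p
    mem := (MorphismProperty.factorizationData S.left S.right f).hp }

/-- Pullback of a subobject along `t`. -/
def pullback [HasLimits V] {A : V} (t : A ⟶ B) (P : MSubobject S B) : MSubobject S A where
  obj := Limits.pullback P.arrow t
  arrow := Limits.pullback.snd P.arrow t
  mem := S.right_of_lifting _ fun e he a b sq => by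
    obtain ⟨d, h₁, h₂⟩ := S.exists_lift he P.mem (a ≫ Limits.pullback.fst P.arrow t) (b ≫ t)
      (by rw [assoc, Limits.pullback.condition, reassoc_of% sq])
    exact ⟨Limits.pullback.lift d b h₂, by
      apply Limits.pullback.hom_ext
      · rw [assoc, Limits.pullback.lift_fst, h₁]
      · rw [assoc, Limits.pullback.lift_snd, sq], Limits.pullback.lift_snd _ _ _⟩

/-- The intersection (wide pullback) of a family of subobjects. -/
def inter [HasLimits V] {J : Type w} (P : J → MSubobject S B) : MSubobject S B where
  obj := widePullback B (fun j => (P j).obj) (fun j => (P j).arrow)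
  arrow := WidePullback.base _
  mem := S.right_of_lifting _ fun e he a b sq => by
    have h (j : J) := S.exists_lift he (P j).mem (a ≫ WidePullback.π _ j) b (by
      rw [assoc, WidePullback.π_arrow, sq])
    choose d h₁ h₂ using h
    refine ⟨WidePullback.lift b d h₂, ?_, WidePullback.lift_base _ _ _ _⟩
    apply WidePullback.hom_ext
    · intro j
      rw [assoc, WidePullback.lift_π, h₁]
    · rw [assoc, WidePullback.lift_base, sq]

/-- The power `P ^ Y` as a subobject of `B ^ Y`. -/
def power [MonoidalClosed V] (Y : V) (P : MSubobject S B) : MSubobject S ((ihom Y).obj B) where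
  obj := (ihom Y).obj P.obj
  arrow := (ihom Y).map P.arrow
  mem := S.right_of_lifting _ fun e he a b sq => by
    obtain ⟨d, h₁, h₂⟩ := S.exists_lift (S.left_whiskerLeft Y e he) P.mem
      (MonoidalClosed.uncurry a) (MonoidalClosed.uncurry b) (by
        rw [← MonoidalClosed.uncurry_natural_right, ← MonoidalClosed.uncurry_natural_left, sq])
    refine ⟨MonoidalClosed.curry d, ?_, ?_⟩
    · rw [← MonoidalClosed.curry_natural_left, h₁, MonoidalClosed.curry_uncurry]
    · rw [← MonoidalClosed.curry_natural_right, h₂, MonoidalClosed.curry_uncurry]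

end MSubobject

end Factorization

/-! ### Languages, structures, and the enriched category of structures -/

/-- A single-sorted language: function symbols `f : (dom f, cod f)` and relation symbols
`R : ar R`, with arities in `V`. -/
structure Language (V : Type u) where
  Func : Type w
  dom : Func → V
  cod : Func → V
  Rel : Type w
  ar : Rel → V

/-- All arities are `κ`-presentable. -/
structure Language.IsAry {V : Type u} [Category.{w} V] (L : Language.{w} V) (κ : Cardinal.{w})
    [Fact κ.IsRegular] : Prop where
  dom (f : L.Func) : IsCardinalPresentable (L.dom f) κ
  cod (f : L.Func) : IsCardinalPresentable (L.cod f) κ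
  ar (R : L.Rel) : IsCardinalPresentable (L.ar R) κ

section Structures

variable {V : Type u} [Category.{w} V] [MonoidalCategory V] [MonoidalClosed V]

/-- Structures for the language `L`; the power `A ^ X` is the internal hom `(ihom X).obj A`. -/
structure Str (S : ProperFactorizationSystem V) (L : Language.{w} V) where
  carrier : V
  func (f : L.Func) : (ihom (L.dom f)).obj carrier ⟶ (ihom (L.cod f)).obj carrier
  rel (R : L.Rel) : MSubobject S ((ihom (L.ar R)).obj carrier)

namespace Str

variable {S : ProperFactorizationSystem V} {L : Language.{w} V}

/-- Morphisms of structures. -/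
@[ext]
structure Hom (A B : Str S L) where
  hom : A.carrier ⟶ B.carrier
  func_comm (f : L.Func) :
    A.func f ≫ (ihom (L.cod f)).map hom = (ihom (L.dom f)).map hom ≫ B.func f
  rel_comm (R : L.Rel) : ∃ k : (A.rel R).obj ⟶ (B.rel R).obj,
    k ≫ (B.rel R).arrow = (A.rel R).arrow ≫ (ihom (L.ar R)).map hom

instance : Category (Str S L) where
  Hom := Hom
  id A := ⟨𝟙 _, by simp, fun R => ⟨𝟙 _, by simp⟩⟩
  comp {A B C} h g := ⟨h.hom ≫ g.hom, fun f => by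
      rw [Functor.map_comp, Functor.map_comp, reassoc_of% h.func_comm f, g.func_comm f, assoc],
    fun R => by
      obtain ⟨k, hk⟩ := h.rel_comm R
      obtain ⟨l, hl⟩ := g.rel_comm R
      exact ⟨k ≫ l, by rw [assoc, hl, reassoc_of% hk, Functor.map_comp]⟩⟩
  id_comp _ := Hom.ext (id_comp _)
  comp_id _ := Hom.ext (comp_id _)
  assoc _ _ _ := Hom.ext (assoc _ _ _)

/-- The morphism `[A, B] ⟶ [A ^ X, B ^ X]` giving the action of `(-) ^ X` on hom objects. -/
def strength (X A B : V) :
    (ihom A).obj B ⟶ (ihom ((ihom X).obj A)).obj ((ihom X).obj B) :=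
  MonoidalClosed.curry (MonoidalClosed.comp X A B)

/-- `[A, B] ⟶ [A ^ X, B ^ X] ⟶ [A ^ X, B ^ Y]`, postcomposing with the symbol on `B`. -/
def homFuncLeft (A B : Str S L) (f : L.Func) : (ihom A.carrier).obj B.carrier ⟶
    (ihom ((ihom (L.dom f)).obj A.carrier)).obj ((ihom (L.cod f)).obj B.carrier) :=
  strength (L.dom f) A.carrier B.carrier ≫ (ihom _).map (B.func f)

/-- `[A, B] ⟶ [A ^ Y, B ^ Y] ⟶ [A ^ X, B ^ Y]`, precomposing with the symbol on `A`. -/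
def homFuncRight (A B : Str S L) (f : L.Func) : (ihom A.carrier).obj B.carrier ⟶
    (ihom ((ihom (L.dom f)).obj A.carrier)).obj ((ihom (L.cod f)).obj B.carrier) :=
  strength (L.cod f) A.carrier B.carrier ≫ (MonoidalClosed.pre (A.func f)).app _

/-- `[A, B] ⟶ [A ^ X, B ^ X] ⟶ [R_A, B ^ X]`, precomposing with the inclusion of `R_A`. -/
def homRel (A B : Str S L) (R : L.Rel) : (ihom A.carrier).obj B.carrier ⟶
    (ihom (A.rel R).obj).obj ((ihom (L.ar R)).obj B.carrier) :=
  strength (L.ar R) A.carrier B.carrier ≫ (MonoidalClosed.pre (A.rel R).arrow).app _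

/-- `g` is a generalized (indexed by `W`) morphism of structures from `A` to `B`. -/
structure IsStrHom {A B : Str S L} {W : V} (g : W ⟶ (ihom A.carrier).obj B.carrier) : Prop where
  func (f : L.Func) :
    ((ihom (L.dom f)).obj A.carrier ◁ g) ≫ MonoidalClosed.comp _ _ _ ≫ B.func f =
      (A.func f ▷ W) ≫ ((ihom (L.cod f)).obj A.carrier ◁ g) ≫ MonoidalClosed.comp _ _ _
  rel (R : L.Rel) : ∃ k : (A.rel R).obj ⊗ W ⟶ (B.rel R).obj, k ≫ (B.rel R).arrow =
    ((A.rel R).arrow ▷ W) ≫ ((ihom (L.ar R)).obj A.carrier ◁ g) ≫ MonoidalClosed.comp _ _ _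

theorem comp_homFunc_iff {A B : Str S L} {W : V} (g : W ⟶ (ihom A.carrier).obj B.carrier)
    (f : L.Func) : g ≫ homFuncLeft A B f = g ≫ homFuncRight A B f ↔
    ((ihom (L.dom f)).obj A.carrier ◁ g) ≫ MonoidalClosed.comp _ _ _ ≫ B.func f =
      (A.func f ▷ W) ≫ ((ihom (L.cod f)).obj A.carrier ◁ g) ≫ MonoidalClosed.comp _ _ _ := by
  unfold homFuncLeft homFuncRight strength
  rw [MonoidalClosed.curry_pre_app, ← MonoidalClosed.curry_natural_right,
    ← MonoidalClosed.curry_natural_left, ← MonoidalClosed.curry_natural_left,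
    MonoidalClosed.curry_injective.eq_iff, whisker_exchange_assoc]

theorem comp_homRel {A B : Str S L} {W : V} (g : W ⟶ (ihom A.carrier).obj B.carrier)
    (R : L.Rel) : g ≫ homRel A B R = MonoidalClosed.curry
      (((A.rel R).arrow ▷ W) ≫ ((ihom (L.ar R)).obj A.carrier ◁ g) ≫
        MonoidalClosed.comp _ _ _) := by
  unfold homRel strength
  rw [MonoidalClosed.curry_pre_app, ← MonoidalClosed.curry_natural_left, whisker_exchange_assoc]

@[simp]
theorem id_hom (A : Str S L) : Hom.hom (𝟙 A) = 𝟙 A.carrier := rfl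

@[simp]
theorem comp_hom {A B C : Str S L} (h : A ⟶ B) (g : B ⟶ C) :
    Hom.hom (h ≫ g) = Hom.hom h ≫ Hom.hom g := rfl

theorem isStrHom_curry' {A B : Str S L} (h : A ⟶ B) :
    IsStrHom (A := A) (B := B) (MonoidalClosed.curry' (Hom.hom h)) where
  func f := by
    rw [MonoidalClosed.whiskerLeft_curry'_comp, MonoidalClosed.whiskerLeft_curry'_comp_assoc,
      rightUnitor_naturality_assoc, Hom.func_comm h f]
  rel R := by
    obtain ⟨k, hk⟩ := Hom.rel_comm h R
    refine ⟨(ρ_ _).hom ≫ k, ?_⟩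
    rw [MonoidalClosed.whiskerLeft_curry'_comp, rightUnitor_naturality_assoc, assoc, hk]

/-- A morphism of structures from a generalized element `𝟙_ V ⟶ [A, B]`. -/
def IsStrHom.toHom {A B : Str S L} {g : 𝟙_ V ⟶ (ihom A.carrier).obj B.carrier}
    (hg : IsStrHom g) : A ⟶ B where
  hom := MonoidalClosed.uncurry' g
  func_comm f := by
    have h := hg.func f
    obtain ⟨k, rfl⟩ : ∃ k, g = MonoidalClosed.curry' k :=
      ⟨_, (MonoidalClosed.curry'_uncurry' g).symm⟩
    rw [MonoidalClosed.whiskerLeft_curry'_comp, MonoidalClosed.whiskerLeft_curry'_comp_assoc,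
      rightUnitor_naturality_assoc, cancel_epi] at h
    rw [MonoidalClosed.uncurry'_curry', h]
  rel_comm R := by
    obtain ⟨k, hk⟩ := hg.rel R
    obtain ⟨l, rfl⟩ : ∃ l, g = MonoidalClosed.curry' l :=
      ⟨_, (MonoidalClosed.curry'_uncurry' g).symm⟩
    rw [MonoidalClosed.whiskerLeft_curry'_comp, rightUnitor_naturality_assoc] at hk
    exact ⟨(ρ_ _).inv ≫ k, by
      rw [MonoidalClosed.uncurry'_curry', assoc, hk, Iso.inv_hom_id_assoc]⟩

theorem whiskerLeft_comp_comp {A B C X W W' : V} (g : W ⟶ (ihom A).obj B)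
    (g' : W' ⟶ (ihom B).obj C) :
    (ihom X).obj A ◁ ((g ⊗ₘ g') ≫ MonoidalClosed.comp A B C) ≫ MonoidalClosed.comp X A C =
      (α_ _ _ _).inv ≫ (((ihom X).obj A ◁ g) ≫ MonoidalClosed.comp X A B) ▷ W' ≫
        ((ihom X).obj B ◁ g') ≫ MonoidalClosed.comp X B C := by
  rw [MonoidalCategory.whiskerLeft_comp, assoc, ← MonoidalClosed.assoc,
    MonoidalCategory.tensorHom_def,
    MonoidalCategory.whiskerLeft_comp, assoc, associator_inv_naturality_right_assoc,
    whisker_exchange_assoc, associator_inv_naturality_middle_assoc, comp_whiskerRight_assoc]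

theorem IsStrHom.comp {A B C : Str S L} {W W' : V} {g : W ⟶ (ihom A.carrier).obj B.carrier}
    {g' : W' ⟶ (ihom B.carrier).obj C.carrier} (hg : IsStrHom g) (hg' : IsStrHom g') :
    IsStrHom (A := A) (B := C) ((g ⊗ₘ g') ≫ MonoidalClosed.comp _ _ _) where
  func f := by
    rw [reassoc_of% whiskerLeft_comp_comp, whiskerLeft_comp_comp, hg'.func f,
      ← comp_whiskerRight_assoc, assoc, hg.func f, associator_inv_naturality_left_assoc,
      ← comp_whiskerRight_assoc]
  rel R := by
    obtain ⟨k, hk⟩ := hg.rel R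
    obtain ⟨k', hk'⟩ := hg'.rel R
    refine ⟨(α_ _ _ _).inv ≫ k ▷ W' ≫ k', ?_⟩
    rw [whiskerLeft_comp_comp, associator_inv_naturality_left_assoc, ← comp_whiskerRight_assoc,
      ← hk, comp_whiskerRight_assoc, assoc, assoc, hk']

theorem isStrHom_id (A : Str S L) :
    IsStrHom (A := A) (B := A) (MonoidalClosed.id A.carrier) := by
  have h := isStrHom_curry' (𝟙 A)
  rwa [id_hom, MonoidalClosed.curry'_id] at h

variable [HasLimits V]

/-- The product over all relation symbols of `[R_A, R_B] ⟶ [R_A, B ^ X]`. -/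
abbrev homRelObj (A B : Str S L) :
    (∏ᶜ fun R => (ihom (A.rel R).obj).obj (B.rel R).obj) ⟶
      ∏ᶜ fun R => (ihom (A.rel R).obj).obj ((ihom (L.ar R)).obj B.carrier) :=
  Limits.Pi.map fun R => (ihom (A.rel R).obj).map (B.rel R).arrow

/-- The hom object of structures: the subobject of `[A, B]` cut out by equalizing the two actions
of every function symbol, and by pulling back `[R_A, R_B] ⟶ [R_A, B ^ X]` for every relation
symbol. -/
abbrev homObj (A B : Str S L) : V :=
  Limits.pullback
    (equalizer.ι (Pi.lift (homFuncLeft A B)) (Pi.lift (homFuncRight A B)) ≫ Pi.lift (homRel A B))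
    (homRelObj A B)

/-- The inclusion of the hom object of structures into `[A, B]`. -/
def homι (A B : Str S L) : homObj A B ⟶ (ihom A.carrier).obj B.carrier :=
  Limits.pullback.fst _ _ ≫ equalizer.ι _ _

instance (A B : Str S L) : Mono (homι A B) := by
  have : Mono (homRelObj A B) := inferInstance
  exact mono_comp _ _

/-- Universal property of the hom object: it classifies generalized morphisms of structures. -/
theorem exists_lift_iff {A B : Str S L} {W : V} (g : W ⟶ (ihom A.carrier).obj B.carrier) :
    (∃ l : W ⟶ homObj A B, l ≫ homι A B = g) ↔ IsStrHom g := by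
  constructor
  · rintro ⟨l, rfl⟩
    refine ⟨fun f => ?_, fun R => ?_⟩
    · rw [← comp_homFunc_iff]
      have h := equalizer.condition (Pi.lift (homFuncLeft A B)) (Pi.lift (homFuncRight A B)) =≫
        Pi.π _ f
      simp only [assoc, Pi.lift_π] at h
      simp only [homι, assoc, h]
    · have h := Limits.pullback.condition (f := equalizer.ι (Pi.lift (homFuncLeft A B))
        (Pi.lift (homFuncRight A B)) ≫ Pi.lift (homRel A B)) (g := homRelObj A B) =≫ Pi.π _ R
      simp only [assoc, Pi.lift_π, Limits.Pi.map_π] at h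
      refine ⟨MonoidalClosed.uncurry (l ≫ Limits.pullback.snd _ _ ≫ Pi.π _ R), ?_⟩
      apply MonoidalClosed.curry_injective
      rw [← comp_homRel, MonoidalClosed.curry_natural_right, MonoidalClosed.curry_uncurry]
      simp only [homι, assoc, h]
  · intro hg
    choose k hk using hg.rel
    refine ⟨Limits.pullback.lift (equalizer.lift g ?_)
      (Pi.lift fun R => MonoidalClosed.curry (k R)) ?_, ?_⟩
    · apply Pi.hom_ext
      intro f
      simpa using (comp_homFunc_iff g f).2 (hg.func f)
    · apply Pi.hom_ext
      intro R
      simp only [assoc, Pi.lift_π, Limits.Pi.map_π, equalizer.lift_ι_assoc, Pi.lift_π_assoc]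
      rw [comp_homRel, ← MonoidalClosed.curry_natural_right, hk]
    · rw [homι, Limits.pullback.lift_fst_assoc, equalizer.lift_ι]

/-- The factorization of a generalized morphism of structures through the hom object. -/
def homLift {A B : Str S L} {W : V} (g : W ⟶ (ihom A.carrier).obj B.carrier) (hg : IsStrHom g) :
    W ⟶ homObj A B :=
  ((exists_lift_iff g).2 hg).choose

@[simp]
theorem homLift_ι {A B : Str S L} {W : V} (g : W ⟶ (ihom A.carrier).obj B.carrier)
    (hg : IsStrHom g) : homLift g hg ≫ homι A B = g :=
  ((exists_lift_iff g).2 hg).choose_spec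

theorem isStrHom_homι (A B : Str S L) : IsStrHom (homι A B) :=
  (exists_lift_iff _).1 ⟨𝟙 _, id_comp _⟩

/-- The enriched category of structures. -/
instance enrichedCategory : EnrichedCategory V (Str S L) where
  Hom := homObj
  id A := homLift (MonoidalClosed.id A.carrier) (isStrHom_id A)
  comp A B C := homLift ((homι A B ⊗ₘ homι B C) ≫ MonoidalClosed.comp _ _ _)
    ((isStrHom_homι A B).comp (isStrHom_homι B C))
  id_comp A B := by
    rw [← cancel_mono (homι A B), assoc, assoc, homLift_ι, id_comp,
      MonoidalCategory.tensorHom_def, assoc,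
      ← comp_whiskerRight_assoc, homLift_ι, ← whisker_exchange_assoc,
      id_whiskerLeft_assoc, Iso.inv_hom_id_assoc, MonoidalClosed.id_comp, comp_id]
  comp_id A B := by
    rw [← cancel_mono (homι A B), assoc, assoc, homLift_ι, id_comp,
      MonoidalCategory.tensorHom_def', assoc, ← MonoidalCategory.whiskerLeft_comp_assoc, homLift_ι,
      whisker_exchange_assoc, MonoidalCategory.whiskerRight_id_assoc, Iso.inv_hom_id_assoc,
      MonoidalClosed.comp_id, comp_id]
  assoc A B C D := by
    rw [← cancel_mono (homι A D), assoc, assoc, assoc, homLift_ι, homLift_ι,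
      ← tensorHom_id, ← id_tensorHom, tensorHom_comp_tensorHom_assoc,
      tensorHom_comp_tensorHom_assoc, homLift_ι, homLift_ι, id_comp, id_comp,
      ← comp_id (homι C D), ← tensorHom_comp_tensorHom_assoc, comp_id,
      ← associator_inv_naturality_assoc, tensorHom_id, MonoidalClosed.assoc, ← id_tensorHom,
      tensorHom_comp_tensorHom_assoc, comp_id]

theorem eId_homι (A : Str S L) : eId V A ≫ homι A A = MonoidalClosed.id A.carrier :=
  homLift_ι _ (isStrHom_id A)

theorem eComp_homι (A B C : Str S L) : eComp V A B C ≫ homι A C =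
    (homι A B ⊗ₘ homι B C) ≫ MonoidalClosed.comp _ _ _ :=
  homLift_ι _ ((isStrHom_homι A B).comp (isStrHom_homι B C))

/-- Morphisms of structures are the generalized elements `𝟙_ V ⟶ [A, B]` of the hom object. -/
def homEquiv (A B : Str S L) : (A ⟶ B) ≃ (𝟙_ V ⟶ homObj A B) where
  toFun h := homLift (MonoidalClosed.curry' (Hom.hom h)) (isStrHom_curry' h)
  invFun l := ((exists_lift_iff (l ≫ homι A B)).1 ⟨l, rfl⟩).toHom
  left_inv h := Hom.ext (by simp [IsStrHom.toHom])
  right_inv l := by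
    rw [← cancel_mono (homι A B)]
    simp [IsStrHom.toHom]

theorem homEquiv_homι {A B : Str S L} (h : A ⟶ B) :
    homEquiv A B h ≫ homι A B = MonoidalClosed.curry' (Hom.hom h) :=
  homLift_ι _ (isStrHom_curry' h)

instance enrichedOrdinaryCategory : EnrichedOrdinaryCategory V (Str S L) where
  homEquiv := homEquiv _ _
  homEquiv_id A := by
    rw [← cancel_mono (homι A A), homEquiv_homι, id_hom, MonoidalClosed.curry'_id]
    exact (eId_homι A).symm
  homEquiv_comp {A B C} f g := by
    rw [← cancel_mono (homι A C), homEquiv_homι, assoc, assoc]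
    refine Eq.trans ?_ (congrArg (fun t => (λ_ (𝟙_ V)).inv ≫ (homEquiv A B f ⊗ₘ homEquiv B C g) ≫ t)
      (eComp_homι A B C).symm)
    rw [tensorHom_comp_tensorHom_assoc, homEquiv_homι, homEquiv_homι, comp_hom,
      MonoidalClosed.curry'_comp]

/-- `A` is `κ`-presentable in the enriched category of structures: the hom functor
`Str(A, -)` into `V` preserves `κ`-filtered colimits. -/
def IsEnrichedPresentable (κ : Cardinal.{w}) [Fact κ.IsRegular] (A : Str S L) : Prop :=
  (eCoyoneda V A).IsCardinalAccessible κ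

/-- `K` is orthogonal to `h : A ⟶ B`: the map `Str(h, K) : Str(B, K) ⟶ Str(A, K)` in `V` is an
isomorphism. -/
def IsOrthogonalTo {A B : Str S L} (h : A ⟶ B) (K : Str S L) : Prop :=
  IsIso (eHomWhiskerRight V h K)

/-- A full subcategory is a `κ`-orthogonality class if it is spanned by the objects orthogonal to
a (small) set of morphisms between `κ`-presentable structures. -/
def IsOrthogonalityClass (κ : Cardinal.{w}) [Fact κ.IsRegular] (P : ObjectProperty (Str S L)) :
    Prop :=
  ∃ (ι : Type w) (A B : ι → Str S L) (h : ∀ i, A i ⟶ B i),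
    (∀ i, IsEnrichedPresentable κ (A i) ∧ IsEnrichedPresentable κ (B i)) ∧
    ∀ K : Str S L, P K ↔ ∀ i, IsOrthogonalTo (h i) K

/-- If `S₀.left ≤ S.left`, then `S.right ≤ S₀.right` and structures relative to `S` are, in
particular, structures relative to `S₀`. -/
def inclusion {S₀ S : ProperFactorizationSystem V} (h : S₀.left ≤ S.left) :
    Str S L ⥤ Str S₀ L where
  obj A :=
    { carrier := A.carrier
      func := A.func
      rel := fun R => ⟨(A.rel R).obj, (A.rel R).arrow,
        ProperFactorizationSystem.right_le_of_left_le h _ (A.rel R).mem⟩ }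
  map {A B} f := ⟨Hom.hom (A := A) (B := B) f, Hom.func_comm (A := A) (B := B) f,
    Hom.rel_comm (A := A) (B := B) f⟩

end Str

end Structures

/-! ### Terms, formulas and limit theories -/

section Logic

theorem isCardinalPresentable_coprod {V : Type u} [Category.{w} V] [HasColimits V]
    {κ : Cardinal.{w}} [Fact κ.IsRegular] {X Y : V} (hX : IsCardinalPresentable X κ)
    (hY : IsCardinalPresentable Y κ) : IsCardinalPresentable (X ⨿ Y) κ := by
  have (k : Discrete WalkingPair) : IsCardinalPresentable ((pair X Y).obj k) κ := by
    obtain ⟨_ | _⟩ := k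
    · exact hX
    · exact hY
  exact isCardinalPresentable_of_isColimit _ (colimit.isColimit (pair X Y)) κ
    (hasCardinalLT_of_finite _ κ (Fact.out : κ.IsRegular).aleph0_le)

variable {V : Type u} [Category.{w} V] [MonoidalCategory V]

/-- The isomorphism `(B ^ X) ^ Z ≅ B ^ (X ⊗ Z)`. -/
def powerTensorIso [MonoidalClosed V] (X Z B : V) :
    (ihom Z).obj ((ihom X).obj B) ≅ (ihom (X ⊗ Z)).obj B where
  hom := MonoidalClosed.curry ((α_ X Z _).hom ≫
    X ◁ (ihom.ev Z).app ((ihom X).obj B) ≫ (ihom.ev X).app B)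
  inv := MonoidalClosed.curry (MonoidalClosed.curry ((α_ X Z _).inv ≫ (ihom.ev (X ⊗ Z)).app B))
  hom_inv_id := by
    rw [← MonoidalClosed.curry_natural_left, ← MonoidalClosed.curry_natural_left,
      MonoidalClosed.curry_eq_iff, MonoidalClosed.curry_eq_iff,
      associator_inv_naturality_right_assoc, MonoidalClosed.whiskerLeft_curry_ihom_ev_app,
      Iso.inv_hom_id_assoc, MonoidalClosed.uncurry_id_eq_ev, MonoidalClosed.uncurry_eq]
  inv_hom_id := by
    rw [← MonoidalClosed.curry_natural_left, MonoidalClosed.curry_eq_iff,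
      associator_naturality_right_assoc, ← MonoidalCategory.whiskerLeft_comp_assoc,
      MonoidalClosed.whiskerLeft_curry_ihom_ev_app, MonoidalClosed.whiskerLeft_curry_ihom_ev_app,
      Iso.hom_inv_id_assoc, MonoidalClosed.uncurry_id_eq_ev]

variable [HasColimits V] (L : Language.{w} V) (κ : Cardinal.{w}) [Fact κ.IsRegular]

/-- Terms with `κ`-presentable input and output arities: morphisms of `V`, function symbols, powers
of terms, families of fewer than `κ` terms with common input, and composites. -/
inductive LTerm : V → V → Type (max u (w + 1))
  | ofHom {X Y : V} (hX : IsCardinalPresentable X κ) (hY : IsCardinalPresentable Y κ)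
      (f : Y ⟶ X) : LTerm X Y
  | symb (f : L.Func) : LTerm (L.dom f) (L.cod f)
  | pow {X Y : V} (Z : V) (hZ : IsCardinalPresentable Z κ) (t : LTerm X Y) :
      LTerm (X ⊗ Z) (Y ⊗ Z)
  | family {X : V} (hX : IsCardinalPresentable X κ) {J : Type w} (hJ : Cardinal.mk J < κ)
      (Y : J → V) (t : ∀ j, LTerm X (Y j)) : LTerm X (∐ Y)
  | comp {X Y Z : V} (t : LTerm X Y) (s : LTerm Y Z) : LTerm X Z

/-- Atomic formulas in context `Z`: equations between terms, and `R ^ Y (t)`. -/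
inductive Atomic (Z : V) : Type (max u (w + 1))
  | eq {Y : V} (s t : LTerm L κ Z Y) : Atomic Z
  | rel (R : L.Rel) (Y : V) (hY : IsCardinalPresentable Y κ) (t : LTerm L κ Z (L.ar R ⊗ Y)) :
      Atomic Z

/-- Conjunctions of fewer than `κ` atomic formulas in context `Z`. -/
structure Conj (Z : V) where
  J : Type w
  card_lt : Cardinal.mk J < κ
  atom : J → Atomic L κ Z

variable {L κ}

/-- Substitution of `x` by `f` in an atomic formula. -/
def Atomic.subst {X Z : V} (hX : IsCardinalPresentable X κ) (hZ : IsCardinalPresentable Z κ)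
    (f : X ⟶ Z) : Atomic L κ X → Atomic L κ Z
  | .eq s t => .eq (.comp (.ofHom hZ hX f) s) (.comp (.ofHom hZ hX f) t)
  | .rel R Y hY t => .rel R Y hY (.comp (.ofHom hZ hX f) t)

/-- Substitution in a conjunction of atomic formulas. -/
def Conj.subst {X Z : V} (hX : IsCardinalPresentable X κ) (hZ : IsCardinalPresentable Z κ)
    (f : X ⟶ Z) (φ : Conj L κ X) : Conj L κ Z where
  J := φ.J
  card_lt := φ.card_lt
  atom j := (φ.atom j).subst hX hZ f

/-- The conjunction of two conjunctions of atomic formulas. -/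
def Conj.and {Z : V} (φ ψ : Conj L κ Z) : Conj L κ Z where
  J := φ.J ⊕ ψ.J
  card_lt := by
    rw [Cardinal.mk_sum, Cardinal.lift_id, Cardinal.lift_id]
    exact Cardinal.add_lt_of_lt (Fact.out : κ.IsRegular).aleph0_le φ.card_lt ψ.card_lt
  atom := Sum.elim φ.atom ψ.atom

variable (L κ)

/-- A limit sequent `(∀ x) (φ(x) ⊢ (∃!! y) (ψ(x, y) ∧ φ(x)))`, with `φ` and `ψ` conjunctions of
atomic formulas. -/
structure LimitSequent where
  X : V
  Y : V
  hX : IsCardinalPresentable X κ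
  hY : IsCardinalPresentable Y κ
  φ : Conj L κ X
  ψ : Conj L κ (X ⨿ Y)

/-- A limit theory: a (small) set of limit sequents. -/
structure LimitTheory where
  sequents : Set (LimitSequent L κ)
  small : Small.{w} sequents

variable {L κ}

/-- The formula `ψ(x, y) ∧ φ(x)` in context `(x, y) : X + Y`. -/
def LimitSequent.body (τ : LimitSequent L κ) : Conj L κ (τ.X ⨿ τ.Y) :=
  τ.ψ.and (τ.φ.subst τ.hX (isCardinalPresentable_coprod τ.hX τ.hY) coprod.inl)

section Interpretation

variable [SymmetricCategory V] [MonoidalClosed V]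

/-- The morphism `B ^ X ⟶ B ^ (∐ Y)` induced by a family of morphisms `B ^ X ⟶ B ^ (Y j)`. -/
def powerSigmaLift {J : Type w} {W B : V} (Y : J → V) (t : ∀ j, W ⟶ (ihom (Y j)).obj B) :
    W ⟶ (ihom (∐ Y)).obj B :=
  MonoidalClosed.curry ((β_ (∐ Y) W).hom ≫ MonoidalClosed.uncurry (Sigma.desc fun j =>
    MonoidalClosed.curry ((β_ W (Y j)).hom ≫ MonoidalClosed.uncurry (t j))))

/-- Its components are the given morphisms. -/
theorem powerSigmaLift_pre {J : Type w} {W B : V} (Y : J → V)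
    (t : ∀ j, W ⟶ (ihom (Y j)).obj B) (j : J) :
    powerSigmaLift Y t ≫ (MonoidalClosed.pre (Sigma.ι Y j)).app B = t j := by
  rw [powerSigmaLift, MonoidalClosed.curry_pre_app, BraidedCategory.braiding_naturality_left_assoc,
    ← MonoidalClosed.uncurry_natural_left, Sigma.ι_desc, MonoidalClosed.uncurry_curry,
    SymmetricCategory.symmetry_assoc, MonoidalClosed.curry_uncurry]

variable [HasLimits V] {S : ProperFactorizationSystem V}

/-- Interpretation of an `(X, Y)`-ary term as a morphism `A ^ X ⟶ A ^ Y`. -/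
def LTerm.interp (A : Str S L) : ∀ {X Y : V}, LTerm L κ X Y →
    ((ihom X).obj A.carrier ⟶ (ihom Y).obj A.carrier)
  | _, _, .ofHom _ _ f => (MonoidalClosed.pre f).app A.carrier
  | _, _, .symb f => A.func f
  | _, _, @LTerm.pow _ _ _ _ _ _ _ X Y Z _ t => (powerTensorIso X Z A.carrier).inv ≫
      (ihom Z).map (t.interp A) ≫ (powerTensorIso Y Z A.carrier).hom
  | _, _, .family _ _ Y t => powerSigmaLift Y fun j => (t j).interp A
  | _, _, .comp t s => t.interp A ≫ s.interp A

/-- Interpretation of an atomic formula: the image of the equalizer of the two terms, respectively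
the pullback of the power of the relation along the term. -/
def Atomic.interp (A : Str S L) {Z : V} : Atomic L κ Z → MSubobject S ((ihom Z).obj A.carrier)
  | .eq s t => MSubobject.image S (equalizer.ι (s.interp A) (t.interp A))
  | .rel R Y _ t => ((A.rel R).power Y).pullback
      (t.interp A ≫ (powerTensorIso (L.ar R) Y A.carrier).inv)

/-- Interpretation of a conjunction. -/
def Conj.interp (A : Str S L) {Z : V} (φ : Conj L κ Z) :
    MSubobject S ((ihom Z).obj A.carrier) :=
  MSubobject.inter fun j => (φ.atom j).interp A

/-- The morphism `χ_A ⟶ A ^ (X + Y) ⟶ A ^ X`. -/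
def Conj.proj (A : Str S L) {X Y : V} (χ : Conj L κ (X ⨿ Y)) :
    (χ.interp A).obj ⟶ (ihom X).obj A.carrier :=
  (χ.interp A).arrow ≫ (MonoidalClosed.pre (coprod.inl : X ⟶ X ⨿ Y)).app A.carrier

/-- Interpretation of `(∃ y) χ(x, y)`. -/
def Conj.existsInterp (A : Str S L) {X Y : V} (χ : Conj L κ (X ⨿ Y)) :
    MSubobject S ((ihom X).obj A.carrier) :=
  MSubobject.image S (χ.proj A)

/-- Satisfaction of a limit sequent: existence, and uniqueness relative to the right class. -/
structure LimitSequent.Holds (τ : LimitSequent L κ) (A : Str S L) : Prop where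
  existence : (τ.φ.interp A).le (τ.body.existsInterp A)
  uniqueness : S.right (τ.body.proj A)

/-- The full subcategory of models of a limit theory. -/
def LimitTheory.Mod (T : LimitTheory L κ) (S : ProperFactorizationSystem V) :
    ObjectProperty (Str S L) :=
  fun A => ∀ τ ∈ T.sequents, τ.Holds A

end Interpretation

end Logic

/-- The comparison assumption for the language `L` and the factorization system `S`, relative to an
auxiliary proper enriched factorization system `S₀`: the right class of `S₀` is closed under
`κ`-filtered colimits; `L` is relational, or else has suitably stable arities and there is
a generator of projectives; the left class of `S` contains that of `S₀`; and the inclusion of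
structures relative to `S` into structures relative to `S₀` preserves `κ`-presentable objects. -/
structure ComparisonAssumption {V : Type u} [Category.{w} V] [MonoidalCategory V]
    [MonoidalClosed V] [HasLimits V] (κ : Cardinal.{w}) [Fact κ.IsRegular]
    (S₀ S : ProperFactorizationSystem V) (L : Language.{w} V) : Prop where
  isAry : L.IsAry κ
  right_closed : S₀.RightClosedUnderFilteredColimits κ
  relational_or_stable : IsEmpty L.Func ∨
    ((∀ f : L.Func, S₀.IsLeftStable (L.dom f)) ∧ (∀ R : L.Rel, S₀.IsLeftStable (L.ar R)) ∧
      ∃ G : Set V, S₀.IsLeftGenerator κ G ∧ ∀ X ∈ G, S₀.IsLeftProjective X)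
  left_le : S₀.left ≤ S.left
  preserves_presentable (A : Str S L) : Str.IsEnrichedPresentable κ A →
    Str.IsEnrichedPresentable κ ((Str.inclusion left_le).obj A)

end EnrichedLogic

end

open EnrichedLogic

/-! The bridge between logic and orthogonality is the structure presented by generators `X` and a
conjunction `φ`: maps out of it are the `X`-families of elements satisfying `φ`. Only the ordinary
universal property has to be constructed. The enriched one follows because structures have powers `K
^ W`, and a formula holds of a family in `K ^ W` exactly when it holds of the corresponding
`W`-indexed family in `K` (`Conj.power_factors_iff`). Hence the hom object from the presented
structure to `K` is `φ_K`, as a subobject of `K ^ X` (`IsPresentation.exists_isIso`).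

From theories to orthogonality: a sequent gives presented structures `F` (on `φ`) and `B` (on `ψ ∧
φ`) and a map `h : F ⟶ B`. Under the identifications above, `Str(h, K)` is the restricted projection
from the solutions of `ψ ∧ φ` to those of `φ`. The sequent says exactly that this is invertible:
uniqueness puts the projection in the right class, so the existential image is the body itself, and
existence supplies the inverse. Presented structures are presentable because powers with presentable
exponents, the relations (closure of the right class) and therefore satisfaction all commute with
`κ`-filtered colimits.

Presented structures exist because structures form a reflective subcategory of `PreStr`, where
powers and relations are arbitrary objects with formal evaluation maps. There colimits are
componentwise. One reflects by first inverting a small set of maps between presentable objects,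
which turns formal powers into actual ones, and then replacing each formal relation by its image. So
structures are cocomplete and have free objects, and each atomic formula is imposed by a pushout
along an epimorphism (`Atomic.exists_test`).

From orthogonality to theories: presented structures form a strong generator, so every presentable
structure lies in the closure of a small set of them under `κ`-small colimits. To present such a
colimit, or to encode `h : A ⟶ B` as a sequent, one must express the images of the generators of one
structure by terms in the generators of the other. This is possible after precomposing with an
epimorphism `e : G ⟶ X` (`IsTermCovering`), and that is enough, since an equation `e x = t(y)` still
determines `x`. In a relational language a presentable structure has presentable carrier and may be
presented on it. Otherwise, term values at the generating projectives span, by stability of the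
arities, a substructure containing the generators; it is the whole structure by the universal
property, and projectivity lifts families to terms. The sequent for `h` is then `φ(x) ⊢ ∃!! y (χ(y)
∧ e x = t(y) ∧ φ(x))`. -/

noncomputable section

namespace EnrichedLogic

open MonoidalClosed (curry uncurry pre curry' uncurry')

/-! ### Generalized morphisms acting on powers and on terms -/

section Action

variable {V : Type u} [Category.{w} V] [MonoidalCategory V] [MonoidalClosed V]

open MonoidalClosed (curry uncurry pre)

/-- The action `A ^ X ⊗ W ⟶ B ^ X` of a generalized morphism `A ⊗ W ⟶ B` on powers. -/
def act (X : V) {A B W : V} (g : A ⊗ W ⟶ B) : (ihom X).obj A ⊗ W ⟶ (ihom X).obj B :=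
  curry ((α_ X _ W).inv ≫ (ihom.ev X).app A ▷ W ≫ g)

theorem whiskerRight_act {X A B U W : V} (p : U ⟶ (ihom X).obj A) (g : A ⊗ W ⟶ B) :
    p ▷ W ≫ act X g = curry ((α_ X U W).inv ≫ uncurry p ▷ W ≫ g) := by
  rw [act, ← MonoidalClosed.curry_natural_left, associator_inv_naturality_middle_assoc,
    ← comp_whiskerRight_assoc, MonoidalClosed.uncurry_eq]

theorem uncurry_whiskerRight_act {X A B U W : V} (p : U ⟶ (ihom X).obj A) (g : A ⊗ W ⟶ B) :
    uncurry (p ▷ W ≫ act X g) = (α_ X U W).inv ≫ uncurry p ▷ W ≫ g := by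
  rw [whiskerRight_act, MonoidalClosed.uncurry_curry]

theorem whiskerLeft_comp_eq_act {X A B W : V} (g : W ⟶ (ihom A).obj B) :
    (ihom X).obj A ◁ g ≫ MonoidalClosed.comp X A B = act X (uncurry g) := by
  rw [MonoidalClosed.comp_eq, MonoidalClosed.compTranspose, ← MonoidalClosed.curry_natural_left,
    associator_inv_naturality_right_assoc, whisker_exchange_assoc, act, MonoidalClosed.uncurry_eq]
  rfl

theorem act_map (X : V) {A B C W : V} (g : A ⊗ W ⟶ B) (h : B ⟶ C) :
    act X g ≫ (ihom X).map h = act X (g ≫ h) := by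
  rw [act, act, ← MonoidalClosed.curry_natural_right, assoc, assoc]

theorem map_whiskerRight_act (X : V) {A B C W : V} (k : A ⟶ B) (g : B ⊗ W ⟶ C) :
    (ihom X).map k ▷ W ≫ act X g = act X (k ▷ W ≫ g) := by
  rw [whiskerRight_act, MonoidalClosed.uncurry_ihom_map, act, comp_whiskerRight_assoc]

theorem pre_whiskerRight_act {X Y A B W : V} (f : Y ⟶ X) (g : A ⊗ W ⟶ B) :
    (pre f).app A ▷ W ≫ act Y g = act X g ≫ (pre f).app B := by
  rw [whiskerRight_act, act, MonoidalClosed.curry_pre_app, MonoidalClosed.uncurry_pre,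
    comp_whiskerRight_assoc, associator_inv_naturality_left_assoc]

theorem act_rightUnitor (X : V) {A B : V} (h : A ⟶ B) :
    act X ((ρ_ A).hom ≫ h) = (ρ_ _).hom ≫ (ihom X).map h := by
  apply MonoidalClosed.uncurry_injective
  rw [act, MonoidalClosed.uncurry_curry, MonoidalClosed.uncurry_natural_left,
    MonoidalClosed.uncurry_ihom_map]
  simp

theorem uncurry_comp_powerTensorIso_hom {X Z B U : V} (p : U ⟶ (ihom Z).obj ((ihom X).obj B)) :
    uncurry (p ≫ (powerTensorIso X Z B).hom) = (α_ X Z U).hom ≫ uncurry (uncurry p) := by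
  rw [powerTensorIso, ← MonoidalClosed.curry_natural_left, MonoidalClosed.uncurry_curry,
    associator_naturality_right_assoc, MonoidalClosed.uncurry_eq, MonoidalClosed.uncurry_eq,
    MonoidalCategory.whiskerLeft_comp_assoc]

theorem uncurry_uncurry_comp_powerTensorIso_inv {X Z B U : V} (q : U ⟶ (ihom (X ⊗ Z)).obj B) :
    uncurry (uncurry (q ≫ (powerTensorIso X Z B).inv)) = (α_ X Z U).inv ≫ uncurry q := by
  rw [← cancel_epi (α_ X Z U).hom, ← uncurry_comp_powerTensorIso_hom]
  simp

/-- The action is compatible with `(A ^ X) ^ Z ≅ A ^ (X ⊗ Z)`; this is what makes powers of terms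
and formulas `R ^ Y (t)` natural in generalized morphisms. -/
theorem whiskerRight_act_act {X Z A B U W : V} (q : U ⟶ (ihom (X ⊗ Z)).obj A) (g : A ⊗ W ⟶ B) :
    (q ≫ (powerTensorIso X Z A).inv) ▷ W ≫ act Z (act X g) =
      (q ▷ W ≫ act (X ⊗ Z) g) ≫ (powerTensorIso X Z B).inv := by
  apply MonoidalClosed.uncurry_injective
  apply MonoidalClosed.uncurry_injective
  rw [uncurry_uncurry_comp_powerTensorIso_inv, uncurry_whiskerRight_act, uncurry_whiskerRight_act,
    MonoidalClosed.uncurry_natural_left, uncurry_whiskerRight_act,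
    uncurry_uncurry_comp_powerTensorIso_inv]
  simp

theorem powerTensorIso_inv_whiskerRight_act {X Z A B W : V} (g : A ⊗ W ⟶ B) :
    (powerTensorIso X Z A).inv ▷ W ≫ act Z (act X g) =
      act (X ⊗ Z) g ≫ (powerTensorIso X Z B).inv := by
  simpa using whiskerRight_act_act (𝟙 _) g

theorem powerTensorIso_hom_whiskerRight_act {X Z A B W : V} (g : A ⊗ W ⟶ B) :
    (powerTensorIso X Z A).hom ▷ W ≫ act (X ⊗ Z) g =
      act Z (act X g) ≫ (powerTensorIso X Z B).hom := by
  rw [← cancel_mono (powerTensorIso X Z B).inv, assoc, ← powerTensorIso_inv_whiskerRight_act,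
    ← comp_whiskerRight_assoc]
  simp

variable {S : ProperFactorizationSystem V} {L : Language.{w} V}

namespace Str

/-- `g : A ⊗ W ⟶ B` is a `W`-indexed morphism of structures. -/
structure IsGenHom (A B : Str S L) {W : V} (g : A.carrier ⊗ W ⟶ B.carrier) : Prop where
  func (f : L.Func) : act (L.dom f) g ≫ B.func f = A.func f ▷ W ≫ act (L.cod f) g
  rel (R : L.Rel) : ∃ k : (A.rel R).obj ⊗ W ⟶ (B.rel R).obj,
    k ≫ (B.rel R).arrow = (A.rel R).arrow ▷ W ≫ act (L.ar R) g

/-- Replaces the internal composition `MonoidalClosed.comp` by `act`, which is easier to compute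
with. -/
theorem isStrHom_iff {A B : Str S L} {W : V} (g : W ⟶ (ihom A.carrier).obj B.carrier) :
    IsStrHom g ↔ IsGenHom A B (uncurry g) := by
  refine ⟨fun h => ⟨fun f => ?_, fun R => ?_⟩, fun h => ⟨fun f => ?_, fun R => ?_⟩⟩
  · rw [← whiskerLeft_comp_eq_act, ← whiskerLeft_comp_eq_act, assoc]
    exact h.func f
  · rw [← whiskerLeft_comp_eq_act]
    exact h.rel R
  · have := h.func f
    rwa [← whiskerLeft_comp_eq_act, ← whiskerLeft_comp_eq_act, assoc] at this
  · have := h.rel R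
    rwa [← whiskerLeft_comp_eq_act] at this

theorem Hom.isGenHom {A B : Str S L} (h : A ⟶ B) :
    IsGenHom A B ((ρ_ _).hom ≫ Hom.hom h) := by
  have := (isStrHom_iff _).1 (isStrHom_curry' h)
  rwa [MonoidalClosed.curry', MonoidalClosed.uncurry_curry] at this

end Str

section Sigma

variable [SymmetricCategory V] [HasColimits V]

/-- Morphisms into `B ^ (∐ Y)` are determined by their components. -/
theorem powerSigma_hom_ext {J : Type w} {Q B : V} (Y : J → V) {a b : Q ⟶ (ihom (∐ Y)).obj B}
    (h : ∀ j, a ≫ (pre (Sigma.ι Y j)).app B = b ≫ (pre (Sigma.ι Y j)).app B) : a = b := by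
  apply MonoidalClosed.uncurry_injective
  rw [← cancel_epi (β_ Q (∐ Y)).hom]
  apply MonoidalClosed.curry_injective
  apply Sigma.hom_ext
  intro j
  rw [← MonoidalClosed.curry_natural_left, ← MonoidalClosed.curry_natural_left,
    BraidedCategory.braiding_naturality_right_assoc, BraidedCategory.braiding_naturality_right_assoc,
    ← MonoidalClosed.uncurry_pre_app, ← MonoidalClosed.uncurry_pre_app, h]

variable {κ : Cardinal.{w}} [Fact κ.IsRegular]

/-- Terms commute with generalized morphisms of structures. -/
theorem LTerm.interp_act {A B : Str S L} {W : V} {g : A.carrier ⊗ W ⟶ B.carrier}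
    (hg : Str.IsGenHom A B g) {X Y : V} (t : LTerm L κ X Y) :
    t.interp A ▷ W ≫ act Y g = act X g ≫ t.interp B := by
  induction t with
  | ofHom _ _ f => exact pre_whiskerRight_act f g
  | symb f => exact (hg.func f).symm
  | @pow X Y Z hZ t ih =>
    simp only [LTerm.interp, comp_whiskerRight, assoc]
    rw [powerTensorIso_hom_whiskerRight_act, ← reassoc_of% (powerTensorIso_inv_whiskerRight_act g),
      reassoc_of% (map_whiskerRight_act Z (t.interp A)), ih, ← reassoc_of% (act_map Z)]
  | family hX hJ Y t ih =>
    apply powerSigma_hom_ext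
    intro j
    simp only [LTerm.interp, assoc]
    rw [← pre_whiskerRight_act, ← comp_whiskerRight_assoc, powerSigmaLift_pre, powerSigmaLift_pre,
      ih]
  | comp t s iht ihs =>
    simp only [LTerm.interp, comp_whiskerRight, assoc]
    rw [ihs, reassoc_of% iht]

theorem LTerm.interp_map {A B : Str S L} (h : A ⟶ B) {X Y : V} (t : LTerm L κ X Y) :
    t.interp A ≫ (ihom Y).map (Str.Hom.hom h) = (ihom X).map (Str.Hom.hom h) ≫ t.interp B := by
  have := LTerm.interp_act (Str.Hom.isGenHom h) t
  rw [act_rightUnitor, act_rightUnitor, rightUnitor_naturality_assoc, assoc, cancel_epi] at this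
  exact this

end Sigma
end Action

/-! ### Subobjects through their generalized elements -/

namespace MSubobject

section

variable {V : Type u} [Category.{w} V] [MonoidalCategory V] {S : ProperFactorizationSystem V}

/-- The morphism `f` factors through the subobject `P`. -/
def Factors {B Q : V} (P : MSubobject S B) (f : Q ⟶ B) : Prop :=
  ∃ k : Q ⟶ P.obj, k ≫ P.arrow = f

theorem Factors.precomp {B Q Q' : V} {P : MSubobject S B} {f : Q ⟶ B} (h : P.Factors f)
    (r : Q' ⟶ Q) : P.Factors (r ≫ f) := by
  obtain ⟨k, rfl⟩ := h
  exact ⟨r ≫ k, assoc _ _ _⟩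

theorem factors_arrow {B : V} (P : MSubobject S B) : P.Factors P.arrow := ⟨𝟙 _, id_comp _⟩

theorem factors_iso_comp_iff {B Q Q' : V} {P : MSubobject S B} (r : Q' ⟶ Q) [IsIso r] (f : Q ⟶ B) :
    P.Factors (r ≫ f) ↔ P.Factors f :=
  ⟨fun h => by simpa using h.precomp (inv r), fun h => h.precomp r⟩

/-- Orthogonality: membership in a subobject of the right class may be tested after a cover in the
left class. -/
theorem factors_left_comp_iff {B Q Q' : V} {P : MSubobject S B} {e : Q' ⟶ Q} (he : S.left e)
    (f : Q ⟶ B) : P.Factors (e ≫ f) ↔ P.Factors f := by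
  refine ⟨fun ⟨k, hk⟩ => ?_, fun h => h.precomp e⟩
  obtain ⟨d, -, h⟩ := S.exists_lift he P.mem k f hk
  exact ⟨d, h⟩

theorem pullback_factors_iff [HasLimits V] {A B Q : V} (t : A ⟶ B) (P : MSubobject S B)
    (f : Q ⟶ A) : (P.pullback t).Factors f ↔ P.Factors (f ≫ t) := by
  refine ⟨?_, fun ⟨k, hk⟩ => ⟨Limits.pullback.lift k f hk, Limits.pullback.lift_snd _ _ _⟩⟩
  rintro ⟨(k : Q ⟶ Limits.pullback P.arrow t), (rfl : k ≫ Limits.pullback.snd _ _ = f)⟩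
  exact ⟨k ≫ Limits.pullback.fst _ _, by rw [assoc, Limits.pullback.condition, assoc]⟩

theorem inter_factors_iff [HasLimits V] {B Q : V} {J : Type w} (P : J → MSubobject S B)
    (f : Q ⟶ B) : (inter P).Factors f ↔ ∀ j, (P j).Factors f := by
  refine ⟨?_, fun h => ?_⟩
  · rintro ⟨(k : Q ⟶ widePullback B (fun j => (P j).obj) (fun j => (P j).arrow)),
      (rfl : k ≫ WidePullback.base _ = f)⟩ j
    exact ⟨k ≫ WidePullback.π _ j, by rw [assoc, WidePullback.π_arrow]⟩
  · choose k hk using h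
    exact ⟨WidePullback.lift f k hk, WidePullback.lift_base _ _ _ _⟩

theorem power_factors_iff [MonoidalClosed V] {B Q : V} (Y : V) (P : MSubobject S B)
    (f : Q ⟶ (ihom Y).obj B) : (P.power Y).Factors f ↔ P.Factors (MonoidalClosed.uncurry f) := by
  refine ⟨?_, fun ⟨k, hk⟩ => ⟨MonoidalClosed.curry k, ?_⟩⟩
  · rintro ⟨k, rfl⟩
    exact ⟨MonoidalClosed.uncurry k, (MonoidalClosed.uncurry_natural_right _ _).symm⟩
  · refine (MonoidalClosed.curry_natural_right _ _).symm.trans ?_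
    rw [hk, MonoidalClosed.curry_uncurry]

/-- A morphism of the right class is its own image. -/
theorem image_factors_iff_of_right {A B Q : V} {m : A ⟶ B} (hm : S.right m) (f : Q ⟶ B) :
    (image S m).Factors f ↔ ∃ k, k ≫ m = f := by
  have := S.hasFactorization
  let F := MorphismProperty.factorizationData S.left S.right m
  obtain ⟨d, -, hd⟩ := S.exists_lift F.hi hm (𝟙 A) F.p (by simp)
  refine ⟨?_, fun ⟨k, hk⟩ => ⟨k ≫ F.i, (?_ : (k ≫ F.i) ≫ F.p = f)⟩⟩
  · rintro ⟨(k : Q ⟶ F.Z), (hk : k ≫ F.p = f)⟩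
    exact ⟨k ≫ d, by rw [assoc, hd, hk]⟩
  · rw [assoc, F.fac, hk]

/-- Properness enters here: the left class is epic, so an equation verified on a cover holds. Hence
taking the image in the interpretation of an equation changes nothing. -/
theorem right_equalizer_ι [HasLimits V] {A B : V} (s t : A ⟶ B) : S.right (equalizer.ι s t) :=
  S.right_of_lifting _ fun e he a b sq => by
    have := S.epi_of_left e he
    have h : b ≫ s = b ≫ t := by
      rw [← cancel_epi e, ← reassoc_of% sq, ← reassoc_of% sq, equalizer.condition]
    refine ⟨equalizer.lift b h, ?_, equalizer.lift_ι _ _⟩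
    rw [← cancel_mono (equalizer.ι s t), assoc, equalizer.lift_ι, sq]

theorem image_equalizer_factors_iff [HasLimits V] {A B Q : V} (s t : A ⟶ B) (f : Q ⟶ A) :
    (image S (equalizer.ι s t)).Factors f ↔ f ≫ s = f ≫ t := by
  rw [image_factors_iff_of_right (right_equalizer_ι s t)]
  exact ⟨fun ⟨k, hk⟩ => by rw [← hk, assoc, assoc, equalizer.condition],
    fun h => ⟨equalizer.lift f h, equalizer.lift_ι _ _⟩⟩

/-- The left part of the factorization defining the image. -/
theorem exists_left_image {A B : V} (f : A ⟶ B) :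
    ∃ e : A ⟶ (image S f).obj, S.left e ∧ e ≫ (image S f).arrow = f := by
  have := S.hasFactorization
  let F := MorphismProperty.factorizationData S.left S.right f
  exact ⟨F.i, F.hi, F.fac⟩

end

end MSubobject

variable {V : Type u} [Category.{w} V] [MonoidalCategory V] [MonoidalClosed V]

theorem curry'_whiskerRight_act {X A B W : V} (x : X ⟶ A) (g : A ⊗ W ⟶ B) :
    curry' x ▷ W ≫ act X g = (λ_ W).hom ≫ curry (x ▷ W ≫ g) := by
  rw [whiskerRight_act, curry', MonoidalClosed.uncurry_curry, ← MonoidalClosed.curry_natural_left,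
    comp_whiskerRight, assoc]
  simp

theorem curry'_comp_map {X A B : V} (x : X ⟶ A) (h : A ⟶ B) :
    curry' x ≫ (ihom X).map h = curry' (x ≫ h) := by
  rw [curry', curry', ← MonoidalClosed.curry_natural_right, assoc]

theorem curry'_pre {X Y A : V} (x : X ⟶ A) (f : Y ⟶ X) :
    curry' x ≫ (pre f).app A = curry' (f ≫ x) := by
  rw [curry', curry', MonoidalClosed.curry_pre_app, rightUnitor_naturality_assoc]

/-- The argument fed to a relation by `R ^ Y (t)` is moved by `g` through the action on `A ^ X`, so
compatibility of `g` with `R` applies to it directly. -/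
theorem uncurry_rel_act {A B W X Y Z Q : V} (t : (ihom Z).obj A ⟶ (ihom (X ⊗ Y)).obj A)
    (t' : (ihom Z).obj B ⟶ (ihom (X ⊗ Y)).obj B) (g : A ⊗ W ⟶ B)
    (h : t ▷ W ≫ act _ g = act _ g ≫ t') (p : Q ⟶ (ihom Z).obj A) :
    uncurry (((p ▷ W ≫ act Z g) ≫ t') ≫ (powerTensorIso X Y B).inv) = (α_ _ _ _).inv ≫
      uncurry ((p ≫ t) ≫ (powerTensorIso X Y A).inv) ▷ W ≫ act X g := by
  rw [← uncurry_whiskerRight_act, whiskerRight_act_act, comp_whiskerRight, assoc, assoc, assoc, assoc,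
    ← reassoc_of% h]

/-! ### Powers of structures -/

section Power

namespace Str

theorem IsGenHom.comp_hom {S : ProperFactorizationSystem V} {L : Language.{w} V}
    {A B C : Str S L} {W : V} {g : B.carrier ⊗ W ⟶ C.carrier}
    (hg : IsGenHom B C g) (h : A ⟶ B) : IsGenHom A C (Hom.hom h ▷ W ≫ g) where
  func f := by
    rw [← map_whiskerRight_act, ← map_whiskerRight_act, assoc, hg.func, ← comp_whiskerRight_assoc,
      ← comp_whiskerRight_assoc, Hom.func_comm h]
  rel R := by
    obtain ⟨k, hk⟩ := Hom.rel_comm h R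
    obtain ⟨l, hl⟩ := hg.rel R
    refine ⟨k ▷ W ≫ l, ?_⟩
    rw [assoc, hl, ← map_whiskerRight_act, ← comp_whiskerRight_assoc, hk, comp_whiskerRight_assoc]

end Str

variable [SymmetricCategory V]

/-- The evaluation `A ^ W ⊗ W ⟶ A`. -/
def evPow (W A : V) : (ihom W).obj A ⊗ W ⟶ A := (β_ _ _).hom ≫ (ihom.ev W).app A

theorem whiskerRight_evPow {W A Q : V} (k : Q ⟶ (ihom W).obj A) :
    k ▷ W ≫ evPow W A = (β_ Q W).hom ≫ uncurry k := by
  rw [evPow, BraidedCategory.braiding_naturality_left_assoc, MonoidalClosed.uncurry_eq]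

theorem curry_whiskerRight_evPow {W A Q : V} (g : Q ⊗ W ⟶ A) :
    curry ((β_ W Q).hom ≫ g) ▷ W ≫ evPow W A = g := by
  rw [whiskerRight_evPow, MonoidalClosed.uncurry_curry, SymmetricCategory.symmetry_assoc]

theorem evPow_ext {W A Q : V} {k k' : Q ⟶ (ihom W).obj A}
    (h : k ▷ W ≫ evPow W A = k' ▷ W ≫ evPow W A) : k = k' := by
  rw [whiskerRight_evPow, whiskerRight_evPow, cancel_epi] at h
  exact MonoidalClosed.uncurry_injective h

/-- `(A ^ W) ^ X` embeds in `W`-indexed families of `A ^ X`; identities in a power structure are all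
checked through this embedding. -/
theorem act_evPow_ext {X W A Q : V} {p p' : Q ⟶ (ihom X).obj ((ihom W).obj A)}
    (h : p ▷ W ≫ act X (evPow W A) = p' ▷ W ≫ act X (evPow W A)) : p = p' := by
  rw [whiskerRight_act, whiskerRight_act, MonoidalClosed.curry_injective.eq_iff, cancel_epi] at h
  exact MonoidalClosed.uncurry_injective (evPow_ext h)

/-- The transpose `Q ⟶ (A ^ W) ^ X` of a morphism `Q ⊗ W ⟶ A ^ X`. -/
def powTranspose {X W A Q : V} (q : Q ⊗ W ⟶ (ihom X).obj A) :
    Q ⟶ (ihom X).obj ((ihom W).obj A) :=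
  curry (curry ((β_ W (X ⊗ Q)).hom ≫ (α_ X Q W).hom ≫ uncurry q))

theorem powTranspose_whiskerRight_act {X W A Q : V} (q : Q ⊗ W ⟶ (ihom X).obj A) :
    powTranspose q ▷ W ≫ act X (evPow W A) = q := by
  rw [whiskerRight_act, powTranspose, MonoidalClosed.uncurry_curry, curry_whiskerRight_evPow,
    Iso.inv_hom_id_assoc, MonoidalClosed.curry_uncurry]

namespace Str

variable {S : ProperFactorizationSystem V} {L : Language.{w} V}

variable [HasLimits V]

/-- The power `A ^ W` of a structure. -/
abbrev power (W : V) (A : Str S L) : Str S L where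
  carrier := (ihom W).obj A.carrier
  func f := powTranspose (act (L.dom f) (evPow W A.carrier) ≫ A.func f)
  rel R := ((A.rel R).power W).pullback
    (curry ((β_ W _).hom ≫ act (L.ar R) (evPow W A.carrier)))

/-- Relations on the power are pointwise, in the sense of `W`-indexed elements. -/
theorem power_rel_factors_iff (W : V) (A : Str S L) (R : L.Rel) {Q : V}
    (p : Q ⟶ (ihom (L.ar R)).obj ((ihom W).obj A.carrier)) : ((A.power W).rel R).Factors p ↔
      (A.rel R).Factors (p ▷ W ≫ act (L.ar R) (evPow W A.carrier)) := by
  refine (MSubobject.pullback_factors_iff _ _ _).trans ((MSubobject.power_factors_iff _ _ _).trans ?_)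
  rw [← MonoidalClosed.curry_natural_left, MonoidalClosed.uncurry_curry,
    BraidedCategory.braiding_naturality_right_assoc]
  exact MSubobject.factors_iso_comp_iff _ _

theorem isGenHom_evPow (W : V) (A : Str S L) : IsGenHom (A.power W) A (evPow W A.carrier) where
  func _ := (powTranspose_whiskerRight_act _).symm
  rel R := (power_rel_factors_iff W A R _).1 (MSubobject.factors_arrow _)

/-- A generalized morphism, transposed to a morphism into the power. -/
def IsGenHom.toPower {A B : Str S L} {W : V} {k : A.carrier ⟶ (ihom W).obj B.carrier}
    (h : IsGenHom A B (k ▷ W ≫ evPow W B.carrier)) : A ⟶ B.power W where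
  hom := k
  func_comm f := by
    apply act_evPow_ext
    rw [comp_whiskerRight, comp_whiskerRight, assoc, assoc, map_whiskerRight_act, ← h.func,
      ← map_whiskerRight_act, assoc]
    exact congrArg ((ihom (L.dom f)).map k ▷ W ≫ ·) (powTranspose_whiskerRight_act _).symm
  rel_comm R := by
    refine (power_rel_factors_iff W B R _).2 ?_
    rw [comp_whiskerRight, assoc, map_whiskerRight_act]
    exact h.rel R

end Str

end Power

section EvalGen

namespace IsPresentation

variable [HasLimits V]

/-- Evaluation at the generators, `Str(F, K) ⟶ K ^ X`. -/
def evalGen {S : ProperFactorizationSystem V} {L : Language.{w} V} {X : V} {F : Str S L}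
    (K : Str S L) (x : X ⟶ F.carrier) : Str.homObj F K ⟶ (ihom X).obj K.carrier :=
  Str.homι F K ≫ (pre x).app K.carrier

theorem comp_evalGen {S : ProperFactorizationSystem V} {L : Language.{w} V} {X W : V}
    {F K : Str S L} {x : X ⟶ F.carrier} (l : W ⟶ Str.homObj F K) :
    l ≫ evalGen K x = curry (x ▷ W ≫ uncurry (l ≫ Str.homι F K)) := by
  rw [← MonoidalClosed.curry_pre_app, MonoidalClosed.curry_uncurry, assoc, evalGen]

end IsPresentation

end EvalGen

/-! ### Satisfaction of formulas and presented structures -/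

section Satisfaction

variable [SymmetricCategory V] [HasLimits V] [HasColimits V] {S : ProperFactorizationSystem V}
  {L : Language.{w} V} {κ : Cardinal.{w}} [Fact κ.IsRegular]

theorem Atomic.eq_factors_iff (A : Str S L) {Y Z Q : V} (s t : LTerm L κ Z Y)
    (p : Q ⟶ (ihom Z).obj A.carrier) : ((Atomic.eq s t).interp A).Factors p ↔
      p ≫ s.interp A = p ≫ t.interp A :=
  MSubobject.image_equalizer_factors_iff _ _ _

theorem Atomic.rel_factors_iff (A : Str S L) {Z Q : V} (R : L.Rel) (Y : V)
    (hY : IsCardinalPresentable Y κ) (t : LTerm L κ Z (L.ar R ⊗ Y))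
    (p : Q ⟶ (ihom Z).obj A.carrier) : ((Atomic.rel R Y hY t).interp A).Factors p ↔
      (A.rel R).Factors
        (uncurry ((p ≫ t.interp A) ≫ (powerTensorIso (L.ar R) Y A.carrier).inv)) := by
  refine (MSubobject.pullback_factors_iff _ _ _).trans ?_
  rw [MSubobject.power_factors_iff, assoc]

theorem Conj.factors_iff (A : Str S L) {Z Q : V} (φ : Conj L κ Z)
    (p : Q ⟶ (ihom Z).obj A.carrier) :
    (φ.interp A).Factors p ↔ ∀ j, ((φ.atom j).interp A).Factors p :=
  MSubobject.inter_factors_iff _ _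

theorem Conj.and_factors_iff (A : Str S L) {Z Q : V} (φ ψ : Conj L κ Z)
    (p : Q ⟶ (ihom Z).obj A.carrier) :
    ((φ.and ψ).interp A).Factors p ↔ (φ.interp A).Factors p ∧ (ψ.interp A).Factors p := by
  rw [Conj.factors_iff, Conj.factors_iff, Conj.factors_iff]
  exact Sum.forall

theorem Conj.subst_factors_iff (A : Str S L) {X Z Q : V} (hX : IsCardinalPresentable X κ)
    (hZ : IsCardinalPresentable Z κ) (f : X ⟶ Z) (φ : Conj L κ X)
    (p : Q ⟶ (ihom Z).obj A.carrier) : ((φ.subst hX hZ f).interp A).Factors p ↔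
      (φ.interp A).Factors (p ≫ (pre f).app A.carrier) := by
  rw [Conj.factors_iff, Conj.factors_iff]
  refine forall_congr' fun (j : φ.J) => ?_
  show (((φ.atom j).subst hX hZ f).interp A).Factors p ↔ _
  rcases φ.atom j with ⟨s, t⟩ | ⟨R, Y, hY, t⟩
  · rw [Atomic.subst, Atomic.eq_factors_iff, Atomic.eq_factors_iff]
    simp only [LTerm.interp, assoc]
  · rw [Atomic.subst, Atomic.rel_factors_iff, Atomic.rel_factors_iff]
    simp only [LTerm.interp, assoc]

/-- Positive formulas are preserved by generalized morphisms: terms commute with the action, and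
relations are preserved by definition. -/
theorem Conj.Factors.act {A B : Str S L} {X Q W : V} {φ : Conj L κ X}
    {p : Q ⟶ (ihom X).obj A.carrier} (hp : (φ.interp A).Factors p)
    {g : A.carrier ⊗ W ⟶ B.carrier} (hg : Str.IsGenHom A B g) :
    (φ.interp B).Factors (p ▷ W ≫ act X g) := by
  rw [Conj.factors_iff] at hp ⊢
  intro j
  replace hp := hp j
  revert hp
  rcases φ.atom j with ⟨s, t⟩ | ⟨R, Y, hY, t⟩
  · rw [Atomic.eq_factors_iff, Atomic.eq_factors_iff]
    intro hp
    rw [assoc, assoc, ← LTerm.interp_act hg, ← LTerm.interp_act hg, ← comp_whiskerRight_assoc,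
      ← comp_whiskerRight_assoc, hp]
  · rw [Atomic.rel_factors_iff, Atomic.rel_factors_iff,
      uncurry_rel_act _ _ _ (LTerm.interp_act hg t), MSubobject.factors_iso_comp_iff]
    rintro ⟨k, hk⟩
    obtain ⟨l, hl⟩ := hg.rel R
    exact ⟨k ▷ W ≫ l, by rw [assoc, hl, ← comp_whiskerRight_assoc, hk]⟩

theorem Conj.Factors.map {A B : Str S L} {X Q : V} {φ : Conj L κ X}
    {p : Q ⟶ (ihom X).obj A.carrier} (hp : (φ.interp A).Factors p) (h : A ⟶ B) :
    (φ.interp B).Factors (p ≫ (ihom X).map (Str.Hom.hom h)) := by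
  have := Conj.Factors.act hp (Str.Hom.isGenHom h)
  rwa [act_rightUnitor, rightUnitor_naturality_assoc, MSubobject.factors_iso_comp_iff] at this

/-- One direction is preservation along the evaluation `A ^ W ⊗ W ⟶ A`. The converse holds because
equality and the relations on the power are tested by that same evaluation. -/
theorem Conj.power_factors_iff {A : Str S L} {X Q W : V} {φ : Conj L κ X}
    {p : Q ⟶ (ihom X).obj ((ihom W).obj A.carrier)} :
    (φ.interp (A.power W)).Factors p ↔
      (φ.interp A).Factors (p ▷ W ≫ act X (evPow W A.carrier)) := by
  refine ⟨fun h => Conj.Factors.act h (Str.isGenHom_evPow W A), ?_⟩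
  rw [Conj.factors_iff, Conj.factors_iff]
  refine forall_imp fun j => ?_
  rcases φ.atom j with ⟨s, t⟩ | ⟨R, Y, hY, t⟩
  · rw [Atomic.eq_factors_iff, Atomic.eq_factors_iff]
    intro hp
    apply act_evPow_ext
    rw [comp_whiskerRight, comp_whiskerRight, assoc, assoc]
    erw [LTerm.interp_act (Str.isGenHom_evPow W A), LTerm.interp_act (Str.isGenHom_evPow W A)]
    simpa only [assoc] using hp
  · rw [Atomic.rel_factors_iff, Atomic.rel_factors_iff]
    erw [uncurry_rel_act _ _ _ (LTerm.interp_act (Str.isGenHom_evPow W A) t)]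
    rw [MSubobject.factors_iso_comp_iff]
    exact (Str.power_rel_factors_iff W A R _).2

/-- `x` exhibits `F` as the structure presented by the generators `X` and the formula `φ`. -/
structure IsPresentation {X : V} (φ : Conj L κ X) (F : Str S L) (x : X ⟶ F.carrier) : Prop where
  sat : (φ.interp F).Factors (curry' x)
  existsUnique (K : Str S L) (a : X ⟶ K.carrier) (ha : (φ.interp K).Factors (curry' a)) :
    ∃! h : F ⟶ K, x ≫ Str.Hom.hom h = a

namespace IsPresentation

variable {X : V} {φ : Conj L κ X} {F : Str S L} {x : X ⟶ F.carrier}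

theorem hom_ext (hF : IsPresentation φ F x) {K : Str S L} {h h' : F ⟶ K}
    (e : x ≫ Str.Hom.hom h = x ≫ Str.Hom.hom h') : h = h' := by
  refine (hF.existsUnique K (x ≫ Str.Hom.hom h') ?_).unique e rfl
  rw [← curry'_comp_map]
  exact Conj.Factors.map hF.sat h'

theorem factors_evalGen (hF : IsPresentation φ F x) (K : Str S L) :
    (φ.interp K).Factors (evalGen K x) := by
  have := Conj.Factors.act hF.sat ((Str.isStrHom_iff _).1 (Str.isStrHom_homι F K))
  rw [curry'_whiskerRight_act, MSubobject.factors_iso_comp_iff] at this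
  rwa [← id_comp (evalGen K x), comp_evalGen, id_comp]

/-- The enriched universal property from the ordinary one: a `W`-indexed solution of `φ` in `K` is a
single solution in `K.power W`, and a morphism `F ⟶ K.power W` is a `W`-indexed morphism from `F` to
`K`. -/
theorem existsUnique_lift (hF : IsPresentation φ F x) (K : Str S L) {W : V}
    (a : W ⟶ (ihom X).obj K.carrier) (ha : (φ.interp K).Factors a) :
    ∃! l : W ⟶ Str.homObj F K, l ≫ evalGen K x = a := by
  have hk : (φ.interp (K.power W)).Factors (curry' (curry ((β_ W X).hom ≫ uncurry a))) := by
    rw [Conj.power_factors_iff, curry'_whiskerRight_act, curry_whiskerRight_evPow,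
      MonoidalClosed.curry_uncurry, MSubobject.factors_iso_comp_iff]
    exact ha
  obtain ⟨h, hh, hu⟩ := hF.existsUnique (K.power W) _ hk
  have hg := (Str.isGenHom_evPow W K).comp_hom h
  have hg' : Str.IsStrHom (A := F) (B := K) (curry (Str.Hom.hom h ▷ W ≫ evPow W K.carrier)) := by
    rwa [Str.isStrHom_iff, MonoidalClosed.uncurry_curry]
  refine ⟨Str.homLift _ hg', ?_, fun l hl => ?_⟩
  · dsimp only
    rw [comp_evalGen, Str.homLift_ι, MonoidalClosed.uncurry_curry, ← comp_whiskerRight_assoc]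
    erw [hh]
    rw [curry_whiskerRight_evPow, MonoidalClosed.curry_uncurry]
  -- Uniqueness is also moved to the power: transpose `l` to a morphism `F ⟶ K.power W` and compare
  -- with `h`.
  · have hl' : Str.IsGenHom F K (uncurry (l ≫ Str.homι F K)) :=
      (Str.isStrHom_iff _).1 ((Str.exists_lift_iff _).1 ⟨l, rfl⟩)
    rw [← curry_whiskerRight_evPow (uncurry (l ≫ Str.homι F K))] at hl'
    have e := hu hl'.toPower (by
      apply evPow_ext
      erw [comp_whiskerRight_assoc, curry_whiskerRight_evPow, curry_whiskerRight_evPow]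
      rw [← hl, comp_evalGen, MonoidalClosed.uncurry_curry])
    rw [← cancel_mono (Str.homι F K), Str.homLift_ι, MonoidalClosed.eq_curry_iff, ← e]
    exact (curry_whiskerRight_evPow _).symm

theorem mono_evalGen (hF : IsPresentation φ F x) (K : Str S L) : Mono (evalGen K x) where
  right_cancellation _ l' e :=
    (hF.existsUnique_lift K (l' ≫ evalGen K x) ((hF.factors_evalGen K).precomp l')).unique e rfl

end IsPresentation

end Satisfaction

/-! ### Filtered colimits of structures -/

section FilteredColimits

section

variable {C : Type u} [Category.{w} C] (κ : Cardinal.{w}) [Fact κ.IsRegular]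
  [IsCardinalLocallyPresentable C κ]

/-- A monomorphism through which every morphism from a presentable object factors is invertible. -/
theorem isIso_of_mono_of_presentable {A B : C} (m : A ⟶ B) [Mono m]
    (hm : ∀ (G : C) (_ : IsCardinalPresentable G κ) (g : G ⟶ B), ∃ l, l ≫ m = g) : IsIso m := by
  obtain ⟨P, _, hP⟩ := HasCardinalFilteredGenerator.exists_small_generator C κ
  exact hP.isStrongGenerator.isIso_of_mono m fun G hG => hm G (hP.le_isCardinalPresentable _ hG)

/-- Presentable objects detect equality of morphisms. -/
theorem hom_ext_of_presentable {A B : C} {f g : A ⟶ B}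
    (h : ∀ (G : C) (_ : IsCardinalPresentable G κ) (a : G ⟶ A), a ≫ f = a ≫ g) : f = g := by
  obtain ⟨P, _, hP⟩ := HasCardinalFilteredGenerator.exists_small_generator C κ
  exact hP.isStrongGenerator.isSeparating f g fun G hG a => h G (hP.le_isCardinalPresentable _ hG) a

theorem isIso_of_bijective_of_presentable {A B : C} (f : A ⟶ B)
    (hf : ∀ (G : C) (_ : IsCardinalPresentable G κ),
      Function.Bijective (fun a : G ⟶ A => a ≫ f)) : IsIso f := by
  have : Mono f := ⟨fun a b h => hom_ext_of_presentable κ fun G hG g =>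
    (hf G hG).1 (by simp [h])⟩
  exact isIso_of_mono_of_presentable κ f fun G hG g => (hf G hG).2 g

variable {J : Type w} [SmallCategory J] [IsCardinalFiltered J κ]

/-- Filtered colimit cocones are detected on morphisms from presentable objects. -/
def isColimitOfPresentable {F : J ⥤ C} (c : Cocone F)
    (surj : ∀ (G : C) (_ : IsCardinalPresentable G κ) (g : G ⟶ c.pt),
      ∃ (j : J) (a : G ⟶ F.obj j), a ≫ c.ι.app j = g)
    (inj : ∀ (G : C) (_ : IsCardinalPresentable G κ) (j : J) (a b : G ⟶ F.obj j),
      a ≫ c.ι.app j = b ≫ c.ι.app j → ∃ (k : J) (u : j ⟶ k), a ≫ F.map u = b ≫ F.map u) :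
    IsColimit c := by
  -- The two hypotheses say that the comparison from the actual colimit is bijective on maps out of
  -- presentable objects, which contain a strong generator.
  have hd : IsIso (colimit.desc F c) := by
    apply isIso_of_bijective_of_presentable κ
    refine fun G hG => ⟨fun a b h => ?_, fun g => ?_⟩
    · obtain ⟨j₁, a, rfl⟩ := IsCardinalPresentable.exists_hom_of_isColimit κ (colimit.isColimit F) a
      obtain ⟨j₂, b, rfl⟩ := IsCardinalPresentable.exists_hom_of_isColimit κ (colimit.isColimit F) b
      have := isFiltered_of_isCardinalFiltered J κ
      obtain ⟨k, u, hu⟩ := inj G hG (IsFiltered.max j₁ j₂)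
        (a ≫ F.map (IsFiltered.leftToMax _ _)) (b ≫ F.map (IsFiltered.rightToMax _ _))
        (by simpa using h)
      dsimp
      rw [← colimit.w F (IsFiltered.leftToMax j₁ j₂ ≫ u),
        ← colimit.w F (IsFiltered.rightToMax j₁ j₂ ≫ u), F.map_comp, F.map_comp]
      simp only [assoc] at hu ⊢
      rw [reassoc_of% hu]
    · obtain ⟨j, a, rfl⟩ := surj G hG g
      exact ⟨a ≫ colimit.ι F j, by simp⟩
  have : IsIso ((colimit.isColimit F).desc c) := hd
  exact IsColimit.ofPointIso (colimit.isColimit F)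

end

variable {V : Type u} [Category.{w} V] [MonoidalCategory V] [MonoidalClosed V]
  {κ : Cardinal.{w}} [Fact κ.IsRegular] [IsLocallyPresentableAsClosed V κ]
  {J : Type w} [SmallCategory J] [IsCardinalFiltered J κ]

-- Maps `G ⟶ A ^ X` are maps `X ⊗ G ⟶ A`, and `X ⊗ G` is again presentable when `G` is.
variable (κ) in
theorem preservesColimitsOfShape_ihom (X : V) (hX : IsCardinalPresentable X κ) :
    PreservesColimitsOfShape J (ihom X) where
  preservesColimit {F} := ⟨fun {c} hc => ⟨by
    apply isColimitOfPresentable κ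
    · intro G hG g
      have := IsLocallyPresentableAsClosed.presentable_tensor X G hX hG
      obtain ⟨j, a, ha⟩ := IsCardinalPresentable.exists_hom_of_isColimit κ hc (uncurry g)
      refine ⟨j, curry a, ?_⟩
      dsimp
      rw [← MonoidalClosed.curry_natural_right, ha, MonoidalClosed.curry_uncurry]
    · intro G hG j a b h
      have := IsLocallyPresentableAsClosed.presentable_tensor X G hX hG
      obtain ⟨k, u, hu⟩ := IsCardinalPresentable.exists_eq_of_isColimit' κ hc (uncurry a) (uncurry b)
        (by rw [← MonoidalClosed.uncurry_natural_right, ← MonoidalClosed.uncurry_natural_right]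
            exact congrArg uncurry h)
      refine ⟨k, u, MonoidalClosed.uncurry_injective ?_⟩
      dsimp
      rw [MonoidalClosed.uncurry_natural_right, MonoidalClosed.uncurry_natural_right, hu]⟩⟩

namespace Str

variable {S : ProperFactorizationSystem V} {L : Language.{w} V}

/-- The underlying object. -/
@[simps]
def forget (S : ProperFactorizationSystem V) (L : Language.{w} V) : Str S L ⥤ V where
  obj A := A.carrier
  map h := Hom.hom h

/-- The action of a morphism of structures on a relation. -/
def relMap {A B : Str S L} (h : A ⟶ B) (R : L.Rel) : (A.rel R).obj ⟶ (B.rel R).obj :=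
  (Hom.rel_comm h R).choose

theorem relMap_arrow {A B : Str S L} (h : A ⟶ B) (R : L.Rel) :
    relMap h R ≫ (B.rel R).arrow = (A.rel R).arrow ≫ (ihom (L.ar R)).map (Hom.hom h) :=
  (Hom.rel_comm h R).choose_spec

/-- The interpretation of a relation symbol, as a functor. -/
@[simps]
def relFunctor (S : ProperFactorizationSystem V) {L : Language.{w} V} (R : L.Rel) :
    Str S L ⥤ V where
  obj A := (A.rel R).obj
  map h := relMap h R
  map_id A := by rw [← cancel_mono (A.rel R).arrow, relMap_arrow]; simp
  map_comp {A B C} h g := by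
    rw [← cancel_mono (C.rel R).arrow, relMap_arrow, assoc, relMap_arrow, ← assoc, relMap_arrow, assoc]
    simp

/-- The inclusions of the interpretations of a relation symbol. -/
@[simps]
def relArrow (S : ProperFactorizationSystem V) {L : Language.{w} V} (R : L.Rel) :
    relFunctor S R ⟶ forget S L ⋙ ihom (L.ar R) where
  app A := (A.rel R).arrow
  naturality _ _ h := relMap_arrow h R

/-- The interpretations of a function symbol. -/
@[simps]
def funcNatTrans (S : ProperFactorizationSystem V) {L : Language.{w} V} (f : L.Func) :
    forget S L ⋙ ihom (L.dom f) ⟶ forget S L ⋙ ihom (L.cod f) where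
  app A := A.func f
  naturality _ _ h := (Hom.func_comm h f).symm

section

variable (hS : S.RightClosedUnderFilteredColimits κ) (hL : L.IsAry κ) {D : J ⥤ Str S L}

/-- Powers preserve the colimit of the underlying diagram. -/
def isColimitMapIhom (X : V) (hX : IsCardinalPresentable X κ) {c : Cocone (D ⋙ forget S L)}
    (hc : IsColimit c) : IsColimit ((ihom X).mapCocone c) :=
  have := preservesColimitsOfShape_ihom (J := J) κ X hX
  isColimitOfPreserves (ihom X) hc

/-- The colimit of a filtered diagram of structures, on a colimit of the underlying diagram. -/
abbrev filteredColimit {c : Cocone (D ⋙ forget S L)} (hc : IsColimit c) : Str S L where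
  carrier := c.pt
  func f := (isColimitMapIhom (L.dom f) (hL.dom f) hc).desc
    ((Cocone.precompose (Functor.whiskerLeft D (funcNatTrans S f))).obj ((ihom (L.cod f)).mapCocone c))
  rel R :=
    { obj := colimit (D ⋙ relFunctor S R)
      arrow := colimit.desc (D ⋙ relFunctor S R)
        ((Cocone.precompose (Functor.whiskerLeft D (relArrow S R))).obj
          ((ihom (L.ar R)).mapCocone c))
      mem := (hS J).condition _ _ _ _ (colimit.isColimit _)
        (isColimitMapIhom (L.ar R) (hL.ar R) hc) (Functor.whiskerLeft D (relArrow S R))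
        (fun j => ((D.obj j).rel R).mem) _ (fun _ => colimit.ι_desc _ _) }

theorem filteredColimit_fac {c : Cocone (D ⋙ forget S L)} (hc : IsColimit c) (f : L.Func) (j : J) :
    (ihom (L.dom f)).map (c.ι.app j) ≫ (filteredColimit hS hL hc).func f =
      (D.obj j).func f ≫ (ihom (L.cod f)).map (c.ι.app j) :=
  (isColimitMapIhom (L.dom f) (hL.dom f) hc).fac _ j

theorem ι_filteredColimit_rel_arrow {c : Cocone (D ⋙ forget S L)} (hc : IsColimit c) (R : L.Rel)
    (j : J) : colimit.ι (D ⋙ relFunctor S R) j ≫ ((filteredColimit hS hL hc).rel R).arrow =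
      ((D.obj j).rel R).arrow ≫ (ihom (L.ar R)).map (c.ι.app j) :=
  colimit.ι_desc _ _

/-- The canonical colimit cocone of a filtered diagram of structures. -/
abbrev filteredColimitCocone {c : Cocone (D ⋙ forget S L)} (hc : IsColimit c) : Cocone D where
  pt := filteredColimit hS hL hc
  ι :=
    { app := fun j => Hom.mk (A := D.obj j) (B := filteredColimit hS hL hc) (c.ι.app j)
        (fun f => (filteredColimit_fac hS hL hc f j).symm)
        (fun R => ⟨colimit.ι (D ⋙ relFunctor S R) j, ι_filteredColimit_rel_arrow hS hL hc R j⟩)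
      naturality := fun _ _ u => Hom.ext ((c.w u).trans (comp_id _).symm) }

/-- The canonical cocone is a colimit cocone. -/
def isColimitFilteredColimitCocone {c : Cocone (D ⋙ forget S L)} (hc : IsColimit c) :
    IsColimit (filteredColimitCocone hS hL hc) where
  desc s := Hom.mk (A := filteredColimit hS hL hc) (B := s.pt)
    (hc.desc ((forget S L).mapCocone s))
    (fun f => by
      apply (isColimitMapIhom (L.dom f) (hL.dom f) hc).hom_ext
      intro j
      refine ((assoc _ _ _).symm.trans (congrArg (· ≫ _) (filteredColimit_fac hS hL hc f j))).trans ?_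
      have h := Hom.func_comm (s.ι.app j) f
      have e (X : V) : (ihom X).map (Hom.hom (s.ι.app j)) = (ihom X).map (c.ι.app j) ≫
          (ihom X).map (hc.desc ((forget S L).mapCocone s)) := by
        rw [← Functor.map_comp, hc.fac]
        rfl
      rw [e, e] at h
      exact (assoc _ _ _).trans (h.trans (assoc _ _ _)))
    (fun R => ⟨colimit.desc (D ⋙ relFunctor S R) ((relFunctor S R).mapCocone s), by
      apply colimit.hom_ext
      intro j
      have h := relMap_arrow (s.ι.app j) R
      have e (X : V) : (ihom X).map (Hom.hom (s.ι.app j)) = (ihom X).map (c.ι.app j) ≫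
          (ihom X).map (hc.desc ((forget S L).mapCocone s)) := by
        rw [← Functor.map_comp, hc.fac]
        rfl
      rw [e] at h
      refine (colimit.ι_desc_assoc _ _ _).trans (h.trans ((assoc _ _ _).symm.trans ?_))
      exact (congrArg (· ≫ _) (ι_filteredColimit_rel_arrow hS hL hc R j).symm).trans (assoc _ _ _)⟩)
  fac s j := Hom.ext (hc.fac _ j)
  uniq s m hm := Hom.ext (hc.hom_ext fun j =>
    (congrArg Hom.hom (hm j)).trans (hc.fac ((forget S L).mapCocone s) j).symm)

include hS hL

/-- It suffices to inspect the colimit cocone just constructed, which lies over a colimit of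
carriers. -/
theorem preservesColimitsOfShape_forget : PreservesColimitsOfShape J (forget S L) where
  preservesColimit {D} := preservesColimit_of_preserves_colimit_cocone
    (isColimitFilteredColimitCocone hS hL (colimit.isColimit (D ⋙ forget S L)))
    ((colimit.isColimit (D ⋙ forget S L)).ofIsoColimit (Cocone.ext (Iso.refl _) fun _ =>
      comp_id _))

theorem preservesColimitsOfShape_relFunctor (R : L.Rel) :
    PreservesColimitsOfShape J (relFunctor S R) where
  preservesColimit {D} := preservesColimit_of_preserves_colimit_cocone
    (isColimitFilteredColimitCocone hS hL (colimit.isColimit (D ⋙ forget S L)))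
    ((colimit.isColimit (D ⋙ relFunctor S R)).ofIsoColimit (Cocone.ext (Iso.refl _) fun j => by
      refine (comp_id _).trans ?_
      have : Mono ((filteredColimit hS hL (colimit.isColimit (D ⋙ forget S L))).rel R).arrow :=
        S.mono_of_right _ (MSubobject.mem _)
      refine (cancel_mono
        ((filteredColimit hS hL (colimit.isColimit (D ⋙ forget S L))).rel R).arrow).1 ?_
      exact (ι_filteredColimit_rel_arrow hS hL _ R j).trans (relMap_arrow
        ((filteredColimitCocone hS hL (colimit.isColimit (D ⋙ forget S L))).ι.app j) R).symm))

end

end Str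

end FilteredColimits

/-! ### Functoriality of the hom objects -/

section HomWhisker

variable {V : Type u} [Category.{w} V] [MonoidalCategory V] [MonoidalClosed V] [HasLimits V]
  {S : ProperFactorizationSystem V} {L : Language.{w} V}

namespace Str

/-- Postcomposition on hom objects. -/
def homPost (F : Str S L) {A B : Str S L} (g : A ⟶ B) : homObj F A ⟶ homObj F B :=
  eHomWhiskerLeft V F g

/-- Precomposition on hom objects. -/
def homPre {A B : Str S L} (h : A ⟶ B) (K : Str S L) : homObj B K ⟶ homObj A K :=
  eHomWhiskerRight V h K

theorem homPost_homι (F : Str S L) {A B : Str S L} (g : A ⟶ B) :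
    homPost F g ≫ homι F B = homι F A ≫ (ihom F.carrier).map (Hom.hom g) := by
  have h : homObj F A ◁ homEquiv A B g ≫ (homι F A ⊗ₘ homι A B) ≫
      MonoidalClosed.comp F.carrier A.carrier B.carrier =
        homι F A ▷ 𝟙_ V ≫ (ρ_ _).hom ≫ (ihom F.carrier).map (Hom.hom g) := by
    rw [← MonoidalClosed.whiskerLeft_curry'_comp, ← homEquiv_homι, MonoidalCategory.tensorHom_def,
      MonoidalCategory.whiskerLeft_comp, assoc, assoc, whisker_exchange_assoc]
  refine Eq.trans (b := (ρ_ _).inv ≫ homObj F A ◁ homEquiv A B g ≫ eComp V F A B ≫ homι F B) ?_ ?_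
  · simp only [homPost, eHomWhiskerLeft, assoc]; rfl
  · rw [eComp_homι]
    erw [h]
    rw [rightUnitor_naturality_assoc, Iso.inv_hom_id_assoc]

theorem homPre_homι {A B : Str S L} (h : A ⟶ B) (K : Str S L) :
    homPre h K ≫ homι A K = homι B K ≫ (pre (Hom.hom h)).app K.carrier := by
  have e : homEquiv A B h ▷ homObj B K ≫ (homι A B ⊗ₘ homι B K) ≫
      MonoidalClosed.comp A.carrier B.carrier K.carrier =
        (λ_ _).hom ≫ homι B K ≫ (pre (Hom.hom h)).app K.carrier := by
    rw [MonoidalCategory.tensorHom_def, assoc, ← comp_whiskerRight_assoc, homEquiv_homι,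
      whiskerLeft_comp_eq_act, curry'_whiskerRight_act, ← MonoidalClosed.curry_pre_app,
      MonoidalClosed.curry_uncurry]
  refine Eq.trans (b := (λ_ _).inv ≫ homEquiv A B h ▷ homObj B K ≫ eComp V A B K ≫ homι A K) ?_ ?_
  · simp only [homPre, eHomWhiskerRight, assoc]; rfl
  · rw [eComp_homι]
    erw [e]
    rw [Iso.inv_hom_id_assoc]

end Str

theorem IsPresentation.homPost_evalGen {X : V} {F : Str S L} (x : X ⟶ F.carrier)
    {A B : Str S L} (g : A ⟶ B) : Str.homPost F g ≫ evalGen B x =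
      evalGen A x ≫ (ihom X).map (Str.Hom.hom g) := by
  rw [evalGen, evalGen, reassoc_of% (Str.homPost_homι F g), assoc,
    MonoidalClosed.pre_comm_ihom_map]

end HomWhisker

/-! ### Formulas in filtered colimits, and presentability of presented structures -/

theorem isCardinalPresentable_sigma {V : Type u} [Category.{w} V] [HasColimits V]
    {κ : Cardinal.{w}} [Fact κ.IsRegular] {J : Type w} (hJ : Cardinal.mk J < κ) (Y : J → V)
    (hY : ∀ j, IsCardinalPresentable (Y j) κ) : IsCardinalPresentable (∐ Y) κ := by
  have (k : Discrete J) : IsCardinalPresentable ((Discrete.functor Y).obj k) κ := hY k.as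
  refine isCardinalPresentable_of_isColimit _ (colimit.isColimit (Discrete.functor Y)) κ ?_
  rwa [hasCardinalLT_arrow_discrete_iff, hasCardinalLT_iff_cardinal_mk_lt]

variable {V : Type u} [Category.{w} V] [MonoidalCategory V]
  {κ : Cardinal.{w}} [Fact κ.IsRegular] [IsLocallyPresentableAsClosed V κ] {L : Language.{w} V}

theorem LTerm.isCardinalPresentable (hL : L.IsAry κ) {X Y : V} (t : LTerm L κ X Y) :
    IsCardinalPresentable X κ ∧ IsCardinalPresentable Y κ := by
  induction t with
  | ofHom hX hY f => exact ⟨hX, hY⟩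
  | symb f => exact ⟨hL.dom f, hL.cod f⟩
  | pow Z hZ t ih =>
    exact ⟨IsLocallyPresentableAsClosed.presentable_tensor _ _ ih.1 hZ,
      IsLocallyPresentableAsClosed.presentable_tensor _ _ ih.2 hZ⟩
  | family hX hJ Y t ih => exact ⟨hX, isCardinalPresentable_sigma hJ Y fun j => (ih j).2⟩
  | comp t s iht ihs => exact ⟨iht.1, ihs.2⟩

variable [MonoidalClosed V] {S : ProperFactorizationSystem V}
  {J : Type w} [SmallCategory J] [IsCardinalFiltered J κ]

section

variable (hS : S.RightClosedUnderFilteredColimits κ) (hL : L.IsAry κ) {D : J ⥤ Str S L}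

include hS hL

theorem Str.exists_hom_of_isColimit {c : Cocone D} (hc : IsColimit c) {X G : V}
    (hX : IsCardinalPresentable X κ) (hG : IsCardinalPresentable G κ)
    (p : G ⟶ (ihom X).obj c.pt.carrier) :
    ∃ (j : J) (a : G ⟶ (ihom X).obj (D.obj j).carrier),
      a ≫ (ihom X).map (Str.Hom.hom (c.ι.app j)) = p := by
  have := Str.preservesColimitsOfShape_forget hS hL (J := J)
  exact IsCardinalPresentable.exists_hom_of_isColimit κ
    (Str.isColimitMapIhom X hX (isColimitOfPreserves (Str.forget S L) hc)) p

theorem Str.exists_eq_of_isColimit {c : Cocone D} (hc : IsColimit c) {X G : V}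
    (hX : IsCardinalPresentable X κ) (hG : IsCardinalPresentable G κ) {j : J}
    (a b : G ⟶ (ihom X).obj (D.obj j).carrier)
    (h : a ≫ (ihom X).map (Str.Hom.hom (c.ι.app j)) =
      b ≫ (ihom X).map (Str.Hom.hom (c.ι.app j))) :
    ∃ (k : J) (u : j ⟶ k), a ≫ (ihom X).map (Str.Hom.hom (D.map u)) =
      b ≫ (ihom X).map (Str.Hom.hom (D.map u)) := by
  have := Str.preservesColimitsOfShape_forget hS hL (J := J)
  exact IsCardinalPresentable.exists_eq_of_isColimit' κ
    (Str.isColimitMapIhom X hX (isColimitOfPreserves (Str.forget S L) hc)) a b h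

/-- Relations of a filtered colimit are colimits of relations: the witness comes from some stage
`i`, and it agrees with `a` in the colimit, hence already at a stage beyond both `i` and `j`. -/
theorem Str.exists_rel_factors_of_isColimit {c : Cocone D} (hc : IsColimit c) (R : L.Rel) {G : V}
    (hG : IsCardinalPresentable G κ) {j : J} (a : G ⟶ (ihom (L.ar R)).obj (D.obj j).carrier)
    (h : (c.pt.rel R).Factors (a ≫ (ihom (L.ar R)).map (Str.Hom.hom (c.ι.app j)))) :
    ∃ (k : J) (u : j ⟶ k),
      ((D.obj k).rel R).Factors (a ≫ (ihom (L.ar R)).map (Str.Hom.hom (D.map u))) := by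
  have := Str.preservesColimitsOfShape_relFunctor hS hL (J := J) R
  obtain ⟨b, hb⟩ := h
  obtain ⟨i, (b : G ⟶ ((D.obj i).rel R).obj), rfl⟩ :=
    IsCardinalPresentable.exists_hom_of_isColimit κ
      (isColimitOfPreserves (Str.relFunctor S R) hc) b
  replace hb : (b ≫ Str.relMap (c.ι.app i) R) ≫ (c.pt.rel R).arrow = _ := hb
  have := isFiltered_of_isCardinalFiltered J κ
  let v := IsFiltered.leftToMax j i
  let v' := IsFiltered.rightToMax j i
  have e (k l : J) (u : k ⟶ l) : Str.Hom.hom (c.ι.app k) =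
      Str.Hom.hom (D.map u) ≫ Str.Hom.hom (c.ι.app l) := by
    rw [← Str.comp_hom]
    exact congrArg Str.Hom.hom (c.w u).symm
  obtain ⟨k, u, hu⟩ := Str.exists_eq_of_isColimit hS hL hc (hL.ar R) hG
    (a ≫ (ihom (L.ar R)).map (Str.Hom.hom (D.map v)))
    (b ≫ ((D.obj i).rel R).arrow ≫ (ihom (L.ar R)).map (Str.Hom.hom (D.map v'))) (by
      rw [assoc, assoc, assoc, ← Functor.map_comp, ← Functor.map_comp, ← e, ← e, ← hb, assoc,
        Str.relMap_arrow (B := c.pt)])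
  refine ⟨k, v ≫ u, b ≫ Str.relMap (D.map (v' ≫ u)) R, ?_⟩
  rw [assoc, Str.relMap_arrow, Functor.map_comp, Functor.map_comp, Str.comp_hom, Str.comp_hom,
    Functor.map_comp, Functor.map_comp, ← assoc a, hu, assoc, assoc]

variable [SymmetricCategory V]

theorem Atomic.exists_factors_of_isColimit {c : Cocone D} (hc : IsColimit c) {X G : V}
    (hG : IsCardinalPresentable G κ) (α : Atomic L κ X) {j : J}
    (a : G ⟶ (ihom X).obj (D.obj j).carrier)
    (h : (α.interp c.pt).Factors (a ≫ (ihom X).map (Str.Hom.hom (c.ι.app j)))) :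
    ∃ (k : J) (u : j ⟶ k),
      (α.interp (D.obj k)).Factors (a ≫ (ihom X).map (Str.Hom.hom (D.map u))) := by
  rcases α with ⟨s, t⟩ | ⟨R, Y, hY, t⟩
  · rw [Atomic.eq_factors_iff, assoc, assoc, ← LTerm.interp_map, ← LTerm.interp_map] at h
    obtain ⟨k, u, hu⟩ := Str.exists_eq_of_isColimit hS hL hc (s.isCardinalPresentable hL).2 hG
      (a ≫ s.interp _) (a ≫ t.interp _) (by simpa only [assoc] using h)
    refine ⟨k, u, ?_⟩
    rw [Atomic.eq_factors_iff, assoc, assoc, ← LTerm.interp_map, ← LTerm.interp_map]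
    simpa only [assoc] using hu
  · have e {A B : Str S L} (g : A ⟶ B) (a : G ⟶ (ihom X).obj A.carrier) :
        uncurry (((a ≫ (ihom X).map (Str.Hom.hom g)) ≫ t.interp B) ≫
          (powerTensorIso (L.ar R) Y B.carrier).inv) =
        uncurry ((a ≫ t.interp A) ≫ (powerTensorIso (L.ar R) Y A.carrier).inv) ≫
          (ihom (L.ar R)).map (Str.Hom.hom g) := by
      have := uncurry_rel_act (t.interp A) (t.interp B) _
        (LTerm.interp_act (Str.Hom.isGenHom g) t) a
      rw [act_rightUnitor, act_rightUnitor, rightUnitor_naturality_assoc,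
        rightUnitor_naturality_assoc, rightUnitor_tensor_hom, assoc, assoc, assoc, assoc,
        Iso.inv_hom_id_assoc, MonoidalClosed.uncurry_natural_left (ρ_ G).hom, cancel_epi] at this
      simpa only [assoc] using this
    have hYG := IsLocallyPresentableAsClosed.presentable_tensor Y G hY hG
    rw [Atomic.rel_factors_iff, e] at h
    obtain ⟨k, u, hu⟩ := Str.exists_rel_factors_of_isColimit hS hL hc R hYG _ h
    refine ⟨k, u, ?_⟩
    rwa [Atomic.rel_factors_iff, e]

theorem Conj.exists_factors_of_isColimit {c : Cocone D} (hc : IsColimit c) {X G : V}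
    (hG : IsCardinalPresentable G κ) (φ : Conj L κ X) {j : J}
    (a : G ⟶ (ihom X).obj (D.obj j).carrier)
    (h : (φ.interp c.pt).Factors (a ≫ (ihom X).map (Str.Hom.hom (c.ι.app j)))) :
    ∃ (k : J) (u : j ⟶ k),
      (φ.interp (D.obj k)).Factors (a ≫ (ihom X).map (Str.Hom.hom (D.map u))) := by
  rw [Conj.factors_iff] at h
  choose k u hu using fun i => Atomic.exists_factors_of_isColimit hS hL hc hG (φ.atom i) a (h i)
  -- Each atom becomes true at its own stage; as there are fewer than `κ` atoms, one later stage
  -- serves them all.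
  obtain ⟨m, v, b, hb⟩ := IsCardinalFiltered.wideSpan (κ := κ) u
    ((hasCardinalLT_iff_cardinal_mk_lt _ _).2 φ.card_lt)
  refine ⟨m, b, ?_⟩
  rw [Conj.factors_iff]
  intro i
  -- The atom is treated as a conjunction of length one, so that preservation along morphisms
  -- applies.
  have := Conj.Factors.map (φ := ⟨PUnit, (Cardinal.mk_lt_aleph0).trans_le
    (Fact.out : κ.IsRegular).aleph0_le, fun _ => φ.atom i⟩) ((Conj.factors_iff _ _ _).2 fun _ => hu i)
    (D.map (v i))
  rw [Conj.factors_iff, assoc, ← Functor.map_comp, ← Str.comp_hom, ← Functor.map_comp, hb] at this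
  exact this ⟨⟩

/-- Evaluation at the generators embeds the hom object in a power, with image cut out by `φ`. A map
from a presentable object into it descends first as a map into the power; at a later stage it
satisfies `φ`. -/
theorem IsPresentation.isEnrichedPresentable {X : V} (hX : IsCardinalPresentable X κ)
    {φ : Conj L κ X} {F : Str S L} {x : X ⟶ F.carrier} (hF : IsPresentation φ F x) :
    Str.IsEnrichedPresentable κ F where
  preservesColimitOfShape J _ _ := ⟨fun {D} => ⟨fun {c} hc => ⟨by
    apply isColimitOfPresentable κ
    · intro G hG (l : G ⟶ Str.homObj F c.pt)
      obtain ⟨j, a, ha⟩ := Str.exists_hom_of_isColimit hS hL hc hX hG (l ≫ evalGen _ x)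
      obtain ⟨k, u, hu⟩ := Conj.exists_factors_of_isColimit hS hL hc hG φ a (by
        rw [ha]
        exact (hF.factors_evalGen _).precomp l)
      obtain ⟨l', hl', -⟩ := hF.existsUnique_lift _ _ hu
      refine ⟨k, l', ?_⟩
      have := hF.mono_evalGen c.pt
      refine (cancel_mono (evalGen c.pt x)).1
        ((?_ : (l' ≫ Str.homPost F (c.ι.app k)) ≫ evalGen c.pt x = l ≫ evalGen c.pt x))
      rw [← ha, assoc, homPost_evalGen (B := c.pt), ← assoc, hl', assoc, ← Functor.map_comp, ← Str.comp_hom]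
      exact congrArg (fun v => a ≫ (ihom X).map (Str.Hom.hom v)) (c.w u)
    · intro G hG j (l : G ⟶ Str.homObj F (D.obj j)) (l' : G ⟶ Str.homObj F (D.obj j)) h
      obtain ⟨k, u, hu⟩ := Str.exists_eq_of_isColimit hS hL hc hX hG (l ≫ evalGen _ x)
        (l' ≫ evalGen _ x) (by
          have h : l ≫ Str.homPost F (c.ι.app j) = l' ≫ Str.homPost F (c.ι.app j) := h
          rw [assoc, assoc]
          erw [← homPost_evalGen, reassoc_of% h])
      refine ⟨k, u, ?_⟩
      have := hF.mono_evalGen (D.obj k)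
      refine (cancel_mono (evalGen (D.obj k) x)).1
        (?_ : (l ≫ Str.homPost F (D.map u)) ≫ _ = (l' ≫ Str.homPost F (D.map u)) ≫ _)
      rw [assoc, assoc, homPost_evalGen]
      simpa only [assoc] using hu⟩⟩⟩

end

/-! ### Formal structures, their free objects and colimits -/

section PreStr

section Single

variable {V : Type u} [Category.{w} V] [HasColimits V]

/-- The family supported at one index. -/
abbrev single {I : Type w} (i : I) (Z : V) (j : I) : V := ∐ fun _ : ULift.{w} (PLift (i = j)) => Z

def singleι {I : Type w} (i : I) (Z : V) : Z ⟶ single i Z i :=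
  Sigma.ι (fun _ : ULift.{w} (PLift (i = i)) => Z) ⟨⟨rfl⟩⟩

theorem single_hom_ext {I : Type w} {i : I} {Z : V} {T : I → V} {a b : ∀ j, single i Z j ⟶ T j}
    (h : singleι i Z ≫ a i = singleι i Z ≫ b i) (j : I) : a j = b j := by
  refine Sigma.hom_ext _ _ fun ⟨⟨e⟩⟩ => ?_
  subst e
  exact h

def singleDesc {I : Type w} {i : I} {Z : V} {T : I → V} (a : Z ⟶ T i) (j : I) :
    single i Z j ⟶ T j :=
  Sigma.desc fun e => a ≫ eqToHom (congrArg T e.down.down)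

theorem singleι_singleDesc {I : Type w} {i : I} {Z : V} {T : I → V} (a : Z ⟶ T i) :
    singleι i Z ≫ singleDesc a i = a := by
  simp [singleι, singleDesc]

end Single

/-- Structures in which the powers and the subobjects are replaced by arbitrary objects. -/
structure PreStr {V : Type u} [Category.{w} V] [MonoidalCategory V] (L : Language.{w} V) where
  carrier : V
  pow : L.Func → V
  sub : L.Rel → V
  dom (f : L.Func) : L.dom f ⊗ pow f ⟶ carrier
  cod (f : L.Func) : L.cod f ⊗ pow f ⟶ carrier
  rel (R : L.Rel) : L.ar R ⊗ sub R ⟶ carrier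

namespace PreStr

section

variable {V : Type u} [Category.{w} V] [MonoidalCategory V] {L : Language.{w} V}

@[ext]
structure Hom (p q : PreStr L) where
  hom : p.carrier ⟶ q.carrier
  pow (f : L.Func) : p.pow f ⟶ q.pow f
  sub (R : L.Rel) : p.sub R ⟶ q.sub R
  dom_comm (f : L.Func) : p.dom f ≫ hom = L.dom f ◁ pow f ≫ q.dom f
  cod_comm (f : L.Func) : p.cod f ≫ hom = L.cod f ◁ pow f ≫ q.cod f
  rel_comm (R : L.Rel) : p.rel R ≫ hom = L.ar R ◁ sub R ≫ q.rel R

@[simps]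
instance : Category (PreStr L) where
  Hom := Hom
  id p := ⟨𝟙 _, fun _ => 𝟙 _, fun _ => 𝟙 _, by simp, by simp, by simp⟩
  comp h g := ⟨h.hom ≫ g.hom, fun f => h.pow f ≫ g.pow f, fun R => h.sub R ≫ g.sub R,
    fun f => by rw [reassoc_of% h.dom_comm, g.dom_comm, MonoidalCategory.whiskerLeft_comp_assoc],
    fun f => by rw [reassoc_of% h.cod_comm, g.cod_comm, MonoidalCategory.whiskerLeft_comp_assoc],
    fun R => by rw [reassoc_of% h.rel_comm, g.rel_comm, MonoidalCategory.whiskerLeft_comp_assoc]⟩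
  id_comp _ := Hom.ext (id_comp _) (funext fun _ => id_comp _) (funext fun _ => id_comp _)
  comp_id _ := Hom.ext (comp_id _) (funext fun _ => comp_id _) (funext fun _ => comp_id _)
  assoc _ _ _ := Hom.ext (assoc _ _ _) (funext fun _ => assoc _ _ _)
    (funext fun _ => assoc _ _ _)

theorem hom_ext {p q : PreStr L} {g h : p ⟶ q} (h₁ : Hom.hom g = Hom.hom h)
    (h₂ : ∀ f, Hom.pow g f = Hom.pow h f) (h₃ : ∀ R, Hom.sub g R = Hom.sub h R) : g = h :=
  Hom.ext h₁ (funext h₂) (funext h₃)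

@[simps]
def carrierFunctor (L : Language.{w} V) : PreStr L ⥤ V where
  obj p := p.carrier
  map h := Hom.hom h

@[simps]
def powFunctor {L : Language.{w} V} (f : L.Func) : PreStr L ⥤ V where
  obj p := p.pow f
  map h := Hom.pow h f

@[simps]
def subFunctor {L : Language.{w} V} (R : L.Rel) : PreStr L ⥤ V where
  obj p := p.sub R
  map h := Hom.sub h R

@[simps]
def domNatTrans {L : Language.{w} V} (f : L.Func) :
    powFunctor f ⋙ tensorLeft (L.dom f) ⟶ carrierFunctor L where
  app p := p.dom f
  naturality _ _ h := (Hom.dom_comm h f).symm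

@[simps]
def codNatTrans {L : Language.{w} V} (f : L.Func) :
    powFunctor f ⋙ tensorLeft (L.cod f) ⟶ carrierFunctor L where
  app p := p.cod f
  naturality _ _ h := (Hom.cod_comm h f).symm

@[simps]
def relNatTrans {L : Language.{w} V} (R : L.Rel) :
    subFunctor R ⋙ tensorLeft (L.ar R) ⟶ carrierFunctor L where
  app p := p.rel R
  naturality _ _ h := (Hom.rel_comm h R).symm

variable [HasColimits V]

/-- The free object on a carrier and on families of elements. -/
abbrev free (L : Language.{w} V) (A : V) (C : L.Func → V) (D : L.Rel → V) : PreStr L where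
  carrier := (A ⨿ ∐ fun f => L.dom f ⊗ C f) ⨿ ((∐ fun f => L.cod f ⊗ C f) ⨿
    ∐ fun R => L.ar R ⊗ D R)
  pow := C
  sub := D
  dom f := Sigma.ι (fun f => L.dom f ⊗ C f) f ≫ coprod.inr ≫ coprod.inl
  cod f := Sigma.ι (fun f => L.cod f ⊗ C f) f ≫ coprod.inl ≫ coprod.inr
  rel R := Sigma.ι (fun R => L.ar R ⊗ D R) R ≫ coprod.inr ≫ coprod.inr

theorem sigma_ι_coprod_desc₂ {I : Type w} {A B D T : V} {Y : I → V} (a : A ⟶ T)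
    (b : ∀ i, Y i ⟶ T) (c : B ⟶ T) (d : D ⟶ T) (i : I) :
    (Sigma.ι Y i ≫ coprod.inr ≫ coprod.inl) ≫
      coprod.desc (coprod.desc a (Sigma.desc b)) (coprod.desc c d) = b i := by
  rw [assoc, assoc, coprod.inl_desc, coprod.inr_desc, Sigma.ι_desc]

theorem sigma_ι_coprod_desc₃ {I : Type w} {A B D T : V} {Y : I → V} (a : A ⟶ T)
    (b : B ⟶ T) (c : ∀ i, Y i ⟶ T) (d : D ⟶ T) (i : I) :
    (Sigma.ι Y i ≫ coprod.inl ≫ coprod.inr) ≫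
      coprod.desc (coprod.desc a b) (coprod.desc (Sigma.desc c) d) = c i := by
  rw [assoc, assoc, coprod.inr_desc, coprod.inl_desc, Sigma.ι_desc]

theorem sigma_ι_coprod_desc₄ {I : Type w} {A B D T : V} {Y : I → V} (a : A ⟶ T)
    (b : B ⟶ T) (c : D ⟶ T) (d : ∀ i, Y i ⟶ T) (i : I) :
    (Sigma.ι Y i ≫ coprod.inr ≫ coprod.inr) ≫
      coprod.desc (coprod.desc a b) (coprod.desc c (Sigma.desc d)) = d i := by
  rw [assoc, assoc, coprod.inr_desc, coprod.inr_desc, Sigma.ι_desc]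

def freeDesc {A : V} {C : L.Func → V} {D : L.Rel → V} {p : PreStr L} (a : A ⟶ p.carrier)
    (c : ∀ f, C f ⟶ p.pow f) (d : ∀ R, D R ⟶ p.sub R) : free L A C D ⟶ p where
  hom := coprod.desc (coprod.desc a (Sigma.desc fun f => L.dom f ◁ c f ≫ p.dom f))
    (coprod.desc (Sigma.desc fun f => L.cod f ◁ c f ≫ p.cod f)
      (Sigma.desc fun R => L.ar R ◁ d R ≫ p.rel R))
  pow := c
  sub := d
  dom_comm f := sigma_ι_coprod_desc₂ _ _ _ _ f
  cod_comm f := sigma_ι_coprod_desc₃ _ _ _ _ f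
  rel_comm R := sigma_ι_coprod_desc₄ _ _ _ _ R

/-- The generators of a free object. -/
def freeGen (L : Language.{w} V) (A : V) (C : L.Func → V) (D : L.Rel → V) :
    A ⟶ (free L A C D).carrier := coprod.inl ≫ coprod.inl

theorem freeGen_freeDesc {A : V} {C : L.Func → V} {D : L.Rel → V} {p : PreStr L}
    (a : A ⟶ p.carrier) (c : ∀ f, C f ⟶ p.pow f) (d : ∀ R, D R ⟶ p.sub R) :
    freeGen L A C D ≫ Hom.hom (freeDesc a c d) = a :=
  (assoc _ _ _).trans ((congrArg (_ ≫ ·) (coprod.inl_desc _ _)).trans (coprod.inl_desc _ _))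

theorem free_hom_ext {A : V} {C : L.Func → V} {D : L.Rel → V} {p : PreStr L}
    {g h : free L A C D ⟶ p} (h₁ : freeGen L A C D ≫ Hom.hom g = freeGen L A C D ≫ Hom.hom h)
    (h₂ : ∀ f, Hom.pow g f = Hom.pow h f) (h₃ : ∀ R, Hom.sub g R = Hom.sub h R) : g = h := by
  refine hom_ext ?_ h₂ h₃
  apply coprod.hom_ext <;> apply coprod.hom_ext
  · simpa [freeGen] using h₁
  · refine Sigma.hom_ext _ _ fun f => ?_
    have := Hom.dom_comm g f
    rw [h₂, ← Hom.dom_comm h f] at this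
    simpa using this
  · refine Sigma.hom_ext _ _ fun f => ?_
    have := Hom.cod_comm g f
    rw [h₂, ← Hom.cod_comm h f] at this
    simpa using this
  · refine Sigma.hom_ext _ _ fun R => ?_
    have := Hom.rel_comm g R
    rw [h₃, ← Hom.rel_comm h R] at this
    simpa using this

/-- The free object on an object of the base. -/
abbrev freeCarrier (L : Language.{w} V) (Z : V) : PreStr L :=
  free L Z (fun _ => ⊥_ V) (fun _ => ⊥_ V)

/-- The free object on a generalized element of a power. -/
abbrev freePow {L : Language.{w} V} (f : L.Func) (Z : V) : PreStr L :=
  free L (⊥_ V) (single f Z) (fun _ => ⊥_ V)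

/-- The free object on a generalized element of a relation. -/
abbrev freeSub {L : Language.{w} V} (R : L.Rel) (Z : V) : PreStr L :=
  free L (⊥_ V) (fun _ => ⊥_ V) (single R Z)

def freeCarrierEquiv (Z : V) (p : PreStr L) : (freeCarrier L Z ⟶ p) ≃ (Z ⟶ p.carrier) where
  toFun g := freeGen L _ _ _ ≫ Hom.hom g
  invFun a := freeDesc a (fun _ => initial.to _) (fun _ => initial.to _)
  left_inv g := free_hom_ext (freeGen_freeDesc _ _ _) (fun _ => Subsingleton.elim _ _)
    (fun _ => Subsingleton.elim _ _)
  right_inv a := freeGen_freeDesc _ _ _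

def freePowEquiv (f : L.Func) (Z : V) (p : PreStr L) : (freePow f Z ⟶ p) ≃ (Z ⟶ p.pow f) where
  toFun g := singleι f Z ≫ Hom.pow g f
  invFun a := freeDesc (initial.to _) (singleDesc a) (fun _ => initial.to _)
  left_inv g := free_hom_ext (Subsingleton.elim _ _) (single_hom_ext (singleι_singleDesc _))
    (fun _ => Subsingleton.elim _ _)
  right_inv a := singleι_singleDesc _

def freeSubEquiv (R : L.Rel) (Z : V) (p : PreStr L) : (freeSub R Z ⟶ p) ≃ (Z ⟶ p.sub R) where
  toFun g := singleι R Z ≫ Hom.sub g R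
  invFun a := freeDesc (initial.to _) (fun _ => initial.to _) (singleDesc a)
  left_inv g := free_hom_ext (Subsingleton.elim _ _) (fun _ => Subsingleton.elim _ _)
    (single_hom_ext (singleι_singleDesc _))
  right_inv a := singleι_singleDesc _

end

section Colimits

variable {V : Type u} [Category.{w} V] [MonoidalCategory V] [MonoidalClosed V] [HasColimits V]
  {L : Language.{w} V} {J : Type w} [SmallCategory J] (D : J ⥤ PreStr L)

def isColimitTensor (X : V) {F : J ⥤ V} {c : Cocone F} (hc : IsColimit c) :
    IsColimit ((tensorLeft X).mapCocone c) :=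
  isColimitOfPreserves (tensorLeft X) hc

/-- All structure maps go out of `X ⊗ -`, which is a left adjoint; this is why colimits are
componentwise. -/
abbrev colimitObj : PreStr L where
  carrier := colimit (D ⋙ carrierFunctor L)
  pow f := colimit (D ⋙ powFunctor f)
  sub R := colimit (D ⋙ subFunctor R)
  dom f := (isColimitTensor (L.dom f) (colimit.isColimit (D ⋙ powFunctor f))).desc
    ((Cocone.precompose (Functor.whiskerLeft D (domNatTrans f))).obj (colimit.cocone _))
  cod f := (isColimitTensor (L.cod f) (colimit.isColimit (D ⋙ powFunctor f))).desc
    ((Cocone.precompose (Functor.whiskerLeft D (codNatTrans f))).obj (colimit.cocone _))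
  rel R := (isColimitTensor (L.ar R) (colimit.isColimit (D ⋙ subFunctor R))).desc
    ((Cocone.precompose (Functor.whiskerLeft D (relNatTrans R))).obj (colimit.cocone _))

abbrev colimitCocone : Cocone D where
  pt := colimitObj D
  ι :=
    { app := fun j => Hom.mk (p := D.obj j) (q := colimitObj D)
        (colimit.ι (D ⋙ carrierFunctor L) j) (fun f => colimit.ι (D ⋙ powFunctor f) j)
        (fun R => colimit.ι (D ⋙ subFunctor R) j)
        (fun f => ((isColimitTensor (L.dom f) (colimit.isColimit (D ⋙ powFunctor f))).fac
          ((Cocone.precompose (Functor.whiskerLeft D (domNatTrans f))).obj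
            (colimit.cocone _)) j).symm)
        (fun f => ((isColimitTensor (L.cod f) (colimit.isColimit (D ⋙ powFunctor f))).fac
          ((Cocone.precompose (Functor.whiskerLeft D (codNatTrans f))).obj
            (colimit.cocone _)) j).symm)
        (fun R => ((isColimitTensor (L.ar R) (colimit.isColimit (D ⋙ subFunctor R))).fac
          ((Cocone.precompose (Functor.whiskerLeft D (relNatTrans R))).obj
            (colimit.cocone _)) j).symm)
      naturality := fun j k u => hom_ext
        ((colimit.w (D ⋙ carrierFunctor L) u).trans (comp_id _).symm)
        (fun f => (colimit.w (D ⋙ powFunctor f) u).trans (comp_id _).symm)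
        (fun R => (colimit.w (D ⋙ subFunctor R) u).trans (comp_id _).symm) }

theorem tensor_desc_comm {X : V} {P : PreStr L ⥤ V} (τ : P ⋙ tensorLeft X ⟶ carrierFunctor L)
    (s : Cocone D) : (isColimitTensor X (colimit.isColimit (D ⋙ P))).desc
        ((Cocone.precompose (Functor.whiskerLeft D τ)).obj (colimit.cocone _)) ≫
      colimit.desc (D ⋙ carrierFunctor L) ((carrierFunctor L).mapCocone s) =
      X ◁ colimit.desc (D ⋙ P) (P.mapCocone s) ≫ τ.app s.pt := by
  apply (isColimitTensor X (colimit.isColimit (D ⋙ P))).hom_ext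
  intro j
  have h₁ : X ◁ colimit.ι (D ⋙ P) j ≫ (isColimitTensor X (colimit.isColimit (D ⋙ P))).desc
        ((Cocone.precompose (Functor.whiskerLeft D τ)).obj (colimit.cocone _)) =
      τ.app (D.obj j) ≫ colimit.ι (D ⋙ carrierFunctor L) j :=
    (isColimitTensor X (colimit.isColimit (D ⋙ P))).fac _ j
  have h₂ := colimit.ι_desc ((carrierFunctor L).mapCocone s) j
  have h₃ := colimit.ι_desc (P.mapCocone s) j
  have h₄ := τ.naturality (s.ι.app j)
  dsimp at h₂ h₃ h₄ ⊢
  rw [reassoc_of% h₁]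
  erw [h₂]
  rw [← MonoidalCategory.whiskerLeft_comp_assoc]
  erw [h₃]
  exact h₄.symm

def isColimitColimitCocone : IsColimit (colimitCocone D) where
  desc s := Hom.mk (p := colimitObj D) (q := s.pt)
    (colimit.desc (D ⋙ carrierFunctor L) ((carrierFunctor L).mapCocone s))
    (fun f => colimit.desc (D ⋙ powFunctor f) ((powFunctor f).mapCocone s))
    (fun R => colimit.desc (D ⋙ subFunctor R) ((subFunctor R).mapCocone s))
    (fun f => tensor_desc_comm D (domNatTrans f) s)
    (fun f => tensor_desc_comm D (codNatTrans f) s)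
    (fun R => tensor_desc_comm D (relNatTrans R) s)
  fac s j := hom_ext (colimit.ι_desc _ _) (fun f => colimit.ι_desc _ _)
    (fun R => colimit.ι_desc _ _)
  uniq s m hm := hom_ext
    (colimit.hom_ext fun j => (congrArg Hom.hom (hm j)).trans
      (colimit.ι_desc ((carrierFunctor L).mapCocone s) j).symm)
    (fun f => colimit.hom_ext fun j => (congrArg (fun h => Hom.pow h f) (hm j)).trans
      (colimit.ι_desc ((powFunctor f).mapCocone s) j).symm)
    (fun R => colimit.hom_ext fun j => (congrArg (fun h => Hom.sub h R) (hm j)).trans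
      (colimit.ι_desc ((subFunctor R).mapCocone s) j).symm)

instance : HasColimitsOfSize.{w, w} (PreStr L) where
  has_colimits_of_shape _ _ := ⟨fun D => ⟨⟨_, isColimitColimitCocone D⟩⟩⟩

instance : PreservesColimitsOfShape J (carrierFunctor L) where
  preservesColimit {D} := preservesColimit_of_preserves_colimit_cocone (isColimitColimitCocone D)
    ((colimit.isColimit (D ⋙ carrierFunctor L)).ofIsoColimit
      (Cocone.ext (Iso.refl _) fun _ => comp_id _))

instance (f : L.Func) : PreservesColimitsOfShape J (powFunctor f) where
  preservesColimit {D} := preservesColimit_of_preserves_colimit_cocone (isColimitColimitCocone D)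
    ((colimit.isColimit (D ⋙ powFunctor f)).ofIsoColimit
      (Cocone.ext (Iso.refl _) fun _ => comp_id _))

variable {κ : Cardinal.{w}} [Fact κ.IsRegular]

/-- The represented functor is that of `Z` composed with the carrier functor, which preserves all
small colimits. -/
theorem isCardinalPresentable_freeCarrier {Z : V} (hZ : IsCardinalPresentable Z κ) :
    IsCardinalPresentable (freeCarrier L Z) κ where
  preservesColimitOfShape J _ _ := by
    have := hZ.preservesColimitOfShape J
    let e : carrierFunctor L ⋙ coyoneda.obj (op Z) ≅ coyoneda.obj (op (freeCarrier L Z)) :=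
      NatIso.ofComponents (fun p => (freeCarrierEquiv Z p).symm.toIso) fun {p q} g => by
        ext a
        exact free_hom_ext ((freeGen_freeDesc _ _ _).trans ((congrArg (· ≫ _)
          (freeGen_freeDesc _ _ _).symm).trans (assoc _ _ _))) (fun _ => initial.hom_ext _ _)
            (fun _ => initial.hom_ext _ _)
    exact preservesColimitsOfShape_of_natIso e

theorem isCardinalPresentable_freePow (f : L.Func) {Z : V} (hZ : IsCardinalPresentable Z κ) :
    IsCardinalPresentable (freePow f Z) κ where
  preservesColimitOfShape J _ _ := by
    have := hZ.preservesColimitOfShape J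
    let e : powFunctor f ⋙ coyoneda.obj (op Z) ≅ coyoneda.obj (op (freePow f Z)) :=
      NatIso.ofComponents (fun p => (freePowEquiv f Z p).symm.toIso) fun {p q} g => by
        ext a
        exact free_hom_ext (initial.hom_ext _ _) (single_hom_ext
          ((singleι_singleDesc _).trans ((congrArg (· ≫ _)
            (singleι_singleDesc _).symm).trans (assoc _ _ _))))
            (fun _ => initial.hom_ext _ _)
    exact preservesColimitsOfShape_of_natIso e

end Colimits

end PreStr

end PreStr

/-! ### Structures as a reflective subcategory of formal structures -/

section Reflection

variable {V : Type u} [Category.{w} V] [MonoidalCategory V] [MonoidalClosed V]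
  {S : ProperFactorizationSystem V} {L : Language.{w} V}

theorem whiskerLeft_ev {X Z A : V} (a : Z ⟶ (ihom X).obj A) :
    X ◁ a ≫ (ihom.ev X).app A = uncurry a := (MonoidalClosed.uncurry_eq a).symm

theorem isIso_curry_ev (X A : V) : IsIso (curry ((ihom.ev X).app A)) := by
  rw [← MonoidalClosed.uncurry_id_eq_ev, MonoidalClosed.curry_uncurry]
  infer_instance

namespace Str

/-- The powers and relations of a structure. -/
@[simps]
def toPre (S : ProperFactorizationSystem V) (L : Language.{w} V) : Str S L ⥤ PreStr L where
  obj A :=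
    { carrier := A.carrier
      pow := fun f => (ihom (L.dom f)).obj A.carrier
      sub := fun R => (A.rel R).obj
      dom := fun f => (ihom.ev (L.dom f)).app A.carrier
      cod := fun f => uncurry (A.func f)
      rel := fun R => uncurry (A.rel R).arrow }
  map {A B} h :=
    { hom := Hom.hom h
      pow := fun f => (ihom (L.dom f)).map (Hom.hom h)
      sub := fun R => relMap h R
      dom_comm := fun f => ((ihom.ev (L.dom f)).naturality (Hom.hom h)).symm
      cod_comm := fun f => by
        rw [← MonoidalClosed.uncurry_natural_right, ← MonoidalClosed.uncurry_natural_left,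
          Hom.func_comm]
      rel_comm := fun R => by
        rw [← MonoidalClosed.uncurry_natural_right, ← MonoidalClosed.uncurry_natural_left,
          relMap_arrow] }
  map_id A := PreStr.hom_ext rfl (fun f => (ihom (L.dom f)).map_id A.carrier)
    (fun R => (relFunctor S R).map_id A)
  map_comp h g := PreStr.hom_ext rfl (fun f => (ihom (L.dom f)).map_comp _ _)
    (fun R => (relFunctor S R).map_comp h g)

/-- In a genuine structure the power components are transposes of carrier data and the relations are
monic, so the carrier component decides everything. -/
theorem toPre_hom_ext {p : PreStr L} {A : Str S L} {g h : p ⟶ (toPre S L).obj A}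
    (e : PreStr.Hom.hom g = PreStr.Hom.hom h) : g = h := by
  refine PreStr.hom_ext e (fun f => ?_) (fun R => ?_)
  · apply MonoidalClosed.uncurry_injective
    have h₁ := PreStr.Hom.dom_comm g f
    have h₂ := PreStr.Hom.dom_comm h f
    rw [e] at h₁
    exact (whiskerLeft_ev _).symm.trans (h₁.symm.trans (h₂.trans (whiskerLeft_ev _)))
  · refine (cancel_mono (A.rel R).arrow).1 (MonoidalClosed.uncurry_injective ?_)
    have h₁ := PreStr.Hom.rel_comm g R
    have h₂ := PreStr.Hom.rel_comm h R
    rw [e] at h₁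
    exact (MonoidalClosed.uncurry_natural_left _ _).trans (h₁.symm.trans (h₂.trans
      (MonoidalClosed.uncurry_natural_left _ _).symm))

theorem uncurry_pow {p : PreStr L} {A : Str S L} (g : p ⟶ (toPre S L).obj A) (f : L.Func) :
    uncurry (X := A.carrier) (PreStr.Hom.pow g f) = p.dom f ≫ PreStr.Hom.hom g :=
  (whiskerLeft_ev _).symm.trans (PreStr.Hom.dom_comm g f).symm

theorem uncurry_pow_func {p : PreStr L} {A : Str S L} (g : p ⟶ (toPre S L).obj A) (f : L.Func) :
    uncurry (PreStr.Hom.pow g f ≫ A.func f) = p.cod f ≫ PreStr.Hom.hom g :=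
  (MonoidalClosed.uncurry_natural_left _ _).trans (PreStr.Hom.cod_comm g f).symm

theorem uncurry_sub_arrow {p : PreStr L} {A : Str S L} (g : p ⟶ (toPre S L).obj A) (R : L.Rel) :
    uncurry (PreStr.Hom.sub g R ≫ (A.rel R).arrow) = p.rel R ≫ PreStr.Hom.hom g :=
  (MonoidalClosed.uncurry_natural_left _ _).trans (PreStr.Hom.rel_comm g R).symm

/-- A carrier map is a morphism of structures as soon as this is seen on data that cover `A`:
equations are cancelled along the epimorphisms `up f`, and `us R` detects factorization through
subobjects. -/
theorem exists_hom_of_generators {p : PreStr L} {A B : Str S L} {u₀ : p.carrier ⟶ A.carrier}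
    {up : ∀ f, p.pow f ⟶ (ihom (L.dom f)).obj A.carrier} {us : ∀ R, p.sub R ⟶ (A.rel R).obj}
    (hu₁ : ∀ f, uncurry (up f) = p.dom f ≫ u₀)
    (hu₂ : ∀ f, uncurry (up f ≫ A.func f) = p.cod f ≫ u₀)
    (hu₃ : ∀ R, uncurry (us R ≫ (A.rel R).arrow) = p.rel R ≫ u₀)
    {g₀ : p.carrier ⟶ B.carrier}
    {gp : ∀ f, p.pow f ⟶ (ihom (L.dom f)).obj B.carrier} {gs : ∀ R, p.sub R ⟶ (B.rel R).obj}
    (hg₁ : ∀ f, uncurry (gp f) = p.dom f ≫ g₀)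
    (hg₂ : ∀ f, uncurry (gp f ≫ B.func f) = p.cod f ≫ g₀)
    (hg₃ : ∀ R, uncurry (gs R ≫ (B.rel R).arrow) = p.rel R ≫ g₀)
    (hp : ∀ f, Epi (up f))
    (hs : ∀ (R : L.Rel) {Z : V} (P : MSubobject S Z) (k : (A.rel R).obj ⟶ Z),
      P.Factors (us R ≫ k) → P.Factors k)
    (h : A.carrier ⟶ B.carrier) (hh : u₀ ≫ h = g₀) : ∃ k : A ⟶ B, Hom.hom k = h := by
  have e (f : L.Func) : up f ≫ (ihom (L.dom f)).map h = gp f := by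
    apply MonoidalClosed.uncurry_injective
    rw [MonoidalClosed.uncurry_natural_right, hu₁, hg₁, assoc, hh]
  refine ⟨⟨h, fun f => ?_, fun R => ?_⟩, rfl⟩
  · have := hp f
    refine (cancel_epi (up f)).1 (MonoidalClosed.uncurry_injective ?_)
    rw [reassoc_of% (e f), hg₂, ← assoc, MonoidalClosed.uncurry_natural_right, hu₂, assoc, hh]
  · refine hs R (B.rel R) _ ⟨gs R, MonoidalClosed.uncurry_injective ?_⟩
    rw [← assoc (us R), MonoidalClosed.uncurry_natural_right, hg₃, hu₃, assoc, hh]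

/-- A sufficient condition for a morphism to be universal among those into structures. -/
theorem exists_toPre_map_of_isIso {p : PreStr L} {A : Str S L} (u : p ⟶ (toPre S L).obj A)
    (hc : IsIso (C := V) (PreStr.Hom.hom u)) (hp : ∀ f, Epi (PreStr.Hom.pow u f))
    (hs : ∀ (R : L.Rel) {Z : V} (P : MSubobject S Z) (k : (A.rel R).obj ⟶ Z),
      P.Factors (PreStr.Hom.sub u R ≫ k) → P.Factors k)
    {B : Str S L} (g : p ⟶ (toPre S L).obj B) : ∃! h : A ⟶ B, u ≫ (toPre S L).map h = g := by
  obtain ⟨h, hh⟩ : ∃ h : A.carrier ⟶ B.carrier, PreStr.Hom.hom u ≫ h = PreStr.Hom.hom g := by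
    obtain ⟨v, hv, -⟩ := hc.out
    exact ⟨v ≫ PreStr.Hom.hom g,
      (assoc _ _ _).symm.trans ((congrArg (· ≫ PreStr.Hom.hom g) hv).trans (id_comp _))⟩
  obtain ⟨k, rfl⟩ := exists_hom_of_generators (uncurry_pow u) (uncurry_pow_func u)
    (uncurry_sub_arrow u) (uncurry_pow g) (uncurry_pow_func g) (uncurry_sub_arrow g) hp hs h hh
  exact ⟨k, toPre_hom_ext hh, fun h' hh' => Hom.ext ((cancel_epi (C := V) (PreStr.Hom.hom u)).1
    ((congrArg PreStr.Hom.hom hh').trans hh.symm))⟩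

instance : (toPre S L).Faithful where
  map_injective h := Hom.ext (congrArg PreStr.Hom.hom h)

instance : (toPre S L).Full where
  map_surjective {A B} g := by
    obtain ⟨h, hh, -⟩ := exists_toPre_map_of_isIso (𝟙 ((toPre S L).obj A)) (IsIso.id (C := V) A.carrier)
      (fun f => inferInstanceAs (Epi (𝟙 ((ihom (L.dom f)).obj A.carrier))))
      (fun R _ P k hk => by
        have e : PreStr.Hom.sub (𝟙 ((toPre S L).obj A)) R ≫ k = k := id_comp k
        rwa [e] at hk) g
    exact ⟨h, (id_comp _).symm.trans hh⟩

/-- The structure on the carrier of an object whose powers are the actual ones. -/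
abbrev ofPre (S : ProperFactorizationSystem V) (p : PreStr L) (hp : ∀ f, IsIso (curry (p.dom f))) :
    Str S L where
  carrier := p.carrier
  func f := inv (curry (p.dom f)) ≫ curry (p.cod f)
  rel R := MSubobject.image S (curry (p.rel R))

theorem whiskerLeft_curry_dom_func (p : PreStr L) (hp : ∀ f, IsIso (curry (p.dom f)))
    (f : L.Func) : L.cod f ◁ curry (p.dom f) ≫ uncurry ((ofPre S p hp).func f) = p.cod f := by
  rw [← MonoidalClosed.uncurry_natural_left, MonoidalClosed.uncurry_eq, IsIso.hom_inv_id_assoc,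
    whiskerLeft_ev, MonoidalClosed.uncurry_curry]

/-- Once the formal powers are actual ones, only the relations need correcting. Replacing them by
their images leaves the carrier alone, and the left part of the factorization detects membership in
every subobject. -/
theorem exists_universal_of_isIso (p : PreStr L) (hp : ∀ f, IsIso (curry (p.dom f))) :
    ∃ (A : Str S L) (u : p ⟶ (toPre S L).obj A), ∀ (B : Str S L) (g : p ⟶ (toPre S L).obj B),
      ∃! h : A ⟶ B, u ≫ (toPre S L).map h = g := by
  choose e he hc using fun R => MSubobject.exists_left_image (S := S) (curry (p.rel R))
  have hr (R : L.Rel) : L.ar R ◁ e R ≫ uncurry (MSubobject.image S (curry (p.rel R))).arrow =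
      p.rel R := by
    rw [← MonoidalClosed.uncurry_natural_left, hc, MonoidalClosed.uncurry_curry]
  refine ⟨ofPre S p hp, PreStr.Hom.mk (p := p) (q := (toPre S L).obj (ofPre S p hp)) (𝟙 p.carrier)
    (fun f => curry (p.dom f)) e (fun f => ?_) (fun f => ?_) (fun R => ?_), fun B g =>
    exists_toPre_map_of_isIso _ (IsIso.id (C := V) p.carrier)
      (fun f => (inferInstance : Epi (curry (p.dom f))))
      (fun R _ P k hk => (MSubobject.factors_left_comp_iff (he R) k).1 hk) g⟩
  · refine (comp_id _).trans ?_
    exact ((whiskerLeft_ev _).trans (MonoidalClosed.uncurry_curry _)).symm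
  · exact (comp_id _).trans (whiskerLeft_curry_dom_func p hp f).symm
  · exact (comp_id _).trans (hr R).symm

end Str

section

variable [HasColimits V]

/-- The comparison morphism whose inversion makes the formal power over `f` an actual power. -/
def PreStr.powComparison {L : Language.{w} V} (f : L.Func) (Z : V) :
    freeCarrier L (L.dom f ⊗ Z) ⟶ freePow f Z :=
  (freeCarrierEquiv _ _).symm (L.dom f ◁ singleι f Z ≫ (freePow f Z).dom f)

theorem PreStr.freeCarrierEquiv_powComparison_comp (f : L.Func) (Z : V) {p : PreStr L}
    (g : freePow f Z ⟶ p) : freeCarrierEquiv _ _ (powComparison f Z ≫ g) =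
      uncurry (freePowEquiv f Z p g ≫ curry (p.dom f)) := by
  have h₁ : freeGen L _ _ _ ≫ Hom.hom (powComparison f Z) =
      L.dom f ◁ singleι f Z ≫ (freePow f Z).dom f :=
    (freeCarrierEquiv _ _).apply_symm_apply _
  have h₂ := Hom.dom_comm g f
  refine (assoc _ _ _).symm.trans ((congrArg (· ≫ Hom.hom g) h₁).trans ?_)
  refine (assoc _ _ _).trans ((congrArg (_ ≫ ·) h₂).trans ?_)
  rw [MonoidalClosed.uncurry_natural_left, MonoidalClosed.uncurry_curry]
  exact (MonoidalCategory.whiskerLeft_comp_assoc _ _ _ _).symm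

theorem isIso_of_bijective_of_isStrongGenerator {C : Type u} [Category.{w} C] {P : ObjectProperty C}
    (hP : P.IsStrongGenerator) {A B : C} (f : A ⟶ B)
    (hf : ∀ G, P G → Function.Bijective (fun a : G ⟶ A => a ≫ f)) : IsIso f := by
  have : Mono f := ⟨fun a b h => hP.isSeparating a b fun G hG g => (hf G hG).1 (by simp [h])⟩
  exact hP.isIso_of_mono f fun G hG g => (hf G hG).2 g

/-- By the free-object and tensor-hom bijections, precomposing with `powComparison f Z` is the
canonical map from `Z`-elements of the formal power to `Z`-elements of the actual one. -/
theorem PreStr.bijective_powComparison_comp_iff (f : L.Func) (Z : V) (p : PreStr L) :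
    Function.Bijective (fun g : freePow f Z ⟶ p => powComparison f Z ≫ g) ↔
      Function.Bijective (fun z : Z ⟶ p.pow f => z ≫ curry (p.dom f)) := by
  let e := (freeCarrierEquiv (L.dom f ⊗ Z) p).trans
    ((ihom.adjunction (L.dom f)).homEquiv Z p.carrier)
  have h : e ∘ (fun g : freePow f Z ⟶ p => powComparison f Z ≫ g) =
      (fun z : Z ⟶ p.pow f => z ≫ curry (p.dom f)) ∘ freePowEquiv f Z p := by
    ext g
    refine (congrArg curry (freeCarrierEquiv_powComparison_comp f Z g)).trans ?_
    exact MonoidalClosed.curry_uncurry _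
  rw [← e.bijective.of_comp_iff', h, Function.Bijective.of_comp_iff _ (freePowEquiv f Z p).bijective]

theorem bijective_comp_of_isIso {C : Type u} [Category.{w} C] {A B : C} (f : A ⟶ B) [IsIso f]
    (G : C) : Function.Bijective (fun a : G ⟶ A => a ≫ f) :=
  ⟨fun _ _ h => (cancel_mono f).1 h, fun a => ⟨a ≫ inv f, by simp⟩⟩

/-- The comparison morphisms over the objects of `P`. -/
def PreStr.powComparisons (L : Language.{w} V) (P : ObjectProperty V) :
    MorphismProperty (PreStr L) :=
  MorphismProperty.ofHoms (fun i : L.Func × Subtype P => powComparison i.1 i.2.1)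

instance (P : ObjectProperty V) [ObjectProperty.Small.{w} P] :
    MorphismProperty.IsSmall.{w} (PreStr.powComparisons L P) := by
  have : Small.{w} (Subtype P) := ‹ObjectProperty.Small.{w} P›
  have : Small.{w} (L.Func × Subtype P) := inferInstance
  exact MorphismProperty.isSmall_ofHoms _

omit [MonoidalClosed V] in
theorem PreStr.powComparisons_le_iff {P : ObjectProperty V} (Q : MorphismProperty (PreStr L)) :
    powComparisons L P ≤ Q ↔ ∀ (f : L.Func) (Z : V), P Z → Q (powComparison f Z) :=
  (MorphismProperty.ofHoms_le_iff _ _).trans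
    ⟨fun h f Z hZ => h (f, ⟨Z, hZ⟩), fun h i => h i.1 i.2.1 i.2.2⟩

theorem PreStr.isLocal_iff {P : ObjectProperty V} (hP : P.IsStrongGenerator) (p : PreStr L) :
    (powComparisons L P).isLocal p ↔ ∀ f, IsIso (curry (p.dom f)) := by
  have e : (powComparisons L P).isLocal p ↔ ∀ (f : L.Func) (Z : V), P Z →
      Function.Bijective (fun z : Z ⟶ p.pow f => z ≫ curry (p.dom f)) :=
    (powComparisons_le_iff (fun _ _ g => Function.Bijective (fun t : _ ⟶ p => g ≫ t))).trans
      (forall_congr' fun f => forall₂_congr fun Z _ => bijective_powComparison_comp_iff f Z p)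
  rw [e]
  refine ⟨fun h f => isIso_of_bijective_of_isStrongGenerator hP _ (h f), fun h f Z _ => ?_⟩
  have := h f
  exact bijective_comp_of_isIso (curry (p.dom f)) _

end

variable (κ : Cardinal.{w}) [Fact κ.IsRegular] [IsLocallyPresentableAsClosed V κ]

/-- Two reflections in succession: orthogonal localization at a small set of maps between
presentable objects makes the powers actual, then image factorization makes the relations
subobjects. -/
theorem Str.exists_universal (S : ProperFactorizationSystem V) (hL : L.IsAry κ) (p : PreStr L) :
    ∃ (A : Str S L) (u : p ⟶ (toPre S L).obj A), ∀ (B : Str S L) (g : p ⟶ (toPre S L).obj B),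
      ∃! h : A ⟶ B, u ≫ (toPre S L).map h = g := by
  obtain ⟨P, _, hP⟩ := HasCardinalFilteredGenerator.exists_small_generator V κ
  let W := PreStr.powComparisons L P
  have hW : W.isLocal.ι.IsRightAdjoint := by
    apply MorphismProperty.isRightAdjoint_ι_isLocal W κ
    refine (PreStr.powComparisons_le_iff fun X Y _ => IsCardinalPresentable X κ ∧
      IsCardinalPresentable Y κ).2 fun f Z hZ => ?_
    have hZ := hP.le_isCardinalPresentable _ hZ
    exact ⟨PreStr.isCardinalPresentable_freeCarrier
      (IsLocallyPresentableAsClosed.presentable_tensor _ _ (hL.dom f) hZ),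
      PreStr.isCardinalPresentable_freePow f hZ⟩
  let adj := Adjunction.ofIsRightAdjoint W.isLocal.ι
  let p' := (W.isLocal.ι.leftAdjoint.obj p).obj
  have hp' := (PreStr.isLocal_iff hP.isStrongGenerator p').1
    (W.isLocal.ι.leftAdjoint.obj p).property
  obtain ⟨A, u, hu⟩ := exists_universal_of_isIso (S := S) p' hp'
  -- A genuine structure is local since its formal powers are its powers; hence maps into it factor
  -- uniquely through the localization.
  have hloc (B : Str S L) : W.isLocal ((toPre S L).obj B) := by
    refine (PreStr.isLocal_iff hP.isStrongGenerator _).2 fun f => ?_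
    exact isIso_curry_ev _ _
  have hadj (B : Str S L) : Function.Bijective
      (fun g' : p' ⟶ (toPre S L).obj B => adj.unit.app p ≫ g') := by
    have := ((W.isLocal.fullyFaithfulι.homEquiv (X := W.isLocal.ι.leftAdjoint.obj p)
      (Y := ⟨(toPre S L).obj B, hloc B⟩)).symm.trans
        (adj.homEquiv p ⟨(toPre S L).obj B, hloc B⟩)).bijective
    exact this
  refine ⟨A, adj.unit.app p ≫ u, fun B g => ?_⟩
  obtain ⟨g', hg'⟩ := (hadj B).2 g
  obtain ⟨h, hh, huniq⟩ := hu B g'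
  refine ⟨h, ?_, fun h' hh' => huniq h' ((hadj B).1 ?_)⟩
  · exact (assoc _ _ _).trans ((congrArg (_ ≫ ·) hh).trans hg')
  · exact (assoc _ _ _).symm.trans (hh'.trans hg'.symm)

end Reflection

/-! ### Cocompleteness and free structures -/

section Free

variable {V : Type u} [Category.{w} V] [MonoidalCategory V] [MonoidalClosed V]
  (κ : Cardinal.{w}) [Fact κ.IsRegular] [IsLocallyPresentableAsClosed V κ]
  (S : ProperFactorizationSystem V) {L : Language.{w} V} (hL : L.IsAry κ)

namespace Str

include hL

theorem isRightAdjoint_toPre : (toPre S L).IsRightAdjoint := by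
  have (p : PreStr L) : HasInitial (StructuredArrow p (toPre S L)) := by
    obtain ⟨A, u, hu⟩ := exists_universal κ S hL p
    choose h hh huniq using hu
    have : Limits.IsInitial (StructuredArrow.mk u) := IsInitial.ofUniqueHom
      (fun g => StructuredArrow.homMk (h g.right g.hom) (hh g.right g.hom))
      (fun g m => StructuredArrow.hom_ext _ _ (huniq _ _ _ (StructuredArrow.w m)))
    exact this.hasInitial
  exact isRightAdjointOfStructuredArrowInitials _

theorem hasColimitsOfSize : HasColimitsOfSize.{w, w} (Str S L) where
  has_colimits_of_shape J _ := by
    have := isRightAdjoint_toPre κ S hL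
    let _ : Reflective (toPre S L) := ⟨_, Adjunction.ofIsRightAdjoint _⟩
    exact hasColimitsOfShape_of_reflective (toPre S L)

theorem exists_free (X : V) : ∃ (F : Str S L) (x : X ⟶ F.carrier), ∀ (A : Str S L)
    (a : X ⟶ A.carrier), ∃! h : F ⟶ A, x ≫ Hom.hom h = a := by
  obtain ⟨F, u, hu⟩ := exists_universal κ S hL (PreStr.freeCarrier L X)
  refine ⟨F, PreStr.freeCarrierEquiv _ _ u, fun A a => ?_⟩
  have e (h : F ⟶ A) : PreStr.freeCarrierEquiv _ _ u ≫ Hom.hom h =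
      PreStr.freeCarrierEquiv _ _ (u ≫ (toPre S L).map h) := assoc _ _ _
  obtain ⟨h, hh, huniq⟩ := hu A ((PreStr.freeCarrierEquiv _ ((toPre S L).obj A)).symm a)
  refine ⟨h, ?_, fun h' hh' => huniq _ ?_⟩
  · exact (e h).trans ((Equiv.eq_symm_apply _).1 hh)
  · exact (Equiv.eq_symm_apply _).2 ((e h').symm.trans hh')

theorem exists_freeRel (R : L.Rel) (Y : V) : ∃ (F : Str S L) (x : L.ar R ⊗ Y ⟶ F.carrier),
    (F.rel R).Factors (curry x) ∧ ∀ (A : Str S L) (a : L.ar R ⊗ Y ⟶ A.carrier),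
      (A.rel R).Factors (curry a) → ∃! h : F ⟶ A, x ≫ Hom.hom h = a := by
  obtain ⟨F, u, hu⟩ := exists_universal κ S hL (PreStr.freeSub R Y)
  let y : Y ⟶ (F.rel R).obj := PreStr.freeSubEquiv _ _ _ u
  refine ⟨F, uncurry (y ≫ (F.rel R).arrow), ⟨y, (MonoidalClosed.curry_uncurry _).symm⟩,
    fun A a ⟨(b : Y ⟶ (A.rel R).obj), hb⟩ => ?_⟩
  have e (h : F ⟶ A) : y ≫ relMap h R =
      PreStr.freeSubEquiv _ _ _ (u ≫ (toPre S L).map h) := assoc _ _ _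
  have e' (h : F ⟶ A) : uncurry (y ≫ (F.rel R).arrow) ≫ Hom.hom h = a ↔
      y ≫ relMap h R = b := by
    rw [← cancel_mono (A.rel R).arrow, hb, assoc, relMap_arrow, ← MonoidalClosed.uncurry_natural_right,
      assoc, MonoidalClosed.eq_curry_iff]
  simp_rw [e']
  obtain ⟨h, hh, huniq⟩ := hu A ((PreStr.freeSubEquiv _ _ ((toPre S L).obj A)).symm b)
  refine ⟨h, ?_, fun h' hh' => huniq _ ?_⟩
  · exact (e h).trans ((Equiv.eq_symm_apply _).1 hh)
  · exact (Equiv.eq_symm_apply _).2 ((e h').symm.trans hh')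

end Str

end Free

/-! ### Terms and formulas evaluated on families of elements -/

section App

variable {V : Type u} [Category.{w} V] [MonoidalCategory V] [MonoidalClosed V] 
  [SymmetricCategory V] [HasLimits V] [HasColimits V] {S : ProperFactorizationSystem V}
  {L : Language.{w} V} {κ : Cardinal.{w}} [Fact κ.IsRegular]

/-- The value of a term on a family of elements. -/
def LTerm.app {X Y : V} (t : LTerm L κ X Y) (A : Str S L) (x : X ⟶ A.carrier) : Y ⟶ A.carrier :=
  uncurry' (curry' x ≫ t.interp A)

theorem LTerm.curry'_app {X Y : V} (t : LTerm L κ X Y) (A : Str S L) (x : X ⟶ A.carrier) :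
    curry' (t.app A x) = curry' x ≫ t.interp A :=
  MonoidalClosed.curry'_uncurry' _

omit [SymmetricCategory V] [HasLimits V] [HasColimits V] in
theorem curry'_injective {X A : V} {x y : X ⟶ A} (h : curry' x = curry' y) : x = y := by
  rw [← MonoidalClosed.uncurry'_curry' x, h, MonoidalClosed.uncurry'_curry']

theorem LTerm.app_map {X Y : V} (t : LTerm L κ X Y) {A B : Str S L} (h : A ⟶ B)
    (x : X ⟶ A.carrier) : t.app B (x ≫ Str.Hom.hom h) = t.app A x ≫ Str.Hom.hom h := by
  apply curry'_injective
  rw [curry'_app, ← curry'_comp_map, ← curry'_comp_map, curry'_app, assoc, assoc, interp_map]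

theorem LTerm.ofHom_app {X Y : V} (hX : IsCardinalPresentable X κ) (hY : IsCardinalPresentable Y κ)
    (f : Y ⟶ X) (A : Str S L) (x : X ⟶ A.carrier) :
    (LTerm.ofHom (L := L) hX hY f).app A x = f ≫ x := by
  apply curry'_injective
  rw [curry'_app, interp, curry'_pre]

theorem LTerm.comp_app {X Y Z : V} (t : LTerm L κ X Y) (s : LTerm L κ Y Z) (A : Str S L)
    (x : X ⟶ A.carrier) : (t.comp s).app A x = s.app A (t.app A x) := by
  apply curry'_injective
  rw [curry'_app, curry'_app, curry'_app, interp, assoc]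

theorem LTerm.ι_family_app {X : V} (hX : IsCardinalPresentable X κ) {J : Type w}
    (hJ : Cardinal.mk J < κ) (Y : J → V) (t : ∀ j, LTerm L κ X (Y j)) (A : Str S L)
    (x : X ⟶ A.carrier) (j : J) :
    Sigma.ι Y j ≫ (LTerm.family hX hJ Y t).app A x = (t j).app A x := by
  apply curry'_injective
  rw [← curry'_pre, curry'_app, curry'_app, interp, assoc, powerSigmaLift_pre]

/-- The elements satisfy the formula. -/
def Conj.Sat {X : V} (φ : Conj L κ X) (A : Str S L) (x : X ⟶ A.carrier) : Prop :=
  (φ.interp A).Factors (curry' x)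

/-- The elements satisfy the atomic formula. -/
def Atomic.Sat {X : V} (α : Atomic L κ X) (A : Str S L) (x : X ⟶ A.carrier) : Prop :=
  (α.interp A).Factors (curry' x)

theorem Conj.sat_iff {X : V} (φ : Conj L κ X) (A : Str S L) (x : X ⟶ A.carrier) :
    φ.Sat A x ↔ ∀ j, (φ.atom j).Sat A x := Conj.factors_iff _ _ _

theorem Conj.and_sat_iff {X : V} (φ ψ : Conj L κ X) (A : Str S L) (x : X ⟶ A.carrier) :
    (φ.and ψ).Sat A x ↔ φ.Sat A x ∧ ψ.Sat A x := Conj.and_factors_iff _ _ _ _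

theorem Conj.subst_sat_iff {X Z : V} (hX : IsCardinalPresentable X κ)
    (hZ : IsCardinalPresentable Z κ) (f : X ⟶ Z) (φ : Conj L κ X) (A : Str S L)
    (z : Z ⟶ A.carrier) : (φ.subst hX hZ f).Sat A z ↔ φ.Sat A (f ≫ z) := by
  rw [Sat, Conj.subst_factors_iff, curry'_pre, Sat]

theorem Conj.Sat.map {X : V} {φ : Conj L κ X} {A B : Str S L} {x : X ⟶ A.carrier} (hx : φ.Sat A x)
    (h : A ⟶ B) : φ.Sat B (x ≫ Str.Hom.hom h) := by
  rw [Sat, ← curry'_comp_map]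
  exact Conj.Factors.map hx h

theorem Atomic.eq_sat_iff {X Y : V} (s t : LTerm L κ X Y) (A : Str S L) (x : X ⟶ A.carrier) :
    (Atomic.eq s t).Sat A x ↔ s.app A x = t.app A x := by
  rw [Sat, eq_factors_iff, ← LTerm.curry'_app, ← LTerm.curry'_app]
  exact ⟨curry'_injective, congrArg _⟩

omit [SymmetricCategory V] [HasLimits V] [HasColimits V] in
theorem uncurry_curry'_comp_powerTensorIso_inv {X Y A : V} (x : X ⊗ Y ⟶ A) :
    uncurry (curry' x ≫ (powerTensorIso X Y A).inv) = (ρ_ Y).hom ≫ curry x := by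
  apply MonoidalClosed.uncurry_injective
  rw [uncurry_uncurry_comp_powerTensorIso_inv, MonoidalClosed.uncurry_natural_left,
    MonoidalClosed.uncurry_curry, curry', MonoidalClosed.uncurry_curry]
  simp

theorem Atomic.rel_sat_iff {X : V} (R : L.Rel) (Y : V) (hY : IsCardinalPresentable Y κ)
    (t : LTerm L κ X (L.ar R ⊗ Y)) (A : Str S L) (x : X ⟶ A.carrier) :
    (Atomic.rel R Y hY t).Sat A x ↔ (A.rel R).Factors (curry (t.app A x)) := by
  rw [Sat, rel_factors_iff, ← LTerm.curry'_app, uncurry_curry'_comp_powerTensorIso_inv,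
    MSubobject.factors_iso_comp_iff]

end App

/-! ### Existence of presented structures -/

section Existence

variable {V : Type u} [Category.{w} V] [MonoidalCategory V] [MonoidalClosed V] 
  [SymmetricCategory V] {κ : Cardinal.{w}} [Fact κ.IsRegular] [IsLocallyPresentableAsClosed V κ]
  {S : ProperFactorizationSystem V}
  {L : Language.{w} V} (hL : L.IsAry κ)

include hL

/-- Truth of an atomic formula becomes an extension problem along an epimorphism: the codiagonal of
a free structure for an equation, and for a relation the map from a free structure to the one freely
satisfying that relation. -/
theorem Atomic.exists_test {X : V} (α : Atomic L κ X) (F : Str S L) (x : X ⟶ F.carrier) :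
    ∃ (G H : Str S L) (u : G ⟶ H) (v : G ⟶ F), Epi u ∧ ∀ (K : Str S L) (h : F ⟶ K),
      α.Sat K (x ≫ Str.Hom.hom h) ↔ ∃ k : H ⟶ K, u ≫ k = v ≫ h := by
  have := Str.hasColimitsOfSize κ S hL
  rcases α with @⟨Y, s, t⟩ | ⟨R, Y, hY, t⟩
  · obtain ⟨G, y, hG⟩ := Str.exists_free κ S hL Y
    obtain ⟨v₁, hv₁, -⟩ := hG F (s.app F x)
    obtain ⟨v₂, hv₂, -⟩ := hG F (t.app F x)
    refine ⟨G ⨿ G, G, coprod.desc (𝟙 G) (𝟙 G), coprod.desc v₁ v₂, inferInstance, fun K h => ?_⟩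
    rw [eq_sat_iff, LTerm.app_map, LTerm.app_map, ← hv₁, ← hv₂]
    have e : (∃ k, coprod.desc (𝟙 G) (𝟙 G) ≫ k = coprod.desc v₁ v₂ ≫ h) ↔ v₁ ≫ h = v₂ ≫ h := by
      constructor
      · rintro ⟨k, hk⟩
        have h₁ := congrArg (coprod.inl ≫ ·) hk
        have h₂ := congrArg (coprod.inr ≫ ·) hk
        simp only [coprod.inl_desc_assoc, coprod.inr_desc_assoc] at h₁ h₂
        rw [← h₁, ← h₂]
      · intro e
        refine ⟨v₁ ≫ h, coprod.hom_ext ?_ ?_⟩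
        · rw [coprod.inl_desc_assoc, coprod.inl_desc_assoc, id_comp]
        · rw [coprod.inr_desc_assoc, coprod.inr_desc_assoc, id_comp, e]
    rw [e, assoc, assoc, ← Str.comp_hom, ← Str.comp_hom]
    refine ⟨fun e => (hG K _).unique e rfl, fun e => by rw [e]⟩
  · obtain ⟨G, y, hG⟩ := Str.exists_free κ S hL (L.ar R ⊗ Y)
    obtain ⟨H, z, hz, hH⟩ := Str.exists_freeRel κ S hL R Y
    obtain ⟨u, hu, -⟩ := hG H z
    obtain ⟨v, hv, -⟩ := hG F (t.app F x)
    have hz' {K : Str S L} (k : H ⟶ K) : (K.rel R).Factors (curry (z ≫ Str.Hom.hom k)) := by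
      obtain ⟨l, hl⟩ := hz
      exact ⟨l ≫ Str.relMap k R, by
        rw [assoc, Str.relMap_arrow, reassoc_of% hl, MonoidalClosed.curry_natural_right]⟩
    refine ⟨G, H, u, v, ⟨fun {K} a b e => ?_⟩, fun K h => ?_⟩
    · refine (hH K (z ≫ Str.Hom.hom b) (hz' b)).unique ?_ rfl
      rw [← hu, assoc, assoc, ← Str.comp_hom, e, Str.comp_hom]
    · rw [rel_sat_iff, LTerm.app_map, ← hv, assoc, ← Str.comp_hom]
      constructor
      · intro e
        obtain ⟨k, hk, -⟩ := hH K _ e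
        refine ⟨k, (hG K _).unique ?_ rfl⟩
        rw [Str.comp_hom, ← assoc, hu, hk]
      · rintro ⟨k, hk⟩
        rw [← hk, Str.comp_hom, ← assoc, hu]
        exact hz' k

theorem exists_isPresentation {X : V} (φ : Conj L κ X) :
    ∃ (F : Str S L) (x : X ⟶ F.carrier), IsPresentation φ F x := by
  have := Str.hasColimitsOfSize κ S hL
  obtain ⟨F, x, hF⟩ := Str.exists_free κ S hL X
  choose G H u v hu hφ using fun j => Atomic.exists_test hL (φ.atom j) F x
  have hφ' (K : Str S L) (h : F ⟶ K) : φ.Sat K (x ≫ Str.Hom.hom h) ↔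
      ∃ k : ∀ j, H j ⟶ K, ∀ j, u j ≫ k j = v j ≫ h := by
    rw [Conj.sat_iff]
    exact (forall_congr' fun j => hφ j K h).trans Classical.skolem
  -- All atoms are imposed at once, by pushing out the free structure along the coproduct of the
  -- test maps; extensions are unique because these are epic.
  let i := pushout.inl (Limits.Sigma.map u) (Sigma.desc v)
  let q := pushout.inr (Limits.Sigma.map u) (Sigma.desc v)
  have w (j : φ.J) : u j ≫ Sigma.ι H j ≫ i = v j ≫ q := by
    have := congrArg (Sigma.ι G j ≫ ·) (pushout.condition (f := Limits.Sigma.map u) (g := Sigma.desc v))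
    simpa [i, q] using this
  refine ⟨_, x ≫ Str.Hom.hom q, (hφ' _ q).2 ⟨fun j => Sigma.ι H j ≫ i, w⟩, fun K a ha => ?_⟩
  obtain ⟨h, rfl, huniq⟩ := hF K a
  obtain ⟨k, hk⟩ := (hφ' K h).1 ha
  refine ⟨pushout.desc (Sigma.desc k) h ?_, ?_, fun h' hh' => ?_⟩
  · exact Sigma.hom_ext _ _ fun j => by simpa using hk j
  · dsimp only
    rw [assoc, ← Str.comp_hom, pushout.inr_desc]
  · dsimp only at hh'
    rw [assoc, ← Str.comp_hom] at hh'
    have e := huniq _ hh'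
    apply pushout.hom_ext
    · refine Sigma.hom_ext _ _ fun j => ?_
      rw [pushout.inl_desc, Sigma.ι_desc, ← cancel_epi (u j), hk, ← e]
      simpa using congrArg (· ≫ h') (w j)
    · rw [pushout.inr_desc]
      exact e

end Existence

/-! ### Limit sequents as orthogonality conditions -/

section Orthogonality

variable {V : Type u} [Category.{w} V] [MonoidalCategory V] [MonoidalClosed V]
  [SymmetricCategory V] [HasLimits V] [HasColimits V] {κ : Cardinal.{w}} [Fact κ.IsRegular]
  {S : ProperFactorizationSystem V} {L : Language.{w} V}

theorem IsPresentation.exists_isIso {X : V} {φ : Conj L κ X} {F : Str S L} {x : X ⟶ F.carrier}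
    (hF : IsPresentation φ F x) (K : Str S L) :
    ∃ a : Str.homObj F K ⟶ (φ.interp K).obj, IsIso a ∧ a ≫ (φ.interp K).arrow = evalGen K x := by
  obtain ⟨a, ha⟩ := hF.factors_evalGen K
  obtain ⟨b, hb, -⟩ := hF.existsUnique_lift K _ (φ.interp K).factors_arrow
  have := hF.mono_evalGen K
  refine ⟨a, ⟨b, ?_, ?_⟩, ha⟩
  · rw [← cancel_mono (evalGen K x), assoc, hb, ha, id_comp]
  · rw [← cancel_mono (φ.interp K).arrow, assoc, ha, hb, id_comp]

theorem LimitSequent.exists_comp_arrow_eq_proj (τ : LimitSequent L κ) (K : Str S L) :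
    ∃ c : (τ.body.interp K).obj ⟶ (τ.φ.interp K).obj,
      c ≫ (τ.φ.interp K).arrow = τ.body.proj K := by
  have h := (τ.body.interp K).factors_arrow
  rw [LimitSequent.body, Conj.and_factors_iff, Conj.subst_factors_iff] at h
  exact h.2

/-- If the projection is in the right class it is its own image, and existence gives a section of
`c`, which monicity makes an inverse. Conversely, an isomorphism followed by a map of the right
class is in the right class. -/
theorem LimitSequent.holds_iff (τ : LimitSequent L κ) (K : Str S L)
    (c : (τ.body.interp K).obj ⟶ (τ.φ.interp K).obj)
    (hc : c ≫ (τ.φ.interp K).arrow = τ.body.proj K) : τ.Holds K ↔ IsIso c := by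
  constructor
  · rintro ⟨h₁, h₂⟩
    obtain ⟨k, hk⟩ := (MSubobject.image_factors_iff_of_right h₂ _).1 h₁
    have := S.mono_of_right _ h₂
    refine ⟨k, ?_, ?_⟩
    · rw [← cancel_mono (τ.body.proj K), assoc, hk, hc, id_comp]
    · rw [← cancel_mono (τ.φ.interp K).arrow, assoc, hc, hk, id_comp]
  · intro _
    have h : S.right (τ.body.proj K) := by
      have := S.right_respectsIso
      rw [← hc]
      exact MorphismProperty.RespectsIso.precomp _ _ _ (τ.φ.interp K).mem
    refine ⟨(MSubobject.image_factors_iff_of_right h _).2 ⟨inv c, ?_⟩, h⟩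
    rw [← hc, IsIso.inv_hom_id_assoc]

/-- Both hom objects are interpretations of formulas, and `hh` identifies precomposition with `h`
with the restriction `c` of the projection. -/
theorem LimitSequent.isOrthogonalTo_iff (τ : LimitSequent L κ) {F B : Str S L}
    {x : τ.X ⟶ F.carrier} {z : τ.X ⨿ τ.Y ⟶ B.carrier} (hF : IsPresentation τ.φ F x)
    (hB : IsPresentation τ.body B z) (h : F ⟶ B) (hh : x ≫ Str.Hom.hom h = coprod.inl ≫ z)
    (K : Str S L) : Str.IsOrthogonalTo h K ↔ τ.Holds K := by
  obtain ⟨a, _, ha⟩ := hF.exists_isIso K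
  obtain ⟨b, _, hb⟩ := hB.exists_isIso K
  obtain ⟨c, hc⟩ := τ.exists_comp_arrow_eq_proj K
  have sq : Str.homPre h K ≫ a = b ≫ c := by
    rw [← cancel_mono (τ.φ.interp K).arrow, assoc, assoc, ha, hc, Conj.proj, reassoc_of% hb,
      IsPresentation.evalGen, IsPresentation.evalGen, reassoc_of% (Str.homPre_homι h K), assoc,
      ← NatTrans.comp_app, ← NatTrans.comp_app, ← MonoidalClosed.pre_map,
      ← MonoidalClosed.pre_map, hh]
  rw [τ.holds_iff K c hc]
  have e : IsIso (Str.homPre h K) ↔ IsIso c := by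
    rw [← isIso_comp_right_iff (Str.homPre h K) a, sq, isIso_comp_left_iff]
  exact e

end Orthogonality

section

variable {V : Type u} [Category.{w} V] [MonoidalCategory V] [MonoidalClosed V]
  [SymmetricCategory V] {κ : Cardinal.{w}} [Fact κ.IsRegular] [IsLocallyPresentableAsClosed V κ]
  {S : ProperFactorizationSystem V} {L : Language.{w} V}
  (hS : S.RightClosedUnderFilteredColimits κ) (hL : L.IsAry κ)

include hL

theorem LimitSequent.exists_presentations (S : ProperFactorizationSystem V)
    (τ : LimitSequent L κ) : ∃ (F B : Str S L) (x : τ.X ⟶ F.carrier)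
      (z : τ.X ⨿ τ.Y ⟶ B.carrier) (h : F ⟶ B), IsPresentation τ.φ F x ∧
        IsPresentation τ.body B z ∧ x ≫ Str.Hom.hom h = coprod.inl ≫ z := by
  obtain ⟨F, x, hF⟩ := exists_isPresentation (S := S) hL τ.φ
  obtain ⟨B, z, hB⟩ := exists_isPresentation (S := S) hL τ.body
  have := hB.sat
  rw [LimitSequent.body] at this
  obtain ⟨h, hh, -⟩ := hF.existsUnique B (coprod.inl ≫ z) ((Conj.subst_sat_iff _ _ _ _ _ _).1
    ((Conj.and_sat_iff _ _ _ _).1 this).2)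
  exact ⟨F, B, x, z, h, hF, hB, hh⟩

include hS

theorem LimitTheory.isOrthogonalityClass_mod (T : LimitTheory L κ) :
    Str.IsOrthogonalityClass κ (T.Mod S) := by
  have := T.small
  choose F B x z h hF hB hh using fun i : Shrink.{w} T.sequents =>
    LimitSequent.exists_presentations hL S ((equivShrink T.sequents).symm i).1
  refine ⟨Shrink.{w} T.sequents, F, B, h, fun i => ⟨(hF i).isEnrichedPresentable hS hL
    (LimitSequent.hX _), (hB i).isEnrichedPresentable hS hL (isCardinalPresentable_coprod
      (LimitSequent.hX _) (LimitSequent.hY _))⟩, fun K => ?_⟩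
  have e (i) := LimitSequent.isOrthogonalTo_iff _ (hF i) (hB i) (h i) (hh i) K
  simp_rw [e, (equivShrink T.sequents).symm.forall_congr_left, Equiv.symm_symm,
    Equiv.symm_apply_apply]
  exact ⟨fun H i => H i i.2, fun H τ hτ => H ⟨τ, hτ⟩⟩

end

/-! ### Coproducts as filtered colimits of small subcoproducts -/

section Subcoproduct

variable {C : Type u} [Category.{w} C] [HasColimits C] {I : Type w} (G : I → C)
  (κ : Cardinal.{w}) [Fact κ.IsRegular]

/-- The functor sending a small set of indices to the corresponding coproduct. -/
abbrev subcoproduct : HasCardinalLT.Set I κ ⥤ C where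
  obj A := ∐ fun a : A.1 => G a
  map {A B} u := Sigma.desc fun a => Sigma.ι (fun b : B.1 => G b) ⟨a.1, leOfHom u a.2⟩

/-- The inclusions of the small subcoproducts. -/
abbrev subcoproductCocone : Cocone (subcoproduct G κ) where
  pt := ∐ G
  ι := { app := fun A => Sigma.desc fun a => Sigma.ι G a.1 }

/-- The singletons. -/
abbrev singletonSet (i : I) : HasCardinalLT.Set I κ :=
  ⟨{i}, hasCardinalLT_of_finite _ _ (Fact.out : κ.IsRegular).aleph0_le⟩

theorem ι_subcoproduct_map {i : I} {A : HasCardinalLT.Set I κ} (hi : i ∈ A.1)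
    (u : singletonSet κ i ⟶ A) : Sigma.ι (fun a : (singletonSet κ i).1 => G a)
      ⟨i, Set.mem_singleton i⟩ ≫ (subcoproduct G κ).map u = Sigma.ι (fun a : A.1 => G a) ⟨i, hi⟩ :=
  Sigma.ι_desc _ _

omit [Fact κ.IsRegular] in
theorem ι_subcoproductCocone_ι (A : HasCardinalLT.Set I κ) (a : A.1) :
    Sigma.ι (fun a : A.1 => G a) a ≫ (subcoproductCocone G κ).ι.app A = Sigma.ι G a.1 :=
  Sigma.ι_desc _ _

/-- A coproduct is the filtered colimit of its small subcoproducts. -/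
def isColimitSubcoproductCocone : IsColimit (subcoproductCocone G κ) where
  desc c := Sigma.desc fun i => Sigma.ι (fun a : (singletonSet κ i).1 => G a)
    ⟨i, Set.mem_singleton i⟩ ≫ c.ι.app (singletonSet κ i)
  fac c A := Sigma.hom_ext _ _ fun a => by
    have h := c.w (homOfLE (Set.singleton_subset_iff.2 a.2) : singletonSet κ a.1 ⟶ A)
    rw [← assoc, ι_subcoproductCocone_ι, Sigma.ι_desc, ← h, ← assoc,
      ι_subcoproduct_map G κ (A := A) a.2]
  uniq c m hm := Sigma.hom_ext _ _ fun i => by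
    rw [Sigma.ι_desc, ← hm (singletonSet κ i), ← assoc, ι_subcoproductCocone_ι]

theorem exists_factor_subcoproduct {X : C} (hX : IsCardinalPresentable X κ) (l : X ⟶ ∐ G) :
    ∃ (K : Type w) (_ : Cardinal.mk K < κ) (k : K → I) (r : X ⟶ ∐ fun a => G (k a)),
      r ≫ Sigma.desc (fun a => Sigma.ι G (k a)) = l := by
  obtain ⟨A, r, hr⟩ := IsCardinalPresentable.exists_hom_of_isColimit κ
    (isColimitSubcoproductCocone G κ) l
  exact ⟨A.1, (hasCardinalLT_iff_cardinal_mk_lt _ _).1 A.2, Subtype.val, r, hr⟩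

end Subcoproduct

/-! ### Ordinary presentability and a strong generator of presented structures -/

section Presentable

section

variable {V : Type u} [Category.{w} V] [MonoidalCategory V] [MonoidalClosed V] [HasLimits V]
  {S : ProperFactorizationSystem V} {L : Language.{w} V}

theorem Str.homEquiv_symm_comp_homPost {A B C : Str S L} (g : B ⟶ C) (l : 𝟙_ V ⟶ homObj A B) :
    (homEquiv A C).symm (l ≫ homPost A g) = (homEquiv A B).symm l ≫ g := by
  rw [Equiv.symm_apply_eq, ← cancel_mono (homι A C), homEquiv_homι, assoc, homPost_homι]
  obtain ⟨k, rfl⟩ := (homEquiv A B).surjective l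
  rw [← assoc, homEquiv_homι, curry'_comp_map, Equiv.symm_apply_apply, comp_hom]

end

variable {V : Type u} [Category.{w} V] [MonoidalCategory V] [MonoidalClosed V]
  {κ : Cardinal.{w}} [Fact κ.IsRegular] [IsLocallyPresentableAsClosed V κ]
  {S : ProperFactorizationSystem V} {L : Language.{w} V}

/-- Ordinary morphisms are maps from the unit into the hom object, and the unit is presentable. -/
theorem Str.IsEnrichedPresentable.isCardinalPresentable {A : Str S L}
    (hA : IsEnrichedPresentable κ A) : IsCardinalPresentable A κ where
  preservesColimitOfShape J _ _ := by
    have := hA.preservesColimitOfShape J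
    have := IsLocallyPresentableAsClosed.presentable_unit (V := V) (κ := κ)
    have := this.preservesColimitOfShape J
    let e : eCoyoneda V A ⋙ coyoneda.obj (op (𝟙_ V)) ≅ coyoneda.obj (op A) :=
      NatIso.ofComponents (fun B => (homEquiv A B).symm.toIso) fun {B C} g => by
        ext l
        exact homEquiv_symm_comp_homPost g l
    exact preservesColimitsOfShape_of_natIso e

end Presentable

section

variable {V : Type u} [Category.{w} V] [MonoidalCategory V] [MonoidalClosed V]
  {S : ProperFactorizationSystem V} {L : Language.{w} V}

/-- Invertibility on carriers does not suffice: the relations of `B` could be larger. -/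
theorem Str.isIso_of_isIso_hom {A B : Str S L} (m : A ⟶ B)
    (h : IsIso (Hom.hom m : A.carrier ⟶ B.carrier)) (hr : ∀ R, IsIso (relMap m R)) : IsIso m := by
  obtain ⟨(i : B.carrier ⟶ A.carrier), hi, hi'⟩ := h.out
  have hp (X : V) : (ihom X).map (Hom.hom m) ≫ (ihom X).map i = 𝟙 _ := by
    rw [← Functor.map_comp, hi, CategoryTheory.Functor.map_id]
  have hp' (X : V) : (ihom X).map i ≫ (ihom X).map (Hom.hom m) = 𝟙 _ := by
    rw [← Functor.map_comp, hi', CategoryTheory.Functor.map_id]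
  refine ⟨⟨i, fun f => ?_, fun R => ⟨inv (relMap m R), ?_⟩⟩, Hom.ext hi, Hom.ext hi'⟩
  · have := congrArg (fun t => (ihom _).map i ≫ t ≫ (ihom _).map i) (Hom.func_comm m f)
    simp only [assoc, hp] at this
    rw [reassoc_of% (hp'), comp_id] at this
    exact this.symm
  · rw [IsIso.inv_comp_eq, ← assoc, relMap_arrow, assoc, hp, comp_id]

end

section

variable {V : Type u} [Category.{w} V] [MonoidalCategory V] [MonoidalClosed V]
  [SymmetricCategory V] [HasLimits V] [HasColimits V] {κ : Cardinal.{w}} [Fact κ.IsRegular]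
  {S : ProperFactorizationSystem V} {L : Language.{w} V}

/-- The structure has a presentation on presentable generators. -/
def HasPresentation (κ : Cardinal.{w}) [Fact κ.IsRegular] :
    ObjectProperty (Str S L) := fun A =>
  ∃ (X : V) (_ : IsCardinalPresentable X κ) (φ : Conj L κ X) (x : X ⟶ A.carrier),
    IsPresentation φ A x

/-- The empty conjunction. -/
def Conj.true (L : Language.{w} V) (κ : Cardinal.{w}) [Fact κ.IsRegular] (X : V) :
    Conj L κ X where
  J := PEmpty
  card_lt := by simpa using (Fact.out : κ.IsRegular).pos
  atom := PEmpty.elim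

theorem Conj.true_sat {X : V} (A : Str S L) (x : X ⟶ A.carrier) : (Conj.true L κ X).Sat A x :=
  (Conj.sat_iff _ _ _).2 fun j => j.elim

/-- The conjunction of one atomic formula. -/
def Atomic.toConj {X : V} (α : Atomic L κ X) : Conj L κ X where
  J := PUnit
  card_lt := by simpa using Cardinal.one_lt_aleph0.trans_le (Fact.out : κ.IsRegular).aleph0_le
  atom _ := α

theorem Atomic.toConj_sat_iff {X : V} (α : Atomic L κ X) (A : Str S L) (x : X ⟶ A.carrier) :
    α.toConj.Sat A x ↔ α.Sat A x :=
  (Conj.sat_iff _ _ _).trans ⟨fun h => h ⟨⟩, fun h _ => h⟩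

theorem Atomic.rel_ofHom_sat_iff {R : L.Rel} {Y : V} (h : IsCardinalPresentable (L.ar R ⊗ Y) κ)
    (hY : IsCardinalPresentable Y κ) (A : Str S L) (x : L.ar R ⊗ Y ⟶ A.carrier) :
    (Atomic.rel R Y hY (.ofHom h h (𝟙 _))).Sat A x ↔ (A.rel R).Factors (curry x) := by
  rw [rel_sat_iff, LTerm.ofHom_app, id_comp]

end

section Generator

variable {V : Type u} [Category.{w} V] [MonoidalCategory V] [MonoidalClosed V]
  [SymmetricCategory V] {κ : Cardinal.{w}} [Fact κ.IsRegular] [IsLocallyPresentableAsClosed V κ]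
  {S : ProperFactorizationSystem V} {L : Language.{w} V}

/-- Free structures on a generator of the base detect isomorphisms of carriers; the structures
freely satisfying one relation detect isomorphisms of relations. -/
theorem Str.exists_strongGenerator (hL : L.IsAry κ) :
    ∃ (Q : ObjectProperty (Str S L)) (_ : ObjectProperty.Small.{w} Q), Q.IsStrongGenerator ∧
      Q ≤ HasPresentation κ := by
  obtain ⟨P, _, hP⟩ := HasCardinalFilteredGenerator.exists_small_generator V κ
  have hG := hP.isStrongGenerator
  have hpres (Z : Subtype P) := hP.le_isCardinalPresentable _ Z.2
  have hten (R : L.Rel) (Z : Subtype P) :=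
    IsLocallyPresentableAsClosed.presentable_tensor _ _ (hL.ar R) (hpres Z)
  choose F x hF using fun Z : Subtype P => exists_isPresentation (S := S) hL (Conj.true L κ Z.1)
  choose F' x' hF' using fun i : L.Rel × Subtype P => exists_isPresentation (S := S) hL
    (Atomic.rel i.1 i.2.1 (hpres i.2) (.ofHom (hten i.1 i.2) (hten i.1 i.2) (𝟙 _))).toConj
  let Q : ObjectProperty (Str S L) := ObjectProperty.ofObj (Sum.elim F F')
  have : Small.{w} (Subtype P) := ‹ObjectProperty.Small.{w} P›
  have hQF (Z) : Q (F Z) := ObjectProperty.ofObj_apply (Sum.elim F F') (Sum.inl Z)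
  have hQF' (Z) : Q (F' Z) := ObjectProperty.ofObj_apply (Sum.elim F F') (Sum.inr Z)
  have hf (Z : Subtype P) (A : Str S L) (a : Z.1 ⟶ A.carrier) : ∃ h : F Z ⟶ A, x Z ≫ Hom.hom h = a :=
    ((hF Z).existsUnique A a (Conj.true_sat A a)).exists
  refine ⟨Q, inferInstance, ?_, ?_⟩
  · rw [ObjectProperty.isStrongGenerator_iff]
    refine ⟨fun A B f g hfg => Hom.ext (hG.isSeparating _ _ fun Z hZ a => ?_), fun A B m _ hm => ?_⟩
    · obtain ⟨h, rfl⟩ := hf ⟨Z, hZ⟩ A a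
      rw [assoc, assoc, ← comp_hom, ← comp_hom, hfg _ (hQF _)]
    · have hi : IsIso (Hom.hom m : A.carrier ⟶ B.carrier) := by
        apply isIso_of_bijective_of_isStrongGenerator hG
        refine fun Z hZ => ⟨fun a b hab => ?_, fun b => ?_⟩
        · obtain ⟨h, rfl⟩ := hf ⟨Z, hZ⟩ A a
          obtain ⟨h', rfl⟩ := hf ⟨Z, hZ⟩ A b
          have : h ≫ m = h' ≫ m := (hF ⟨Z, hZ⟩).hom_ext (by simpa using hab)
          rw [(cancel_mono m).1 this]
        · obtain ⟨h, rfl⟩ := hf ⟨Z, hZ⟩ B b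
          obtain ⟨l, rfl⟩ := hm _ (hQF ⟨Z, hZ⟩) h
          exact ⟨x ⟨Z, hZ⟩ ≫ Hom.hom l, by simp⟩
      refine isIso_of_isIso_hom m hi fun R => ?_
      have : Mono (relMap m R) := by
        have : Mono (relMap m R ≫ (B.rel R).arrow) := by
          rw [relMap_arrow]
          infer_instance
        exact mono_of_mono _ (B.rel R).arrow
      refine hG.isIso_of_mono _ fun Z hZ b => ?_
      have sat (i : L.Rel × Subtype P) (A : Str S L) (a : L.ar i.1 ⊗ i.2.1 ⟶ A.carrier) :=
        (Atomic.toConj_sat_iff _ A a).trans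
          (Atomic.rel_ofHom_sat_iff (hten i.1 i.2) (hpres i.2) A a)
      obtain ⟨h, hh, -⟩ := (hF' (R, ⟨Z, hZ⟩)).existsUnique B (uncurry (b ≫ (B.rel R).arrow))
        ((sat (R, ⟨Z, hZ⟩) B _).2 ⟨b, (MonoidalClosed.curry_uncurry _).symm⟩)
      obtain ⟨l, rfl⟩ := hm _ (hQF' (R, ⟨Z, hZ⟩)) h
      obtain ⟨k, hk⟩ := (sat (R, ⟨Z, hZ⟩) A _).1 (Conj.Sat.map (hF' (R, ⟨Z, hZ⟩)).sat l)
      refine ⟨k, ?_⟩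
      rw [← cancel_mono (B.rel R).arrow, assoc, relMap_arrow, reassoc_of% hk,
        ← MonoidalClosed.curry_natural_right, assoc, ← comp_hom]
      exact (congrArg curry hh).trans (MonoidalClosed.curry_uncurry _)
  · rintro _ ⟨Z | i⟩
    · exact ⟨_, hpres Z, _, _, hF Z⟩
    · exact ⟨_, hten i.1 i.2, _, _, hF' i⟩

end Generator

/-! ### Presentations of small colimits -/

section Colimits

variable {V : Type u} [Category.{w} V] [MonoidalCategory V] [MonoidalClosed V]
  [SymmetricCategory V] [HasLimits V] [HasColimits V] {κ : Cardinal.{w}} [Fact κ.IsRegular]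
  {S : ProperFactorizationSystem V} {L : Language.{w} V}

/-- The conjunction of a small family of conjunctions. -/
def Conj.sigma {X : V} {J : Type w} (hJ : Cardinal.mk J < κ) (φ : J → Conj L κ X) : Conj L κ X where
  J := Σ j, (φ j).J
  card_lt := by
    rw [Cardinal.mk_sigma]
    exact Cardinal.sum_lt_of_isRegular Fact.out hJ fun j => (φ j).card_lt
  atom i := (φ i.1).atom i.2

theorem Conj.sigma_sat_iff {X : V} {J : Type w} (hJ : Cardinal.mk J < κ) (φ : J → Conj L κ X)
    (A : Str S L) (x : X ⟶ A.carrier) : (Conj.sigma hJ φ).Sat A x ↔ ∀ j, (φ j).Sat A x := by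
  simp_rw [Conj.sat_iff]
  exact ⟨fun h j i => h ⟨j, i⟩, fun h i => h i.1 i.2⟩

/-- Up to a cover, every presentable family of elements is the value of a term at `y`. -/
def IsTermCovering (κ : Cardinal.{w}) [Fact κ.IsRegular] {Y : V} (B : Str S L)
    (y : Y ⟶ B.carrier) : Prop :=
  ∀ (X : V), IsCardinalPresentable X κ → ∀ g : X ⟶ B.carrier,
    ∃ (G : V) (e : G ⟶ X) (t : LTerm L κ Y G), IsCardinalPresentable G κ ∧ Epi e ∧
      t.app B y = e ≫ g

/-- Take all generators and formulas of the diagram together, and for every arrow an equation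
identifying the generators at its source with the terms expressing their images at its target. -/
theorem hasPresentation_of_isColimit {J : Type w} [SmallCategory J]
    (hJ : HasCardinalLT (Arrow J) κ) {D : J ⥤ Str S L} {c : Cocone D} (hc : IsColimit c)
    (hD : ∀ j, ∃ (X : V) (_ : IsCardinalPresentable X κ) (φ : Conj L κ X)
      (x : X ⟶ (D.obj j).carrier), IsPresentation φ (D.obj j) x ∧ IsTermCovering κ (D.obj j) x) :
    HasPresentation κ c.pt := by
  choose X hX φ x hx hcov using hD
  choose G e t hG he ht using fun a : Arrow J =>
    hcov a.right (X a.left) (hX a.left) (x a.left ≫ Str.Hom.hom (D.map a.hom))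
  have hJ' : Cardinal.mk J < κ :=
    (hasCardinalLT_iff_cardinal_mk_lt _ _).1 (hasCardinalLT_of_hasCardinalLT_arrow hJ)
  have hZ := isCardinalPresentable_sigma hJ' X hX
  let ψ : Conj L κ (∐ X) := (Conj.sigma hJ' fun j => (φ j).subst (hX j) hZ (Sigma.ι X j)).and
    (Conj.sigma ((hasCardinalLT_iff_cardinal_mk_lt _ _).1 hJ) fun a => Atomic.toConj
      (.eq (.ofHom hZ (hG a) (e a ≫ Sigma.ι X a.left))
        (.comp (.ofHom hZ (hX a.right) (Sigma.ι X a.right)) (t a))))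
  have hψ (K : Str S L) (b : ∐ X ⟶ K.carrier) : ψ.Sat K b ↔
      (∀ j, (φ j).Sat K (Sigma.ι X j ≫ b)) ∧ ∀ a : Arrow J, e a ≫ Sigma.ι X a.left ≫ b =
        (t a).app K (Sigma.ι X a.right ≫ b) := by
    simp only [ψ, Conj.and_sat_iff, Conj.sigma_sat_iff, Conj.subst_sat_iff, Atomic.toConj_sat_iff,
      Atomic.eq_sat_iff, LTerm.ofHom_app, LTerm.comp_app, assoc]
  have hw {j k : J} (a : j ⟶ k) : Str.Hom.hom (D.map a) ≫ Str.Hom.hom (c.ι.app k) =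
      Str.Hom.hom (c.ι.app j) := congrArg Str.Hom.hom (c.w a)
  refine ⟨∐ X, hZ, ψ, Sigma.desc fun j => x j ≫ Str.Hom.hom (c.ι.app j),
    (hψ _ _).2 ⟨fun j => ?_, fun a => ?_⟩, fun K b hb => ?_⟩
  · rw [Sigma.ι_desc]
    exact Conj.Sat.map (hx j).sat (c.ι.app j)
  · rw [Sigma.ι_desc, Sigma.ι_desc]
    refine Eq.trans ?_ (LTerm.app_map (t a) (c.ι.app a.right) (x a.right)).symm
    rw [ht, assoc, assoc]
    exact congrArg (fun v => e a ≫ x a.left ≫ v) (hw a.hom).symm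
  · obtain ⟨h₁, h₂⟩ := (hψ K b).1 hb
    choose h hh huniq using fun j => (hx j).existsUnique K _ (h₁ j)
    dsimp only at hh
    -- The equation for `a` yields compatibility only after `e`, which is cancelled as an
    -- epimorphism.
    have nat {j k : J} (a : j ⟶ k) : D.map a ≫ h k = h j := by
      refine (hx j).hom_ext ?_
      have := he (Arrow.mk a)
      rw [← cancel_epi (e (Arrow.mk a)), Str.comp_hom, hh]
      refine Eq.trans ?_ (h₂ (Arrow.mk a)).symm
      refine Eq.trans ?_ ((congrArg ((t (Arrow.mk a)).app K) (hh k).symm).trans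
        (LTerm.app_map _ _ _)).symm
      exact ((congrArg (· ≫ Str.Hom.hom (h k)) (ht (Arrow.mk a))).trans
        ((assoc _ _ _).trans (congrArg (_ ≫ ·) (assoc _ _ _)))).symm
    let s : Cocone D := ⟨K, ⟨h, fun j k a => (nat a).trans (comp_id _).symm⟩⟩
    refine ⟨hc.desc s, ?_, fun h' hh' => hc.hom_ext fun j => ?_⟩
    · refine Sigma.hom_ext _ _ fun j => ?_
      rw [Sigma.ι_desc_assoc, assoc, ← hh]
      exact congrArg (x j ≫ Str.Hom.hom ·) (hc.fac s j)
    · refine Eq.trans (huniq j _ ?_) (hc.fac s j).symm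
      rw [← hh', Sigma.ι_desc_assoc, assoc]
      rfl

end Colimits

/-! ### Relational languages: covering by the carrier -/

section Relational

variable {V : Type u} [Category.{w} V] [MonoidalCategory V] [MonoidalClosed V]
  {κ : Cardinal.{w}} [Fact κ.IsRegular] [IsLocallyPresentableAsClosed V κ]
  {S : ProperFactorizationSystem V} {L : Language.{w} V} [IsEmpty L.Func]

/-- The subobject given by the identity. -/
def MSubobject.top {V : Type u} [Category.{w} V] [MonoidalCategory V]
    (S : ProperFactorizationSystem V) (B : V) : MSubobject S B where
  obj := B
  arrow := 𝟙 B
  mem := S.right_of_lifting _ fun e _ a b sq => ⟨b, by rw [← sq, comp_id], comp_id _⟩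

/-- For a relational language, the structure in which all relations hold. -/
def Str.indiscrete (S : ProperFactorizationSystem V) (L : Language.{w} V) [IsEmpty L.Func] :
    V ⥤ Str S L where
  obj T :=
    { carrier := T
      func := isEmptyElim
      rel := fun R => MSubobject.top S _ }
  map {T U} g := ⟨g, isEmptyElim, fun R => ⟨(ihom (L.ar R)).map g, (comp_id _).trans (id_comp _).symm⟩⟩

/-- Morphisms into an indiscrete structure. -/
def Str.homIndiscreteEquiv (B : Str S L) (T : V) :
    (B ⟶ (indiscrete S L).obj T) ≃ (B.carrier ⟶ T) where
  toFun h := Hom.hom h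
  invFun g := ⟨g, isEmptyElim, fun R => ⟨(B.rel R).arrow ≫ (ihom (L.ar R)).map g, comp_id _⟩⟩

omit [MonoidalClosed V] [IsEmpty L.Func] in
theorem MSubobject.factors_of_isColimit {J : Type w} [SmallCategory J] {F : J ⥤ V} {c : Cocone F}
    (hc : IsColimit c) {T : V} (P : MSubobject S T) (k : c.pt ⟶ T)
    (h : ∀ j, P.Factors (c.ι.app j ≫ k)) : P.Factors k := by
  choose l hl using h
  have nat {i j : J} (u : i ⟶ j) : F.map u ≫ l j = l i := by
    rw [← cancel_mono P.arrow, assoc, hl, hl, ← assoc, c.w]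
  let s : Cocone F := ⟨P.obj, ⟨l, fun i j u => (nat u).trans (comp_id _).symm⟩⟩
  refine ⟨hc.desc s, hc.hom_ext fun j => ?_⟩
  rw [hc.fac_assoc, hl]

theorem Str.rel_factors_map_desc (hL : L.IsAry κ) {J : Type w} [SmallCategory J]
    [IsCardinalFiltered J κ] {F : J ⥤ V} {c : Cocone F} (hc : IsColimit c)
    (s : Cocone (F ⋙ indiscrete S L)) (R : L.Rel) :
    (s.pt.rel R).Factors ((ihom (L.ar R)).map (hc.desc ((forget S L).mapCocone s))) := by
  have := preservesColimitsOfShape_ihom (J := J) κ (L.ar R) (hL.ar R)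
  refine MSubobject.factors_of_isColimit (isColimitOfPreserves (ihom (L.ar R)) hc) _ _ fun j => ?_
  obtain ⟨k, hk⟩ := Hom.rel_comm (s.ι.app j) R
  refine ⟨k, hk.trans ((id_comp _).trans ?_)⟩
  refine (congrArg (ihom (L.ar R)).map (hc.fac ((forget S L).mapCocone s) j).symm).trans ?_
  exact (ihom (L.ar R)).map_comp _ _

theorem Str.preservesColimitsOfShape_indiscrete (hL : L.IsAry κ) {J : Type w} [SmallCategory J]
    [IsCardinalFiltered J κ] : PreservesColimitsOfShape J (indiscrete S L) where
  preservesColimit {F} := ⟨fun {c} hc => ⟨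
    { desc := fun s => ⟨hc.desc ((forget S L).mapCocone s), isEmptyElim, fun R => by
        obtain ⟨k, hk⟩ := rel_factors_map_desc hL hc s R
        exact ⟨k, hk.trans (id_comp _).symm⟩⟩
      fac := fun s j => Hom.ext (hc.fac ((forget S L).mapCocone s) j)
      uniq := fun s m hm => Hom.ext (hc.uniq ((forget S L).mapCocone s) _ fun j =>
        congrArg Hom.hom (hm j)) }⟩⟩

/-- The forgetful functor has the indiscrete structure as right adjoint, and this preserves
`κ`-filtered colimits; so the forgetful functor preserves presentability. -/
theorem Str.isCardinalPresentable_carrier (hL : L.IsAry κ) {B : Str S L}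
    (hB : IsCardinalPresentable B κ) : IsCardinalPresentable B.carrier κ where
  preservesColimitOfShape J _ _ := by
    have := hB.preservesColimitOfShape J
    have := preservesColimitsOfShape_indiscrete (S := S) hL (J := J)
    let e : indiscrete S L ⋙ coyoneda.obj (op B) ≅ coyoneda.obj (op B.carrier) :=
      NatIso.ofComponents (fun T => (homIndiscreteEquiv B T).toIso) fun {T U} g => rfl
    exact preservesColimitsOfShape_of_natIso e

variable [SymmetricCategory V]

/-- Every map of carriers into `T` is a morphism into the indiscrete structure on `T`, hence
determined by the generators. -/
theorem IsPresentation.epi {X : V} {φ : Conj L κ X} {B : Str S L} {x : X ⟶ B.carrier}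
    (hB : IsPresentation φ B x) : Epi x where
  left_cancellation {T} u v h := (Str.homIndiscreteEquiv B T).symm.injective
    (hB.hom_ext (K := (Str.indiscrete S L).obj T) h)

theorem exists_isTermCovering_of_isEmpty (hS : S.RightClosedUnderFilteredColimits κ)
    (hL : L.IsAry κ) {B : Str S L} (hB : HasPresentation κ B) :
    ∃ (X : V) (_ : IsCardinalPresentable X κ) (φ : Conj L κ X)
      (x : X ⟶ B.carrier), IsPresentation φ B x ∧ IsTermCovering κ B x := by
  obtain ⟨X, hX, φ, x, hx⟩ := hB
  have hC := Str.isCardinalPresentable_carrier hL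
    (hx.isEnrichedPresentable hS hL hX).isCardinalPresentable
  -- `B` is presented anew with its whole carrier as generators; then every family of elements is
  -- the value of a term `ofHom`, and the cover is the identity.
  refine ⟨B.carrier, hC, φ.subst hX hC x, 𝟙 _, ⟨(Conj.subst_sat_iff _ _ _ _ _ _).2 ?_,
    fun K a ha => ?_⟩, fun Z hZ g => ⟨Z, 𝟙 Z, .ofHom hC hZ g, hZ, inferInstance, ?_⟩⟩
  · rw [comp_id]
    exact hx.sat
  · obtain ⟨h, hh, huniq⟩ := hx.existsUnique K (x ≫ a) ((Conj.subst_sat_iff hX hC x _ _ _).1 ha)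
    have := hx.epi
    refine ⟨h, ?_, fun h' hh' => huniq h' ?_⟩
    · exact (id_comp _).trans ((cancel_epi x).1 hh)
    · exact congrArg (x ≫ ·) ((id_comp _).symm.trans hh')
  · rw [LTerm.ofHom_app, comp_id, id_comp]

end Relational

section

variable {V : Type u} [Category.{w} V] [MonoidalCategory V] [MonoidalClosed V]

theorem uncurry_curry' {X A : V} (x : X ⟶ A) : uncurry (curry' x) = (ρ_ X).hom ≫ x := by
  rw [curry', MonoidalClosed.uncurry_curry]

variable [SymmetricCategory V] [HasLimits V] [HasColimits V] {S : ProperFactorizationSystem V}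
  {L : Language.{w} V} {κ : Cardinal.{w}} [Fact κ.IsRegular]

theorem LTerm.pow_app {X Y Z : V} (hZ : IsCardinalPresentable Z κ) (t : LTerm L κ X Y)
    (A : Str S L) (x : X ⊗ Z ⟶ A.carrier) :
    (LTerm.pow Z hZ t).app A x = uncurry (curry x ≫ t.interp A) := by
  apply curry'_injective
  apply MonoidalClosed.uncurry_injective
  rw [curry'_app, interp, ← assoc, ← assoc, uncurry_comp_powerTensorIso_hom,
    MonoidalClosed.uncurry_natural_right, uncurry_curry'_comp_powerTensorIso_inv, assoc,
    MonoidalClosed.uncurry_natural_left, uncurry_curry', rightUnitor_tensor_hom, assoc]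

/-- Embeddings reflect quantifier-free formulas: monicity handles equations and `hm` handles
relations. -/
theorem Conj.sat_of_mono {X : V} (φ : Conj L κ X) {A B : Str S L} (m : A ⟶ B)
    [Mono (Str.Hom.hom m : A.carrier ⟶ B.carrier)]
    (hm : ∀ (R : L.Rel) {Q : V} (k : Q ⟶ (ihom (L.ar R)).obj A.carrier),
      (B.rel R).Factors (k ≫ (ihom (L.ar R)).map (Str.Hom.hom m)) → (A.rel R).Factors k)
    (x : X ⟶ A.carrier) (hx : φ.Sat B (x ≫ Str.Hom.hom m)) : φ.Sat A x := by
  rw [Conj.sat_iff] at hx ⊢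
  intro j
  replace hx := hx j
  revert hx
  rcases φ.atom j with ⟨s, t⟩ | ⟨R, Y, hY, t⟩
  · rw [Atomic.eq_sat_iff, Atomic.eq_sat_iff, LTerm.app_map, LTerm.app_map, cancel_mono]
    exact id
  · rw [Atomic.rel_sat_iff, Atomic.rel_sat_iff, LTerm.app_map, MonoidalClosed.curry_natural_right]
    exact hm R _

/-- The induced structure on a subobject closed under the function symbols. -/
abbrev Str.restrict {S₀ : ProperFactorizationSystem V} (B : Str S L)
    (D : MSubobject S₀ B.carrier)
    (k : ∀ f, (ihom (L.dom f)).obj D.obj ⟶ (ihom (L.cod f)).obj D.obj) : Str S L where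
  carrier := D.obj
  func := k
  rel R := (B.rel R).pullback ((ihom (L.ar R)).map D.arrow)

theorem IsPresentation.of_iso {X : V} {φ : Conj L κ X} {A B : Str S L} {x : X ⟶ A.carrier}
    (hA : IsPresentation φ A x) (i : A ≅ B) : IsPresentation φ B (x ≫ Str.Hom.hom i.hom) where
  sat := Conj.Sat.map hA.sat i.hom
  existsUnique K a ha := by
    obtain ⟨h, rfl, huniq⟩ := hA.existsUnique K a ha
    refine ⟨i.inv ≫ h, ?_, fun h' hh' => ?_⟩
    · dsimp only
      rw [assoc, ← Str.comp_hom, Iso.hom_inv_id_assoc]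
    · rw [Iso.eq_inv_comp]
      exact huniq _ ((assoc _ _ _).symm.trans hh')

instance : (HasPresentation κ : ObjectProperty (Str S L)).IsClosedUnderIsomorphisms where
  of_iso := fun i ⟨X, hX, φ, _, hx⟩ => ⟨X, hX, φ, _, hx.of_iso i⟩

end

/-! ### Languages with function symbols: covering by term values -/

section Functional

variable {V : Type u} [Category.{w} V] [MonoidalCategory V]

/-- The pullback of `P` along `k` is a monomorphism hit by every map from a presentable object,
hence invertible. -/
theorem MSubobject.factors_of_presentable {κ : Cardinal.{w}} [Fact κ.IsRegular]
    [IsLocallyPresentableAsClosed V κ] {S : ProperFactorizationSystem V} {Q T : V}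
    (P : MSubobject S T) (k : Q ⟶ T) (h : ∀ (X : V) (_ : IsCardinalPresentable X κ) (g : X ⟶ Q),
      P.Factors (g ≫ k)) : P.Factors k := by
  have : IsIso (P.pullback k).arrow := isIso_of_mono_of_presentable κ _ fun X hX g =>
    (pullback_factors_iff _ _ _).2 (h X hX g)
  have h := (pullback_factors_iff k P _).1 (P.pullback k).factors_arrow
  rwa [factors_iso_comp_iff] at h

variable [MonoidalClosed V] [SymmetricCategory V] {κ : Cardinal.{w}} [Fact κ.IsRegular]
  [IsLocallyPresentableAsClosed V κ] {S : ProperFactorizationSystem V} {L : Language.{w} V}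

/-- The values of terms on the objects of a small set form a small family. -/
theorem exists_family_of_values {G : Set V} [Small.{w} G] {Y : V} (B : Str S L)
    (y : Y ⟶ B.carrier) : ∃ (I : Type w) (Z : I → V) (v : ∀ i, Z i ⟶ B.carrier),
      (∀ i, ∃ t : LTerm L κ Y (Z i), t.app B y = v i) ∧
      ∀ W ∈ G, ∀ t : LTerm L κ Y W, ∃ (i : I) (l : W ⟶ Z i), l ≫ v i = t.app B y := by
  -- Terms live in a larger universe, so the index records their values, which are morphisms and
  -- form a small type.
  let I := Σ Z : G, { g : Z.1 ⟶ B.carrier // ∃ t : LTerm L κ Y Z.1, t.app B y = g }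
  refine ⟨Shrink.{w} I, fun i => ((equivShrink I).symm i).1.1,
    fun i => ((equivShrink I).symm i).2.1, fun i => ((equivShrink I).symm i).2.2, fun W hW t => ?_⟩
  -- Stated for a variable index, so that the passage through `equivShrink` is a substitution.
  have h (a : I) (ha : a = ⟨⟨W, hW⟩, ⟨_, t, rfl⟩⟩) : ∃ l : W ⟶ a.1.1, l ≫ a.2.1 = t.app B y := by
    subst ha
    exact ⟨𝟙 _, id_comp _⟩
  exact ⟨equivShrink I ⟨⟨W, hW⟩, ⟨_, t, rfl⟩⟩, h _ ((equivShrink I).symm_apply_apply _)⟩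

/-- A presentable object maps into fewer than `κ` summands, and the corresponding terms are
assembled by `LTerm.family`. -/
theorem exists_term_of_sigma {Y : V} (hY : IsCardinalPresentable Y κ) {B : Str S L}
    {y : Y ⟶ B.carrier} {I : Type w} {Z : I → V} (hZ : ∀ i, IsCardinalPresentable (Z i) κ)
    {v : ∀ i, Z i ⟶ B.carrier} (hv : ∀ i, ∃ t : LTerm L κ Y (Z i), t.app B y = v i) {X : V}
    (hX : IsCardinalPresentable X κ) (l : X ⟶ ∐ Z) :
    ∃ t : LTerm L κ Y X, t.app B y = l ≫ Sigma.desc v := by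
  obtain ⟨K, hK, k, r, rfl⟩ := exists_factor_subcoproduct Z κ hX l
  choose t ht using hv
  refine ⟨(LTerm.family hY hK (fun a => Z (k a)) fun a => t (k a)).comp
    (.ofHom (isCardinalPresentable_sigma hK _ fun a => hZ (k a)) hX r), ?_⟩
  rw [LTerm.comp_app, LTerm.ofHom_app, assoc]
  congr 1
  refine Sigma.hom_ext _ _ fun a => ?_
  rw [LTerm.ι_family_app, ht, Sigma.ι_desc_assoc, Sigma.ι_desc]

variable {S₀ : ProperFactorizationSystem V} {G : Set V}

/-- The image was built from terms with output arity in `G` only; other presentable arities are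
covered by these, and membership is tested on covers. -/
theorem image_factors_app {Y : V} {B : Str S L} {y : Y ⟶ B.carrier} {I : Type w} {Z : I → V}
    {v : ∀ i, Z i ⟶ B.carrier} (hG : S₀.IsLeftGenerator κ G)
    (hv : ∀ W ∈ G, ∀ t : LTerm L κ Y W, ∃ (i : I) (l : W ⟶ Z i), l ≫ v i = t.app B y) {X : V}
    (hX : IsCardinalPresentable X κ) (t : LTerm L κ Y X) :
    (MSubobject.image S₀ (Sigma.desc v)).Factors (t.app B y) := by
  obtain ⟨e, -, he⟩ := MSubobject.exists_left_image (S := S₀) (Sigma.desc v)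
  obtain ⟨W, hW, e', he'⟩ := hG.2.2 X hX
  obtain ⟨i, l, hl⟩ := hv W hW (t.comp (.ofHom hX (hG.2.1 W hW) e'))
  rw [← MSubobject.factors_left_comp_iff he']
  refine ⟨l ≫ Sigma.ι Z i ≫ e, ?_⟩
  rw [assoc, assoc, he, Sigma.ι_desc, hl, LTerm.comp_app, LTerm.ofHom_app]

/-- The image of the term values is closed under `f`. Stability allows testing on the power of the
coproduct instead of the image, where presentable families are values of terms; applying a power of
`f` gives another term. -/
theorem power_image_factors_func {Y : V} (hY : IsCardinalPresentable Y κ) {B : Str S L}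
    {y : Y ⟶ B.carrier} {I : Type w} {Z : I → V} {v : ∀ i, Z i ⟶ B.carrier} (hL : L.IsAry κ)
    (hG : S₀.IsLeftGenerator κ G) (hZ : ∀ i, IsCardinalPresentable (Z i) κ)
    (hv : ∀ i, ∃ t : LTerm L κ Y (Z i), t.app B y = v i)
    (hv' : ∀ W ∈ G, ∀ t : LTerm L κ Y W, ∃ (i : I) (l : W ⟶ Z i), l ≫ v i = t.app B y)
    (f : L.Func) (hf : S₀.IsLeftStable (L.dom f)) :
    ((MSubobject.image S₀ (Sigma.desc v)).power (L.cod f)).Factors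
      ((ihom (L.dom f)).map (MSubobject.image S₀ (Sigma.desc v)).arrow ≫ B.func f) := by
  obtain ⟨e, he, he'⟩ := MSubobject.exists_left_image (S := S₀) (Sigma.desc v)
  rw [← MSubobject.factors_left_comp_iff (hf e he), ← assoc, ← Functor.map_comp, he']
  refine MSubobject.factors_of_presentable (κ := κ) _ _ fun X hX g => ?_
  rw [MSubobject.power_factors_iff]
  obtain ⟨t, ht⟩ := exists_term_of_sigma hY hZ hv
    (IsLocallyPresentableAsClosed.presentable_tensor _ _ (hL.dom f) hX) (uncurry g)
  have := image_factors_app hG hv'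
    (IsLocallyPresentableAsClosed.presentable_tensor _ _ (hL.cod f) hX)
    (t.comp (.pow X hX (.symb f)))
  rwa [LTerm.comp_app, LTerm.pow_app, ht, MonoidalClosed.curry_natural_right,
    MonoidalClosed.curry_uncurry, LTerm.interp, assoc] at this

theorem IsPresentation.isTermCovering (hL : L.IsAry κ) (hG : S₀.IsLeftGenerator κ G)
    (hG' : ∀ X ∈ G, S₀.IsLeftProjective X) (hst : ∀ f, S₀.IsLeftStable (L.dom f)) {Y : V}
    (hY : IsCardinalPresentable Y κ) {φ : Conj L κ Y} {B : Str S L} {y : Y ⟶ B.carrier}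
    (hB : IsPresentation φ B y) : IsTermCovering κ B y := by
  have := hG.1
  obtain ⟨I, Z, v, hv, hv'⟩ := exists_family_of_values (L := L) (κ := κ) (G := G) B y
  have hZ (i) : IsCardinalPresentable (Z i) κ := by
    obtain ⟨t, -⟩ := hv i
    exact (t.isCardinalPresentable hL).2
  -- The image is taken for `S₀`, whereas the relations induced on it are pullbacks and so remain in
  -- the right class of `S`.
  let D := MSubobject.image S₀ (Sigma.desc v)
  choose k hk using fun f : L.Func => power_image_factors_func (κ := κ) hY hL hG hZ hv hv' f (hst f)
  let A : Str S L := B.restrict D k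
  let m : A ⟶ B := ⟨D.arrow, hk, fun R =>
    (MSubobject.pullback_factors_iff _ _ _).1 (MSubobject.factors_arrow _)⟩
  have : Mono (Str.Hom.hom m : A.carrier ⟶ B.carrier) := inferInstanceAs (Mono D.arrow)
  obtain ⟨(y' : Y ⟶ A.carrier), (hy' : y' ≫ Str.Hom.hom m = y)⟩ : D.Factors y := by
    have := image_factors_app hG hv' hY (.ofHom hY hY (𝟙 Y))
    rwa [LTerm.ofHom_app, id_comp] at this
  have sat : φ.Sat A y' := Conj.sat_of_mono φ m
    (fun R _ k h => (MSubobject.pullback_factors_iff _ _ _).2 h) y' (by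
      rw [hy']
      exact hB.sat)
  obtain ⟨r, hr, -⟩ := hB.existsUnique A y' sat
  -- The substructure contains the generators and inherits `φ`, so the universal property of `B`
  -- retracts the inclusion: the term values exhaust `B`.
  have hrm : r ≫ m = 𝟙 B := hB.hom_ext (by
    rw [Str.comp_hom, ← assoc, hr, hy', Str.id_hom, comp_id])
  intro X hX g
  obtain ⟨W, hW, e₁, he₁⟩ := hG.2.2 X hX
  obtain ⟨e, he, he'⟩ := MSubobject.exists_left_image (S := S₀) (Sigma.desc v)
  -- Projectivity lifts the covered family from the image to the coproduct of term values, where it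
  -- becomes the value of a single term.
  obtain ⟨l, hl⟩ := hG' W hW e he (e₁ ≫ g ≫ Str.Hom.hom r)
  obtain ⟨t, ht⟩ := exists_term_of_sigma hY hZ hv (hG.2.1 W hW) l
  refine ⟨W, e₁, t, hG.2.1 W hW, S₀.epi_of_left _ he₁, ?_⟩
  have hrm' : Str.Hom.hom r ≫ D.arrow = 𝟙 B.carrier := congrArg Str.Hom.hom hrm
  dsimp only at hl
  rw [ht, ← he', ← assoc, hl, assoc, assoc]
  exact (congrArg (e₁ ≫ g ≫ ·) hrm').trans (congrArg (e₁ ≫ ·) (comp_id g))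

end Functional

/-! ### Presentable structures have presentations; orthogonality classes are axiomatized -/

section Main

variable {V : Type u} [Category.{w} V] [MonoidalCategory V] [MonoidalClosed V]
  [SymmetricCategory V] {κ : Cardinal.{w}} [Fact κ.IsRegular]
  [IsLocallyPresentableAsClosed V κ] {S : ProperFactorizationSystem V} {L : Language.{w} V}
  (hS : S.RightClosedUnderFilteredColimits κ) (hL : L.IsAry κ)

include hS hL

theorem HasPresentation.exists_isTermCovering {S₀ : ProperFactorizationSystem V}
    (hC : ComparisonAssumption κ S₀ S L) {B : Str S L} (hB : HasPresentation κ B) :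
    ∃ (X : V) (_ : IsCardinalPresentable X κ) (φ : Conj L κ X)
      (x : X ⟶ B.carrier), IsPresentation φ B x ∧ IsTermCovering κ B x := by
  rcases hC.relational_or_stable with _ | ⟨hdom, -, G, hG, hG'⟩
  · exact exists_isTermCovering_of_isEmpty hS hL hB
  · obtain ⟨X, hX, φ, x, hx⟩ := hB
    exact ⟨X, hX, φ, x, hx, hx.isTermCovering hL hG hG' hdom hX⟩

/-- Presentable objects are the closure of a strong generator of presentables under `κ`-small
colimits, and having a presentation passes to such colimits by the term coverings. -/
theorem Str.IsEnrichedPresentable.hasPresentation {S₀ : ProperFactorizationSystem V}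
    (hC : ComparisonAssumption κ S₀ S L) {B : Str S L} (hB : IsEnrichedPresentable κ B) :
    HasPresentation κ B := by
  have := Str.hasColimitsOfSize κ S hL
  obtain ⟨Q, _, hQ, hQ'⟩ := Str.exists_strongGenerator (S := S) (κ := κ) hL
  have hpres : Q ≤ CategoryTheory.isCardinalPresentable (Str S L) κ := fun A hA => by
    obtain ⟨X, hX, φ, x, hx⟩ := hQ' A hA
    exact (hx.isEnrichedPresentable hS hL hX).isCardinalPresentable
  have h := hB.isCardinalPresentable
  rw [← isCardinalPresentable_iff, IsStrongGenerator.colimitsCardinalClosure_eq_isCardinalPresentable hQ hpres] at h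
  refine ObjectProperty.colimitsCardinalClosure_le Q κ (Q := HasPresentation κ)
    (fun J _ hJ => ⟨fun A ⟨p⟩ => ?_⟩) hQ' _ h
  exact hasPresentation_of_isColimit hJ p.isColimit fun j =>
    (p.prop_diag_obj j).exists_isTermCovering hS hL hC

theorem Str.IsOrthogonalityClass.exists_limitTheory {S₀ : ProperFactorizationSystem V}
    (hC : ComparisonAssumption κ S₀ S L) {K : ObjectProperty (Str S L)}
    (hK : Str.IsOrthogonalityClass κ K) : ∃ T : LimitTheory L κ, K = T.Mod S := by
  obtain ⟨I, A, B, h, hpres, hK⟩ := hK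
  have hτ (i : I) : ∃ τ : LimitSequent L κ, ∀ K : Str S L, IsOrthogonalTo (h i) K ↔ τ.Holds K := by
    obtain ⟨X, hX, φ, x, hx, -⟩ :=
      ((hpres i).1.hasPresentation hS hL hC).exists_isTermCovering hS hL hC
    obtain ⟨Y, hY, χ, y, hy, hcov⟩ :=
      ((hpres i).2.hasPresentation hS hL hC).exists_isTermCovering hS hL hC
    -- The images under `h i` of the generators of the source become, up to the cover `e`, terms in
    -- the generators `y` of the target.
    obtain ⟨G, e, t, hG, he, ht⟩ := hcov X hX (x ≫ Hom.hom (h i))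
    have hXY := isCardinalPresentable_coprod hX hY
    let τ : LimitSequent L κ := ⟨X, Y, hX, hY, φ, (χ.subst hY hXY coprod.inr).and
      (Atomic.toConj (.eq (.ofHom hXY hG (e ≫ coprod.inl))
        (.comp (.ofHom hXY hY coprod.inr) t)))⟩
    have hbody (K : Str S L) (a : X ⨿ Y ⟶ K.carrier) : τ.body.Sat K a ↔
        (χ.Sat K (coprod.inr ≫ a) ∧ e ≫ coprod.inl ≫ a = t.app K (coprod.inr ≫ a)) ∧
          φ.Sat K (coprod.inl ≫ a) := by
      simp only [LimitSequent.body, τ, Conj.and_sat_iff, Conj.subst_sat_iff, Atomic.toConj_sat_iff,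
        Atomic.eq_sat_iff, LTerm.ofHom_app, LTerm.comp_app, assoc]
    refine ⟨τ, fun K => (τ.isOrthogonalTo_iff (z := coprod.desc (x ≫ Hom.hom (h i)) y) hx
      ⟨(hbody _ _).2 ?_, fun K a ha => ?_⟩ (h i) ?_ K)⟩
    · rw [coprod.inl_desc, coprod.inr_desc]
      exact ⟨⟨hy.sat, ht.symm⟩, Conj.Sat.map hx.sat (h i)⟩
    · obtain ⟨⟨h₁, h₂⟩, -⟩ := (hbody K a).1 ha
      obtain ⟨k, hk, huniq⟩ := hy.existsUnique K _ h₁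
      refine ⟨k, coprod.hom_ext ?_ ?_, fun k' hk' => huniq k' ?_⟩
      -- Since `e` is epic, the equation forces the `x`-part of a solution to be the image of the
      -- generators under the map determined by the `y`-part; so the enlarged presentation still
      -- presents the target.
      · rw [← cancel_epi e, h₂, ← hk, LTerm.app_map, ht, coprod.inl_desc_assoc, assoc, assoc,
          assoc]
      · rw [coprod.inr_desc_assoc, hk]
      · rw [← hk', coprod.inr_desc_assoc]
    · rw [coprod.inl_desc]
  choose τ hτ using hτ
  refine ⟨⟨Set.range τ, small_range _⟩, ?_⟩
  ext K
  rw [hK]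
  simp_rw [hτ]
  exact ⟨fun H _ ⟨i, hi⟩ => hi ▸ H i, fun H i => H _ ⟨i, rfl⟩⟩

end Main

end EnrichedLogic

end

open EnrichedLogic

theorem mainTheorem2 {V : Type u} [Category.{w} V] [MonoidalCategory V] [SymmetricCategory V]
    [MonoidalClosed V] (κ : Cardinal.{w}) [Fact κ.IsRegular] [IsLocallyPresentableAsClosed V κ]
    (S : ProperFactorizationSystem V) (hS : S.RightClosedUnderFilteredColimits κ)
    (L : EnrichedLogic.Language.{w} V) (hL : L.IsAry κ) (𝒦 : ObjectProperty (Str S L)) :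
    ((∃ T : LimitTheory L κ, 𝒦 = T.Mod S) → Str.IsOrthogonalityClass κ 𝒦) ∧
    ((∃ S₀ : ProperFactorizationSystem V, ComparisonAssumption κ S₀ S L) →
      Str.IsOrthogonalityClass κ 𝒦 → ∃ T : LimitTheory L κ, 𝒦 = T.Mod S) := by
  refine ⟨?_, ?_⟩
  · rintro ⟨T, rfl⟩
    exact T.isOrthogonalityClass_mod hS hL
  · rintro ⟨S₀, hC⟩ h𝒦
    exact h𝒦.exists_limitTheory hS hL hC
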